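/- Let $J=\begin{pmatrix}0&-1\\1&0\end{pmatrix}$ and let $W:\mathbb R\to\mathbb R^{2\times 2}$ satisfy $W=W^t$ almost everywhere and $W\in L^1_{\rm loc}(\mathbb R)$. Let $Ly=-Jy'-Wy$ be the associated Dirac operator on $L^2(\mathbb R;\mathbb C^2)$, with domain the set of all locally absolutely continuous $y\in L^2$ with $Jy'+Wy\in L^2$. For $z\in\mathbb C^+=\{z\in\mathbb C:\operatorname{Im}z>0\}$ let $y_\pm(\cdot,z)$ be the solution of $Jy'+Wy=-zy$, unique up to a constant factor, that is nontrivial and square integrable on $\pm x>0$; let $m_\pm(z)=\pm y_{\pm,1}(0,z)/y_{\pm,2}(0,z)$ and $$M(z)=\frac{-1}{m_+(z)+m_-(z)}\begin{pmatrix}-2m_+(z)m_-(z)&m_+(z)-m_-(z)\\ m_+(z)-m_-(z)&2\end{pmatrix}.$$ For a matrix $A\in\mathbb C^{2\times2}$ with spectrum in $\Omega=\mathbb C\setminus\{-iy:y\ge0\}$, let $\log A$ be the primary matrix function of the holomorphic branch of $\log$ on $\Omega$ with $\log 1=0$ (so $0<\operatorname{Im}\log w<\pi$ for $w\in\mathbb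 C^+$), let $\operatorname{Im}B=(B-B^*)/(2i)$, and define the Krein function $$\xi(t)=\frac1\pi\lim_{y\to0+}\operatorname{Im}\log M(t+iy)$$ at all $t\in\mathbb R$ at which this limit exists. For a Borel set $E\subseteq\mathbb R$, $W$ is called reflectionless on $E$ if $m_+(t)=-\overline{m_-(t)}$ for (Lebesgue) almost every $t\in E$, where $m_\pm(t)=\lim_{y\to0+}m_\pm(t+iy)$. Then: (a) $\xi(t)$ exists for almost every $t\in\mathbb R$, and $\operatorname{tr}\xi(t)=1$ for every $t$ at which it exists. (b) For every Borel set $E\subseteq\mathbb R$, $W$ is reflectionless on $E$ if and only if $\xi(t)=\frac12 I$ for almost every $t\in E$. (c) For every $t\in\mathbb R\setminus\sigma(L)$, $\xi(t)$ exists and there is $\alpha=\alpha(t)\in\mathbb R$ with $$\xi(t)=P_\alpha=\begin{pmatrix}\cos^2\alpha&\sin\alpha\cos\alpha\\ \sin\alpha\cos\alpha&\sin^2\alpha\end{pmatrix}.$$ -/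

import Mathlib

open MeasureTheory Filter Topology

noncomputable section

namespace Dirac

/-! ### The Dirac differential expression -/

/-- The space `ℂ²` with its Euclidean norm. -/
abbrev C2 : Type := EuclideanSpace ℂ (Fin 2)

/-- The Hilbert space `L²(ℝ; ℂ²)`. -/
abbrev L2 : Type := Lp C2 2 (volume : Measure ℝ)

/-- `J = (0 -1; 1 0)`. -/
def J : Matrix (Fin 2) (Fin 2) ℂ := !![0, -1; 1, 0]

/-- The coefficient functions: real symmetric `2 × 2` matrix functions on the line with locally
integrable entries. -/
structure IsCoefficient (W : ℝ → Matrix (Fin 2) (Fin 2) ℝ) : Prop where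
  symm : ∀ᵐ x, (W x).IsSymm
  locallyIntegrable : ∀ i j, LocallyIntegrable (fun x => W x i j) volume

/-- `y` is (locally) absolutely continuous on the line. -/
def LocallyAC (y : ℝ → C2) : Prop := ∀ a b : ℝ, AbsolutelyContinuousOnInterval y a b

/-- The differential expression `-J y' - W y`. -/
def expr (W : ℝ → Matrix (Fin 2) (Fin 2) ℝ) (y : ℝ → C2) (x : ℝ) : C2 :=
  WithLp.toLp 2 (-(J.mulVec (deriv y x).ofLp) -
    ((W x).map (fun r : ℝ => (r : ℂ))).mulVec (y x).ofLp)

/-! ### The Titchmarsh-Weyl functions and the `M` matrix -/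

/-- `y` solves the Dirac equation `J y' + W y = -z y`, that is, `-J y' - W y = z y`. -/
def IsSolution (W : ℝ → Matrix (Fin 2) (Fin 2) ℝ) (z : ℂ) (y : ℝ → C2) : Prop :=
  LocallyAC y ∧ ∀ᵐ x, expr W y x = z • y x

/-- `y` is a nontrivial solution of the Dirac equation that is square integrable on `s`. -/
def IsWeylSolution (W : ℝ → Matrix (Fin 2) (Fin 2) ℝ) (z : ℂ) (s : Set ℝ) (y : ℝ → C2) : Prop :=
  IsSolution W z y ∧ y ≠ 0 ∧ MemLp y 2 (volume.restrict s)

/-- A nontrivial solution that is square integrable on `s`. For `z` in the upper half plane and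
`s` a half line, such a solution exists and is unique up to a constant factor. -/
def weylSolution (W : ℝ → Matrix (Fin 2) (Fin 2) ℝ) (z : ℂ) (s : Set ℝ) : ℝ → C2 :=
  Classical.epsilon (IsWeylSolution W z s)

/-- `m₊(z) = y₊(0,z)`, a vector `(y₁, y₂)` being identified with `y₁ / y₂`. -/
def mPlus (W : ℝ → Matrix (Fin 2) (Fin 2) ℝ) (z : ℂ) : ℂ :=
  weylSolution W z (Set.Ioi 0) 0 0 / weylSolution W z (Set.Ioi 0) 0 1

/-- `m₋(z) = -y₋(0,z)`, a vector `(y₁, y₂)` being identified with `y₁ / y₂`. -/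
def mMinus (W : ℝ → Matrix (Fin 2) (Fin 2) ℝ) (z : ℂ) : ℂ :=
  -(weylSolution W z (Set.Iio 0) 0 0 / weylSolution W z (Set.Iio 0) 0 1)

/-- The matrix valued Herglotz function `M(z)` of the Dirac operator. -/
def M (W : ℝ → Matrix (Fin 2) (Fin 2) ℝ) (z : ℂ) : Matrix (Fin 2) (Fin 2) ℂ :=
  (-1 / (mPlus W z + mMinus W z)) •
    !![-2 * mPlus W z * mMinus W z, mPlus W z - mMinus W z;
       mPlus W z - mMinus W z, 2]

/-- `W` is reflectionless on `A`: the boundary values satisfy `m₊(t) = -conj m₋(t)` for almost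
every `t ∈ A`. -/
def IsReflectionless (W : ℝ → Matrix (Fin 2) (Fin 2) ℝ) (A : Set ℝ) : Prop :=
  ∀ᵐ t : ℝ, t ∈ A → ∃ a b : ℂ,
    Tendsto (fun y : ℝ => mPlus W (t + y * Complex.I)) (𝓝[>] 0) (𝓝 a) ∧
    Tendsto (fun y : ℝ => mMinus W (t + y * Complex.I)) (𝓝[>] 0) (𝓝 b) ∧
    a = -(starRingEnd ℂ) b

/-! ### The matrix logarithm and the Krein function -/

/-- The branch of the logarithm that is holomorphic on `ℂ ∖ {-iy : y ≥ 0}` with `log 1 = 0`;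
it maps the upper half plane to the strip `0 < Im < π`. -/
def logBranch (w : ℂ) : ℂ := Complex.log (-Complex.I * w) + (Real.pi / 2 : ℂ) * Complex.I

/-- A square root of the discriminant of the characteristic polynomial of `A`. -/
def sqrtDisc (A : Matrix (Fin 2) (Fin 2) ℂ) : ℂ := (A.trace ^ 2 - 4 * A.det) ^ (1 / 2 : ℂ)

/-- One eigenvalue of `A`. -/
def eig₁ (A : Matrix (Fin 2) (Fin 2) ℂ) : ℂ := (A.trace + sqrtDisc A) / 2

/-- The other eigenvalue of `A` (equal to the first one if that is a double root of the
characteristic polynomial). -/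
def eig₂ (A : Matrix (Fin 2) (Fin 2) ℂ) : ℂ := (A.trace - sqrtDisc A) / 2

/-- The matrix logarithm `log A`, as the primary matrix function of `logBranch`: the value at `A` of
the polynomial `log λ₁ + log[λ₁, λ₂] (X - λ₁)` that interpolates `log` at the eigenvalues of `A`.
The divided difference `log[λ₁, λ₂] = dslope log λ₁ λ₂` is `(log λ₂ - log λ₁) / (λ₂ - λ₁)` if
`λ₁ ≠ λ₂`, and the derivative `log' λ₁` if `λ₁ = λ₂` (so the Jordan form is treated as usual).
If `A v = λ v` then `(log A) v = (log λ) v`; see `matLog_mulVec`. -/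
def matLog (A : Matrix (Fin 2) (Fin 2) ℂ) : Matrix (Fin 2) (Fin 2) ℂ :=
  logBranch (eig₁ A) • (1 : Matrix (Fin 2) (Fin 2) ℂ) +
    dslope logBranch (eig₁ A) (eig₂ A) • (A - eig₁ A • (1 : Matrix (Fin 2) (Fin 2) ℂ))

/-- `Im B = (B - B*) / (2i)`. -/
def matIm (B : Matrix (Fin 2) (Fin 2) ℂ) : Matrix (Fin 2) (Fin 2) ℂ :=
  (1 / (2 * Complex.I)) • (B - B.conjTranspose)

/-- The function `(1/π) Im log M(z)`, whose boundary value is the Krein function. -/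
def kreinApprox (W : ℝ → Matrix (Fin 2) (Fin 2) ℝ) (z : ℂ) : Matrix (Fin 2) (Fin 2) ℂ :=
  (1 / Real.pi : ℂ) • matIm (matLog (M W z))

/-- The Krein function `ξ(t) = (1/π) lim_{y → 0+} Im log M(t+iy)`. -/
def krein (W : ℝ → Matrix (Fin 2) (Fin 2) ℝ) (t : ℝ) : Matrix (Fin 2) (Fin 2) ℂ :=
  limUnder (𝓝[>] (0 : ℝ)) (fun y : ℝ => kreinApprox W (t + y * Complex.I))

/-- The limit that defines the Krein function at `t` exists. -/
def KreinExistsAt (W : ℝ → Matrix (Fin 2) (Fin 2) ℝ) (t : ℝ) : Prop :=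
  ∃ X : Matrix (Fin 2) (Fin 2) ℂ,
    Tendsto (fun y : ℝ => kreinApprox W (t + y * Complex.I)) (𝓝[>] 0) (𝓝 X)

/-- The orthogonal projection `P_α` onto the line spanned by `(cos α, sin α)`. -/
def proj (α : ℝ) : Matrix (Fin 2) (Fin 2) ℝ :=
  !![Real.cos α ^ 2, Real.sin α * Real.cos α; Real.sin α * Real.cos α, Real.sin α ^ 2]

/-- The eigenvector property of the matrix logarithm. -/
theorem matLog_mulVec (A : Matrix (Fin 2) (Fin 2) ℂ) (l : ℂ) (v : Fin 2 → ℂ) (hv : v ≠ 0)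
    (h : A.mulVec v = l • v) : (matLog A).mulVec v = logBranch l • v := by
  have hs : sqrtDisc A ^ 2 = A.trace ^ 2 - 4 * A.det := by
    unfold sqrtDisc
    rw [← Complex.cpow_nat_mul]
    norm_num
  have hsum : eig₁ A + eig₂ A = A.trace := by unfold eig₁ eig₂; ring
  have hprod : eig₁ A * eig₂ A = A.det := by
    unfold eig₁ eig₂
    linear_combination (-1 / 4) * hs
  have h0 := congrFun h 0
  have h1 := congrFun h 1
  simp only [Matrix.mulVec, dotProduct, Fin.sum_univ_two, Pi.smul_apply, smul_eq_mul] at h0 h1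
  rw [Matrix.trace_fin_two] at hsum
  rw [Matrix.det_fin_two] at hprod
  have hl : (l - eig₁ A) * (l - eig₂ A) = 0 := by
    have key : ∀ i, (l - eig₁ A) * (l - eig₂ A) * v i = 0 := by
      intro i
      fin_cases i
      · simp only [Fin.zero_eta]
        linear_combination (-l + A 1 1) * h0 - A 0 1 * h1 - l * v 0 * hsum + v 0 * hprod
      · simp only [Fin.mk_one]
        linear_combination (-l + A 0 0) * h1 - A 1 0 * h0 - l * v 1 * hsum + v 1 * hprod
    by_contra hne
    apply hv
    funext i
    exact (mul_eq_zero.1 (key i)).resolve_left hne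
  have hlog : logBranch (eig₁ A) + dslope logBranch (eig₁ A) (eig₂ A) * (l - eig₁ A)
      = logBranch l := by
    rcases mul_eq_zero.1 hl with e | e
    · rw [e, sub_eq_zero.1 e]; simp
    · rw [← sub_eq_zero.1 e]
      have := sub_smul_dslope logBranch (eig₁ A) l
      rw [smul_eq_mul] at this
      linear_combination this
  unfold matLog
  rw [Matrix.add_mulVec, Matrix.smul_mulVec, Matrix.smul_mulVec, Matrix.sub_mulVec,
    Matrix.smul_mulVec, Matrix.one_mulVec, h, ← hlog]
  simp only [smul_smul, ← sub_smul, ← add_smul]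

/-! ### The Dirac operator and its spectrum -/

theorem LocallyAC.continuous {y : ℝ → C2} (hy : LocallyAC y) : Continuous y := by
  rw [continuous_iff_continuousAt]
  intro x
  refine (hy (x - 1) (x + 1)).continuousOn.continuousAt ?_
  rw [Set.uIcc_of_le (by linarith)]
  exact Icc_mem_nhds (by linarith) (by linarith)

theorem LocallyAC.ae_differentiableAt {y : ℝ → C2} (hy : LocallyAC y) :
    ∀ᵐ x, DifferentiableAt ℝ y x := by
  have : FiniteDimensional ℝ C2 := FiniteDimensional.trans ℝ ℂ C2
  apply LocallyBoundedVariationOn.ae_differentiableAt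
  intro a b _ _
  exact (hy a b).boundedVariationOn.mono
    (Set.inter_subset_right.trans Set.Icc_subset_uIcc)

theorem LocallyAC.add {y u : ℝ → C2} (hy : LocallyAC y) (hu : LocallyAC u) :
    LocallyAC (y + u) := fun a b => (hy a b).add (hu a b)

theorem LocallyAC.zero : LocallyAC 0 := by
  intro a b
  rw [absolutelyContinuousOnInterval_iff]
  intro ε hε
  exact ⟨1, one_pos, fun E _ _ => by simpa using hε⟩

theorem LocallyAC.smul {y : ℝ → C2} (c : ℂ) (hy : LocallyAC y) : LocallyAC (c • y) := by
  intro a b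
  have h := Tendsto.const_mul ‖c‖ (hy a b)
  rw [mul_zero] at h
  refine h.congr fun E => ?_
  rw [Finset.mul_sum]
  refine Finset.sum_congr rfl fun i _ => ?_
  rw [Pi.smul_apply, Pi.smul_apply, dist_smul₀]

/-- The graph of the Dirac operator `L`: the pairs `(y, -J y' - W y)` of elements of `L²(ℝ; ℂ²)`
with `y` absolutely continuous. -/
def graph (W : ℝ → Matrix (Fin 2) (Fin 2) ℝ) : Submodule ℂ (L2 × L2) where
  carrier := {p | ∃ y : ℝ → C2, LocallyAC y ∧ p.1 =ᵐ[volume] y ∧ p.2 =ᵐ[volume] expr W y}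
  zero_mem' := by
    refine ⟨0, LocallyAC.zero, Lp.coeFn_zero _ _ _, ?_⟩
    filter_upwards [Lp.coeFn_zero C2 2 (volume : Measure ℝ)] with x hx
    have hd : deriv (0 : ℝ → C2) x = 0 := by
      rw [show (0 : ℝ → C2) = fun _ => 0 from rfl, deriv_const]
    simp [expr, hd]
  add_mem' := by
    rintro p q ⟨y, hy, hp1, hp2⟩ ⟨u, hu, hq1, hq2⟩
    refine ⟨y + u, hy.add hu, ?_, ?_⟩
    · exact (Lp.coeFn_add _ _).trans (hp1.add hq1)
    · filter_upwards [Lp.coeFn_add p.2 q.2, hp2, hq2, hy.ae_differentiableAt,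
        hu.ae_differentiableAt] with x h1 h2 h3 h4 h5
      rw [Prod.snd_add, h1, Pi.add_apply, h2, h3]
      unfold expr
      rw [deriv_add h4 h5, Pi.add_apply, ← WithLp.toLp_add]
      congr 1
      rw [WithLp.ofLp_add, WithLp.ofLp_add, Matrix.mulVec_add, Matrix.mulVec_add]
      abel
  smul_mem' := by
    rintro c p ⟨y, hy, hp1, hp2⟩
    refine ⟨c • y, hy.smul c, ?_, ?_⟩
    · exact (Lp.coeFn_smul c _).trans (hp1.const_smul c)
    · filter_upwards [Lp.coeFn_smul c p.2, hp2, hy.ae_differentiableAt] with x h1 h2 h3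
      rw [Prod.smul_snd, h1, Pi.smul_apply, h2]
      unfold expr
      rw [(h3.hasDerivAt.const_smul c).deriv, Pi.smul_apply, ← WithLp.toLp_smul]
      congr 1
      rw [WithLp.ofLp_smul, WithLp.ofLp_smul, Matrix.mulVec_smul, Matrix.mulVec_smul, smul_sub,
        smul_neg]

/-- The relation `graph W` is single valued. -/
theorem graph_snd_eq_zero (W : ℝ → Matrix (Fin 2) (Fin 2) ℝ) (p : L2 × L2) (hp : p ∈ graph W)
    (h0 : p.1 = 0) : p.2 = 0 := by
  obtain ⟨y, hy, h1, h2⟩ := hp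
  have hy0 : y = 0 := by
    refine (Continuous.ae_eq_iff_eq volume hy.continuous continuous_zero).1 ?_
    exact h1.symm.trans (by rw [h0]; exact Lp.coeFn_zero _ _ _)
  subst hy0
  refine Lp.ext ?_
  filter_upwards [h2, Lp.coeFn_zero C2 2 (volume : Measure ℝ)] with x hx _
  have hd : deriv (0 : ℝ → C2) x = 0 := by
    rw [show (0 : ℝ → C2) = fun _ => 0 from rfl, deriv_const]
  simp [hx, expr, hd]

/-- The Dirac operator `L y = -J y' - W y` on `L²(ℝ; ℂ²)`, with its natural maximal domain. -/
def diracOp (W : ℝ → Matrix (Fin 2) (Fin 2) ℝ) : L2 →ₗ.[ℂ] L2 := (graph W).toLinearPMap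

theorem diracOp_graph (W : ℝ → Matrix (Fin 2) (Fin 2) ℝ) : (diracOp W).graph = graph W :=
  Submodule.toLinearPMap_graph_eq _ (graph_snd_eq_zero W)

/-- The spectrum of an unbounded operator: the complement of the set of all `z` for which `A - z`
maps the domain bijectively onto the space, with a bounded inverse `R`. -/
def spectrumOp (A : L2 →ₗ.[ℂ] L2) : Set ℂ :=
  {z | ∃ R : L2 →L[ℂ] L2, (∀ f : L2, ∃ h : R f ∈ A.domain, A ⟨R f, h⟩ - z • R f = f) ∧
    ∀ u : A.domain, R (A u - z • (u : L2)) = u}ᶜ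

end Dirac

end

/-!
The functions `m₊` and `m₋` are Herglotz functions: existence of the Weyl solutions and
positivity of the imaginary parts come from the Lagrange identity (`exists_isWeylSolution_Ioi`,
`mPlus_im_pos`), and so does holomorphy (`differentiableAt_mPlus`); the left half line is
reduced to the right one by a reflection. The matrix `M(z)` is symmetric with determinant `-1`,
and its trace has nonnegative imaginary part. So its eigenvalues satisfy `λ₁ λ₂ = -1` and lie in
the closed upper half plane away from zero, where the logarithm is continuous. Since the matrix
logarithm is a symmetric function of the eigenvalues, `Im log` is continuous on the matrices
with these properties (`tendsto_im_log`), and `log λ₁ + log λ₂ = π i` gives the trace of the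
Krein function (`trace_krein`).

*Existence almost everywhere.* By Fatou's theorem, `m₊`, `m₋` and `m₊ + m₋` have boundary values
almost everywhere, and these are finite, with a nonzero value for the sum
(`ae_boundary_values`). At such points `M(t + iy)` converges, and hence so does
`Im log M(t + iy)`.

*Reflectionless sets.* For boundary values `a`, `b` of `m₊`, `m₋`, the condition `a = -conj b`
says that all entries of `M` are purely imaginary. For matrices as above, this is equivalent to
`Im log M = π / 2` (`im_matLog_of_re_eq_zero`, `re_eq_zero_of_im_matLog`).

*Off the spectrum.* If `t` is real and not in the spectrum, then the resolvent, applied to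
functions supported on one half line, produces the solutions at `t` that are square integrable
on the other one, and their values at `0` are continuous in the spectral parameter by
perturbation theory. So `M` converges, although `m₊` and `m₋` may have poles, to a real
symmetric matrix of determinant `-1`. It has one positive and one negative eigenvalue, and
`Im log / π` is the projection onto the eigenspace of the latter (`exists_proj_of_real`,
`krein_eq_proj`).
-/

noncomputable section

namespace Dirac

/-! ### Boundary values of holomorphic functions on the upper half plane -/

/-- A holomorphic function on the upper half plane has a primitive: the Cayley transform carries
the statement over to the unit disk. -/
theorem exists_primitive_upperHalfPlane {f : ℂ → ℂ}
    (hf : DifferentiableOn ℂ f {z : ℂ | 0 < z.im}) :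
    ∃ Φ : ℂ → ℂ, ∀ z : ℂ, 0 < z.im → HasDerivAt Φ (f z) z := by
  have hne : ∀ w ∈ Metric.ball (0 : ℂ) 1, 1 - w ≠ 0 := by
    intro w hw h
    rw [← sub_eq_zero.1 h] at hw
    simp at hw
  have hmaps : ∀ w ∈ Metric.ball (0 : ℂ) 1, 0 < (Complex.I * (1 + w) / (1 - w)).im := by
    intro w hw
    have h1 : ‖w‖ ^ 2 < 1 := by
      have : ‖w‖ < 1 := by simpa using hw
      nlinarith [norm_nonneg w]
    have h2 : 0 < Complex.normSq (1 - w) := Complex.normSq_pos.2 (hne w hw)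
    rw [Complex.sq_norm, Complex.normSq_apply] at h1
    rw [Complex.div_im, ← sub_div, div_pos_iff_of_pos_right h2]
    simp
    nlinarith
  have hd : DifferentiableOn ℂ
      (fun w : ℂ => f (Complex.I * (1 + w) / (1 - w)) * (2 * Complex.I / (1 - w) ^ 2))
      (Metric.ball 0 1) := by
    refine DifferentiableOn.mul (hf.comp ?_ hmaps) ?_
    · exact DifferentiableOn.div (by fun_prop) (by fun_prop) hne
    · exact DifferentiableOn.div (by fun_prop) (by fun_prop) fun w hw => pow_ne_zero 2 (hne w hw)
  obtain ⟨Ψ, hΨ⟩ := hd.isExactOn_ball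
  refine ⟨fun z => Ψ ((z - Complex.I) / (z + Complex.I)), fun z hz => ?_⟩
  have hzi : z + Complex.I ≠ 0 := by
    intro h
    have := congrArg Complex.im h
    simp at this
    linarith
  have hball : (z - Complex.I) / (z + Complex.I) ∈ Metric.ball (0 : ℂ) 1 := by
    rw [mem_ball_zero_iff, norm_div, div_lt_one (norm_pos_iff.2 hzi)]
    apply lt_of_pow_lt_pow_left₀ 2 (norm_nonneg _)
    rw [Complex.sq_norm, Complex.sq_norm, Complex.normSq_apply, Complex.normSq_apply]
    simp
    nlinarith
  have h1 : HasDerivAt (fun z : ℂ => (z - Complex.I) / (z + Complex.I))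
      (2 * Complex.I / (z + Complex.I) ^ 2) z := by
    have := ((hasDerivAt_id z).sub_const Complex.I).div ((hasDerivAt_id z).add_const Complex.I) hzi
    refine this.congr_deriv ?_
    simp only [id]
    ring
  have := (hΨ _ hball).comp z h1
  refine this.congr_deriv ?_
  have e1 : 1 - (z - Complex.I) / (z + Complex.I) = 2 * Complex.I / (z + Complex.I) := by
    field_simp; ring
  have e2 : Complex.I * (1 + (z - Complex.I) / (z + Complex.I)) /
      (1 - (z - Complex.I) / (z + Complex.I)) = z := by
    rw [e1]
    field_simp
    ring
  simp only [e2]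
  rw [e1]
  have hI := Complex.I_ne_zero
  field_simp

/-- The maximum principle, symmetrized under the rotations of a square. The bottom side of the
square with centre `ζ` and half side `b` may lie on the boundary of the domain of holomorphy. On
each side of the square, one of the four rotated copies of `Ψ` takes its values on the bottom
side, where `Ψ` is bounded by `A`, so the product of the four copies is bounded by `A * B ^ 3`.
This is a substitute for an estimate of harmonic measure. -/
theorem norm_pow_four_le_of_square {Ψ : ℂ → ℂ} {ζ : ℂ} {b A B : ℝ} (hb : 0 < b)
    (hcont : Continuous Ψ) (hd : DifferentiableOn ℂ Ψ {z : ℂ | ζ.im - b < z.im})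
    (hbot : ∀ z : ℂ, z.im = ζ.im - b → |z.re - ζ.re| ≤ b → ‖Ψ z‖ ≤ A)
    (hall : ∀ z : ℂ, |z.re - ζ.re| ≤ b → |z.im - ζ.im| ≤ b → ‖Ψ z‖ ≤ B) :
    ‖Ψ ζ‖ ^ 4 ≤ A * B ^ 3 := by
  set U : Set ℂ := Set.Ioo (-b) b ×ℂ Set.Ioo (-b) b with hU
  have hA : 0 ≤ A := by
    refine (norm_nonneg _).trans (hbot (ζ - b * Complex.I) ?_ ?_) <;> simp [hb.le]
  have hB : 0 ≤ B := by
    refine (norm_nonneg _).trans (hall ζ ?_ ?_) <;> simp [hb.le]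
  have hbd : Bornology.IsBounded U :=
    (Metric.isBounded_Ioo _ _).reProdIm (Metric.isBounded_Ioo _ _)
  have hop : IsOpen {z : ℂ | ζ.im - b < z.im} := isOpen_lt continuous_const Complex.continuous_im
  have hdiff : ∀ c : ℂ, (∀ w ∈ U, -b < (c * w).im) →
      DifferentiableOn ℂ (fun w => Ψ (ζ + c * w)) U := by
    intro c hc
    refine hd.comp (by fun_prop) ?_
    intro w hw
    have := hc w hw
    simp only [Set.mem_ofPred_eq, Complex.add_im]
    linarith
  have key : ∀ w ∈ closure U, |w.re| ≤ b ∧ |w.im| ≤ b := by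
    intro w hw
    rw [hU, Complex.closure_reProdIm, closure_Ioo (by linarith)] at hw
    exact ⟨abs_le.2 hw.1, abs_le.2 hw.2⟩
  have hp : DiffContOnCl ℂ (fun w => Ψ (ζ + 1 * w) * Ψ (ζ + Complex.I * w) * Ψ (ζ + (-1) * w) *
      Ψ (ζ + (-Complex.I) * w)) U := by
    refine ⟨(((hdiff _ ?_).mul (hdiff _ ?_)).mul (hdiff _ ?_)).mul (hdiff _ ?_), ?_⟩
    · intro w hw; simpa using hw.2.1
    · intro w hw; simpa using hw.1.1
    · intro w hw; simpa using hw.2.2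
    · intro w hw; simpa using hw.1.2
    · exact Continuous.continuousOn (by fun_prop)
  have h0 : (0 : ℂ) ∈ closure U := subset_closure (by simp [hU, Complex.mem_reProdIm, hb])
  have hfr : ∀ w ∈ frontier U, ‖Ψ (ζ + 1 * w) * Ψ (ζ + Complex.I * w) * Ψ (ζ + (-1) * w) *
      Ψ (ζ + (-Complex.I) * w)‖ ≤ A * B ^ 3 := by
    intro w hw
    obtain ⟨hr, hi⟩ := key w (frontier_subset_closure hw)
    have b1 : ‖Ψ (ζ + 1 * w)‖ ≤ B := hall _ (by simpa using hr) (by simpa using hi)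
    have b2 : ‖Ψ (ζ + Complex.I * w)‖ ≤ B := hall _ (by simpa using hi) (by simpa using hr)
    have b3 : ‖Ψ (ζ + (-1) * w)‖ ≤ B := hall _ (by simpa using hr) (by simpa using hi)
    have b4 : ‖Ψ (ζ + (-Complex.I) * w)‖ ≤ B := hall _ (by simpa using hi) (by simpa using hr)
    have hcase : w.im = -b ∨ w.im = b ∨ w.re = -b ∨ w.re = b := by
      have hn : w ∉ U := by
        have : IsOpen U := isOpen_Ioo.reProdIm isOpen_Ioo
        rw [this.frontier_eq] at hw
        exact hw.2
      by_contra! h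
      apply hn
      rw [abs_le] at hr hi
      exact ⟨⟨lt_of_le_of_ne hr.1 (Ne.symm h.2.2.1), lt_of_le_of_ne hr.2 h.2.2.2⟩,
        ⟨lt_of_le_of_ne hi.1 (Ne.symm h.1), lt_of_le_of_ne hi.2 h.2.1⟩⟩
    have hmul : ∀ x y z t : ℝ, 0 ≤ x → 0 ≤ y → 0 ≤ z → 0 ≤ t → x ≤ A → y ≤ B → z ≤ B → t ≤ B →
        x * y * z * t ≤ A * B ^ 3 := by
      intro x y z t hx hy hz ht h1 h2 h3 h4
      calc x * y * z * t ≤ A * B * B * B := by gcongr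
        _ = A * B ^ 3 := by ring
    rw [norm_mul, norm_mul, norm_mul]
    have n1 := norm_nonneg (Ψ (ζ + 1 * w))
    have n2 := norm_nonneg (Ψ (ζ + Complex.I * w))
    have n3 := norm_nonneg (Ψ (ζ + (-1) * w))
    have n4 := norm_nonneg (Ψ (ζ + (-Complex.I) * w))
    rcases hcase with h | h | h | h
    · exact hmul _ _ _ _ n1 n2 n3 n4 (hbot _ (by simp [h]; ring) (by simpa using hr)) b2 b3 b4
    · have := hmul _ _ _ _ n3 n1 n2 n4 (hbot _ (by simp [h]; ring) (by simpa using hr)) b1 b2 b4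
      linarith
    · have := hmul _ _ _ _ n2 n1 n3 n4 (hbot _ (by simp [h]; ring) (by simpa using hi)) b1 b3 b4
      linarith
    · have := hmul _ _ _ _ n4 n1 n2 n3 (hbot _ (by simp [h]; ring) (by simpa using hi)) b1 b2 b3
      linarith
  have := Complex.norm_le_of_forall_mem_frontier_norm_le hbd hp hfr h0
  simp only [mul_zero, add_zero, norm_mul] at this
  linarith

/-- Fatou's theorem: a bounded holomorphic function on the upper half plane has vertical limits at
almost all boundary points. A primitive `Φ` is Lipschitz, so it extends to the real line and is
differentiable along it almost everywhere. At such a point `x₀`, the remainder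
`Ψ z = Φ z - Φ x₀ - d * (z - x₀)` is `o(y)` at the real points within distance `O(y)` of `x₀`, and
`O(y)` at all points within that distance. By `norm_pow_four_le_of_square` it is `o(y)` on the
circle with radius `y / 2` about `x₀ + iy`, and Cauchy's estimate for the derivative gives
`f (x₀ + iy) → d`. -/
theorem ae_exists_tendsto_of_bounded {f : ℂ → ℂ} {C : ℝ}
    (hf : DifferentiableOn ℂ f {z : ℂ | 0 < z.im}) (hC : ∀ z : ℂ, 0 < z.im → ‖f z‖ ≤ C) :
    ∀ᵐ t : ℝ, ∃ a : ℂ, Tendsto (fun y : ℝ => f (t + y * Complex.I)) (𝓝[>] 0) (𝓝 a) := by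
  obtain ⟨Φ₀, hΦ₀⟩ := exists_primitive_upperHalfPlane hf
  have hC0 : 0 ≤ C := (norm_nonneg _).trans (hC Complex.I (by simp))
  have hconv : Convex ℝ {z : ℂ | 0 < z.im} := convex_halfSpace_im_gt 0
  have hopen : IsOpen {z : ℂ | 0 < z.im} := isOpen_lt continuous_const Complex.continuous_im
  have hlip : LipschitzOnWith ⟨C, hC0⟩ Φ₀ {z : ℂ | 0 < z.im} := by
    refine hconv.lipschitzOnWith_of_nnnorm_hasDerivWithin_le
      (fun z hz => (hΦ₀ z hz).hasDerivWithinAt) fun z hz => ?_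
    exact hC z hz
  obtain ⟨Φ, hΦ, heq⟩ := hlip.extend_finite_dimension
  set K := lipschitzExtensionConstant ℂ * ⟨C, hC0⟩
  have hder : ∀ z : ℂ, 0 < z.im → HasDerivAt Φ (f z) z := fun z hz =>
    (hΦ₀ z hz).congr_of_eventuallyEq
      (Filter.eventuallyEq_of_mem (hopen.mem_nhds hz) fun w hw => (heq hw).symm)
  have hline : LipschitzWith (K * 1) fun x : ℝ => Φ x :=
    hΦ.comp (Isometry.lipschitz Complex.isometry_ofReal)
  filter_upwards [hline.ae_differentiableAt_real] with x₀ hx₀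
  obtain ⟨d, hd⟩ : ∃ d, HasDerivAt (fun x : ℝ => Φ x) d x₀ := ⟨_, hx₀.hasDerivAt⟩
  refine ⟨d, ?_⟩
  set Ψ : ℂ → ℂ := fun z => Φ z - Φ x₀ - d * (z - x₀) with hΨ
  set D : ℝ := K + ‖d‖ with hD
  have hD0 : 0 ≤ D := by positivity
  have hΨc : Continuous Ψ := by
    have := hΦ.continuous
    fun_prop
  have hΨd : ∀ z : ℂ, 0 < z.im → HasDerivAt Ψ (f z - d) z := by
    intro z hz
    have := ((hder z hz).sub_const (Φ x₀)).sub
      (((hasDerivAt_id z).sub_const (x₀ : ℂ)).const_mul d)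
    exact this.congr_deriv (by simp)
  have hΨb : ∀ z, ‖Ψ z‖ ≤ D * ‖z - x₀‖ := by
    intro z
    have h1 := hΦ.norm_sub_le z x₀
    calc ‖Ψ z‖ ≤ ‖Φ z - Φ x₀‖ + ‖d * (z - x₀)‖ := norm_sub_le _ _
      _ ≤ K * ‖z - x₀‖ + ‖d‖ * ‖z - x₀‖ := by rw [norm_mul]; gcongr
      _ = D * ‖z - x₀‖ := by rw [hD]; ring
  rw [Metric.tendsto_nhds]
  intro η hη
  set e := η / 4 with he
  have he0 : 0 < e := by positivity
  -- `2 * ε` and `5 * D` are the bounds for `Ψ`, relative to `y`, on the bottom side and on the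
  -- whole of the squares below.
  obtain ⟨ε, hε, hεe⟩ : ∃ ε > 0, 2 * ε * (5 * D) ^ 3 ≤ e ^ 4 := by
    refine ⟨e ^ 4 / (2 * (5 * D) ^ 3 + 1), by positivity, ?_⟩
    have hp : 0 < 2 * (5 * D) ^ 3 + 1 := by positivity
    rw [show 2 * (e ^ 4 / (2 * (5 * D) ^ 3 + 1)) * (5 * D) ^ 3 =
      e ^ 4 * (2 * (5 * D) ^ 3) / (2 * (5 * D) ^ 3 + 1) by ring, div_le_iff₀ hp]
    have : 0 ≤ e ^ 4 := by positivity
    nlinarith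
  have hlit := (hasDerivAt_iff_isLittleO.1 hd).bound hε
  obtain ⟨δ, hδ, hδb⟩ := Metric.eventually_nhds_iff.1 hlit
  have hsmall : ∀ x : ℝ, |x - x₀| < δ → ‖Ψ x‖ ≤ ε * |x - x₀| := by
    intro x hx
    have := hδb (y := x) (by rwa [Real.dist_eq])
    have e : Ψ x = Φ x - Φ x₀ - (x - x₀) • d := by
      simp only [hΨ, Complex.real_smul]
      push_cast
      ring
    rw [e]
    exact this
  have hyev : ∀ᶠ y : ℝ in 𝓝[>] 0, y ∈ Set.Ioo 0 (δ / 4) := Ioo_mem_nhdsGT (by positivity)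
  filter_upwards [hyev] with y hy
  obtain ⟨hy0, hyδ⟩ := hy
  set p : ℂ := x₀ + y * Complex.I with hp
  have hpre : p.re = x₀ := by simp [hp]
  have hpim : p.im = y := by simp [hp]
  have hsph : ∀ ζ ∈ Metric.sphere p (y / 2), ‖Ψ ζ‖ ≤ e * y := by
    intro ζ hζ
    rw [mem_sphere_iff_norm] at hζ
    have hr : |ζ.re - x₀| ≤ y / 2 := by
      have := Complex.abs_re_le_norm (ζ - p)
      rwa [Complex.sub_re, hpre, hζ] at this
    have hi : |ζ.im - y| ≤ y / 2 := by
      have := Complex.abs_im_le_norm (ζ - p)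
      rwa [Complex.sub_im, hpim, hζ] at this
    rw [abs_le] at hr hi
    -- The half side is `ζ.im`, so that the bottom side of the square lies on the real line.
    have hsq := norm_pow_four_le_of_square (Ψ := Ψ) (ζ := ζ) (b := ζ.im) (A := 2 * ε * y)
      (B := 5 * D * y) (by linarith) hΨc ?_ ?_ ?_
    · have h4 : ‖Ψ ζ‖ ^ 4 ≤ (e * y) ^ 4 := by
        calc ‖Ψ ζ‖ ^ 4 ≤ 2 * ε * y * (5 * D * y) ^ 3 := hsq
          _ = 2 * ε * (5 * D) ^ 3 * y ^ 4 := by ring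
          _ ≤ e ^ 4 * y ^ 4 := by gcongr
          _ = (e * y) ^ 4 := by ring
      exact le_of_pow_le_pow_left₀ (by norm_num) (by positivity) h4
    · intro z hz
      simp only [sub_self, Set.mem_ofPred_eq] at hz
      exact (hΨd z hz).differentiableAt.differentiableWithinAt
    · intro z hz1 hz2
      have hzr : z = (z.re : ℂ) := by
        apply Complex.ext <;> simp [hz1]
      rw [abs_le] at hz2
      have hz3 : |z.re - x₀| ≤ 2 * y := by rw [abs_le]; constructor <;> linarith
      rw [hzr]
      calc ‖Ψ z.re‖ ≤ ε * |z.re - x₀| := hsmall _ (by linarith)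
        _ ≤ ε * (2 * y) := by gcongr
        _ = 2 * ε * y := by ring
    · intro z hz1 hz2
      rw [abs_le] at hz1 hz2
      have h1 : |(z - x₀).re| ≤ 2 * y := by
        rw [abs_le]; simp only [Complex.sub_re, Complex.ofReal_re]; constructor <;> linarith
      have h2 : |(z - x₀).im| ≤ 3 * y := by
        rw [abs_le]; simp only [Complex.sub_im, Complex.ofReal_im]; constructor <;> linarith
      calc ‖Ψ z‖ ≤ D * ‖z - x₀‖ := hΨb z
        _ ≤ D * (5 * y) := by
          gcongr
          have := Complex.norm_le_abs_re_add_abs_im (z - x₀)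
          linarith
        _ = 5 * D * y := by ring
  have hdc : DiffContOnCl ℂ Ψ (Metric.ball p (y / 2)) := by
    refine ⟨fun z hz => (hΨd z ?_).differentiableAt.differentiableWithinAt, hΨc.continuousOn⟩
    rw [mem_ball_iff_norm] at hz
    have := Complex.abs_im_le_norm (z - p)
    rw [Complex.sub_im, hpim] at this
    have := abs_le.1 this
    linarith
  have hfin := Complex.norm_deriv_le_of_forall_mem_sphere_norm_le (by linarith) hdc hsph
  rw [(hΨd p (by rw [hpim]; exact hy0)).deriv] at hfin
  rw [dist_eq_norm]
  have : e * y / (y / 2) = 2 * e := by field_simp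
  rw [this] at hfin
  linarith

theorem continuous_horizontal {F : ℂ → ℂ} (hF : DifferentiableOn ℂ F {z : ℂ | 0 < z.im})
    {y : ℝ} (hy : 0 < y) : Continuous fun x : ℝ => F (x + y * Complex.I) :=
  hF.continuousOn.comp_continuous (by fun_prop) fun x => by simpa using hy

/-- A function with positive imaginary part tends to infinity at almost no boundary point. The
functions `(F + i) ^ (-ε)` are bounded by `1`. By Cauchy's theorem, the integral of such a
function over `(a, b]` at height `h` differs by at most `2 * h` from the one at a small height, to
which the exceptional set contributes nothing in the limit. If now `ε → 0` with `h` fixed, then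
the integral at height `h` tends to `b - a`, which leaves at most `2 * h` for the measure of the
exceptional set. -/
theorem volume_tendsto_norm_atTop_eq_zero {F : ℂ → ℂ} (hF : DifferentiableOn ℂ F {z : ℂ | 0 < z.im})
    (him : ∀ z : ℂ, 0 < z.im → 0 < (F z).im) :
    volume {t : ℝ | Tendsto (fun n : ℕ => ‖F (t + (1 / (n + 1 : ℝ) : ℝ) * Complex.I)‖)
      atTop atTop} = 0 := by
  set S := {t : ℝ | Tendsto (fun n : ℕ => ‖F (t + (1 / (n + 1 : ℝ) : ℝ) * Complex.I)‖)
      atTop atTop} with hS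
  have hSm : MeasurableSet S := by
    refine measurableSet_tendsto atTop fun n => ?_
    exact (continuous_horizontal hF (by positivity)).norm.measurable
  have him1 : ∀ z : ℂ, 0 < z.im → 1 < ‖F z + Complex.I‖ := by
    intro z hz
    have h1 := Complex.abs_im_le_norm (F z + Complex.I)
    have h2 := le_abs_self (F z + Complex.I).im
    simp only [Complex.add_im, Complex.I_im] at h1 h2
    linarith [him z hz]
  set k : ℝ → ℂ → ℂ := fun ε z => (F z + Complex.I) ^ ((-ε : ℝ) : ℂ) with hk
  have hkd : ∀ ε, DifferentiableOn ℂ (k ε) {z : ℂ | 0 < z.im} := by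
    intro ε
    refine DifferentiableOn.cpow_const (hF.add_const _) fun z hz => ?_
    right
    simp only [Complex.add_im, Complex.I_im]
    linarith [him z hz]
  have hkn : ∀ ε z, ‖k ε z‖ = ‖F z + Complex.I‖ ^ (-ε) := fun ε z => Complex.norm_cpow_real _ _
  have hkb : ∀ ε, 0 ≤ ε → ∀ z : ℂ, 0 < z.im → ‖k ε z‖ ≤ 1 := by
    intro ε hε z hz
    rw [hkn]
    exact Real.rpow_le_one_of_one_le_of_nonpos (him1 z hz).le (by linarith)
  have main : ∀ a b : ℝ, a ≤ b → volume.real (S ∩ Set.Ioc a b) = 0 := by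
    intro a b hab
    set T := S ∩ Set.Ioc a b with hT
    have hTm : MeasurableSet T := hSm.inter measurableSet_Ioc
    have step : ∀ ε > 0, ∀ h > 0,
        ‖∫ x in a..b, k ε (x + (h : ℝ) * Complex.I)‖ ≤ 2 * h + (b - a - volume.real T) := by
      intro ε hε h hh
      have hrect : ∀ y, 0 < y → y < h → ‖∫ x in a..b, k ε (x + (h : ℝ) * Complex.I)‖ ≤
          ‖∫ x in a..b, k ε (x + (y : ℝ) * Complex.I)‖ + 2 * h := by
        intro y hy hyh
        have hr := Complex.integral_boundary_rect_eq_zero_of_differentiableOn (k ε)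
          (a + y * Complex.I) (b + h * Complex.I) ((hkd ε).mono ?_)
        · simp only [Complex.add_re, Complex.ofReal_re, Complex.mul_re, Complex.I_re, mul_zero,
            Complex.ofReal_im, Complex.I_im, mul_one, sub_self, add_zero, Complex.add_im,
            Complex.mul_im, zero_add] at hr
          have hv : ∀ c : ℝ, ‖Complex.I • ∫ s in y..h, k ε (c + s * Complex.I)‖ ≤ h := by
            intro c
            rw [norm_smul, Complex.norm_I, one_mul]
            refine (intervalIntegral.norm_integral_le_of_norm_le_const (C := 1) ?_).trans ?_
            · intro s hs
              rw [Set.uIoc_of_le hyh.le] at hs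
              exact hkb ε hε.le _ (by simpa using hy.trans hs.1)
            · rw [one_mul, abs_of_pos (by linarith)]
              linarith
          have e : ∫ x in a..b, k ε (x + (h : ℝ) * Complex.I) =
              (∫ x in a..b, k ε (x + (y : ℝ) * Complex.I)) +
              Complex.I • (∫ s in y..h, k ε (b + s * Complex.I)) -
              Complex.I • ∫ s in y..h, k ε (a + s * Complex.I) := by
            linear_combination -hr
          rw [e]
          refine (norm_sub_le _ _).trans ?_
          have := norm_add_le (∫ x in a..b, k ε (x + (y : ℝ) * Complex.I))
            (Complex.I • (∫ s in y..h, k ε (b + s * Complex.I)))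
          linarith [hv a, hv b]
        · intro z hz
          have := hz.2
          simp only [Set.mem_preimage, Complex.add_im, Complex.ofReal_im, Complex.mul_im,
            Complex.ofReal_re, Complex.I_im, mul_one, Complex.I_re, mul_zero, add_zero,
            zero_add, Set.uIcc_of_le hyh.le] at this
          exact hy.trans_le this.1
      set yn : ℕ → ℝ := fun n => 1 / (n + 1 : ℝ) with hyn
      have hyn0 : ∀ n, 0 < yn n := fun n => by positivity
      have hcont : ∀ n, Continuous fun x : ℝ => k ε (x + (yn n : ℝ) * Complex.I) := fun n =>
        continuous_horizontal (hkd ε) (hyn0 n)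
      have hlim : Tendsto (fun n => ∫ x in T, ‖k ε (x + (yn n : ℝ) * Complex.I)‖) atTop
          (𝓝 0) := by
        have := tendsto_integral_of_dominated_convergence (μ := volume.restrict T)
          (F := fun n (x : ℝ) => ‖k ε (x + (yn n : ℝ) * Complex.I)‖) (f := fun _ => (0 : ℝ))
          (fun _ => 1) (fun n => (hcont n).norm.aestronglyMeasurable) ?_ ?_ ?_
        · simpa using this
        · refine (integrableOn_const_iff (C := (1 : ℝ))).2 (Or.inr ?_)
          exact (measure_mono Set.inter_subset_right).trans_lt measure_Ioc_lt_top
        · intro n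
          refine Eventually.of_forall fun x => ?_
          rw [norm_norm]
          exact hkb ε hε.le _ (by simpa using hyn0 n)
        · filter_upwards [ae_restrict_mem hTm] with x hx
          simp only [hkn]
          refine (tendsto_rpow_neg_atTop hε).comp ?_
          refine tendsto_atTop_mono (fun n => ?_) (tendsto_atTop_add_const_right _ (-1) hx.1)
          have := norm_sub_le (F (x + (yn n : ℝ) * Complex.I) + Complex.I) Complex.I
          rw [add_sub_cancel_right, Complex.norm_I] at this
          simp only [hyn] at this ⊢
          linarith
      have hyl : Tendsto yn atTop (𝓝 0) := tendsto_one_div_add_atTop_nhds_zero_nat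
      have hev : ∀ᶠ n in atTop, ‖∫ x in a..b, k ε (x + (h : ℝ) * Complex.I)‖ ≤
          (∫ x in T, ‖k ε (x + (yn n : ℝ) * Complex.I)‖) + (b - a - volume.real T) + 2 * h := by
        filter_upwards [hyl.eventually_lt_const hh] with n hn
        refine (hrect (yn n) (hyn0 n) hn).trans ?_
        gcongr
        have hint : IntegrableOn (fun x : ℝ => ‖k ε (x + (yn n : ℝ) * Complex.I)‖)
            (Set.Ioc a b) := ((hcont n).norm.integrableOn_Icc).mono_set Set.Ioc_subset_Icc_self
        calc ‖∫ x in a..b, k ε (x + (yn n : ℝ) * Complex.I)‖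
            ≤ ∫ x in Set.Ioc a b, ‖k ε (x + (yn n : ℝ) * Complex.I)‖ := by
              rw [intervalIntegral.integral_of_le hab]
              exact norm_integral_le_integral_norm _
          _ = (∫ x in T, ‖k ε (x + (yn n : ℝ) * Complex.I)‖) +
              ∫ x in Set.Ioc a b \ S, ‖k ε (x + (yn n : ℝ) * Complex.I)‖ := by
              rw [hT, Set.inter_comm]
              exact (integral_inter_add_sdiff hSm hint).symm
          _ ≤ _ := by
              gcongr
              have hfin : volume (Set.Ioc a b \ S) < ⊤ :=
                (measure_mono Set.sdiff_subset).trans_lt measure_Ioc_lt_top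
              have h1 := norm_setIntegral_le_of_norm_le_const
                (f := fun x : ℝ => ‖k ε (x + (yn n : ℝ) * Complex.I)‖) (C := 1) hfin
                (fun x _ => by
                  rw [norm_norm]
                  exact hkb ε hε.le _ (by simpa using hyn0 n))
              rw [one_mul] at h1
              refine (le_abs_self _).trans (h1.trans ?_)
              have h2 := measureReal_inter_add_sdiff (μ := volume) (s := Set.Ioc a b) hSm
                measure_Ioc_lt_top.ne
              rw [Set.inter_comm, Real.volume_real_Ioc_of_le hab] at h2
              linarith
      have hl := ((hlim.add_const (b - a - volume.real T)).add_const (2 * h))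
      have := ge_of_tendsto hl hev
      linarith
    have step2 : ∀ h > 0, volume.real T ≤ 2 * h := by
      intro h hh
      have hl : Tendsto (fun n : ℕ => ‖∫ x in a..b, k (1 / (n + 1 : ℝ)) (x + (h : ℝ) * Complex.I)‖)
          atTop (𝓝 (b - a)) := by
        have h1 : Tendsto (fun n : ℕ => ∫ x in a..b, k (1 / (n + 1 : ℝ)) (x + (h : ℝ) * Complex.I))
          atTop (𝓝 (∫ x in a..b, (1 : ℂ))) := by
          refine intervalIntegral.tendsto_integral_filter_of_dominated_convergence (fun _ => 1)
            ?_ ?_ ?_ ?_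
          · exact Eventually.of_forall fun n =>
              (continuous_horizontal (hkd _) hh).aestronglyMeasurable
          · exact Eventually.of_forall fun n => Eventually.of_forall fun x _ =>
              hkb _ (by positivity) _ (by simpa using hh)
          · simp
          · refine Eventually.of_forall fun x _ => ?_
            have hz : F (x + h * Complex.I) + Complex.I ≠ 0 := by
              intro h0
              have := him1 (x + h * Complex.I) (by simpa using hh)
              rw [h0] at this
              simp at this
              linarith
            have hc : ContinuousAt (fun w : ℂ => (F (x + h * Complex.I) + Complex.I) ^ w) 0 :=
              continuousAt_const_cpow hz
            have := hc.tendsto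
            rw [Complex.cpow_zero] at this
            refine this.comp ?_
            have h3 : Tendsto (fun n : ℕ => -(1 / (n + 1 : ℝ))) atTop (𝓝 0) := by
              simpa using (tendsto_one_div_add_atTop_nhds_zero_nat (𝕜 := ℝ)).neg
            exact (Complex.continuous_ofReal.tendsto 0).comp h3
        have h2 := h1.norm
        rw [intervalIntegral.integral_const] at h2
        simpa [← Complex.ofReal_sub, abs_of_nonneg (sub_nonneg.2 hab)] using h2
      have := le_of_tendsto hl (Eventually.of_forall fun n =>
        step (1 / (n + 1 : ℝ)) (by positivity) h hh)
      linarith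
    refine le_antisymm (le_of_forall_pos_le_add fun e he => ?_) measureReal_nonneg
    have := step2 (e / 2) (by positivity)
    linarith
  have hcov : S ⊆ ⋃ n : ℕ, S ∩ Set.Ioc (-(n : ℝ)) n := by
    intro x hx
    obtain ⟨n, hn⟩ := exists_nat_gt |x|
    have := abs_lt.1 hn
    exact Set.mem_iUnion.2 ⟨n, hx, this.1, this.2.le⟩
  refine measure_mono_null hcov (measure_iUnion_null fun n => ?_)
  have h1 := main (-(n : ℝ)) n (by linarith [(Nat.cast_nonneg n : (0 : ℝ) ≤ n)])
  rwa [measureReal_eq_zero_iff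
    ((measure_mono Set.inter_subset_right).trans_lt measure_Ioc_lt_top).ne] at h1

/-- Fatou's theorem for Herglotz functions, from the bounded function `1 / (F + i)`. -/
theorem ae_exists_tendsto_of_im_pos {F : ℂ → ℂ} (hF : DifferentiableOn ℂ F {z : ℂ | 0 < z.im})
    (him : ∀ z : ℂ, 0 < z.im → 0 < (F z).im) :
    ∀ᵐ t : ℝ, ∃ a : ℂ, Tendsto (fun y : ℝ => F (t + y * Complex.I)) (𝓝[>] 0) (𝓝 a) := by
  have hne : ∀ z : ℂ, 0 < z.im → F z + Complex.I ≠ 0 := by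
    intro z hz h0
    have := congrArg Complex.im h0
    simp only [Complex.add_im, Complex.I_im, Complex.zero_im] at this
    linarith [him z hz]
  set g : ℂ → ℂ := fun z => 1 / (F z + Complex.I) with hg
  have hgd : DifferentiableOn ℂ g {z : ℂ | 0 < z.im} :=
    (differentiableOn_const 1).div (hF.add_const _) hne
  have hgb : ∀ z : ℂ, 0 < z.im → ‖g z‖ ≤ 1 := by
    intro z hz
    have h1 := Complex.abs_im_le_norm (F z + Complex.I)
    have h2 := le_abs_self (F z + Complex.I).im
    simp only [Complex.add_im, Complex.I_im] at h1 h2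
    rw [hg, norm_div, norm_one, div_le_one (norm_pos_iff.2 (hne z hz))]
    linarith [him z hz]
  have hnull := volume_tendsto_norm_atTop_eq_zero hF him
  filter_upwards [ae_exists_tendsto_of_bounded hgd hgb, measure_eq_zero_iff_ae_notMem.1 hnull]
    with t ⟨c, hc⟩ ht
  have hpos : ∀ᶠ y : ℝ in 𝓝[>] 0, 0 < y := self_mem_nhdsWithin
  by_cases h0 : c = 0
  · exfalso
    apply ht
    have h1 : Tendsto (fun y : ℝ => ‖g (t + y * Complex.I)‖⁻¹) (𝓝[>] 0) atTop := by
      refine tendsto_inv_nhdsGT_zero.comp (tendsto_nhdsWithin_iff.2 ⟨?_, ?_⟩)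
      · simpa [h0] using hc.norm
      · filter_upwards [hpos] with y hy
        exact norm_pos_iff.2 (one_div_ne_zero (hne _ (by simpa using hy)))
    have h2 : Tendsto (fun y : ℝ => ‖F (t + y * Complex.I)‖) (𝓝[>] 0) atTop := by
      refine tendsto_atTop_mono (fun y => ?_) (tendsto_atTop_add_const_right _ (-1) h1)
      have := norm_add_le (F (t + y * Complex.I)) Complex.I
      rw [Complex.norm_I] at this
      simp only [hg, one_div, norm_inv, inv_inv]
      linarith
    refine h2.comp (tendsto_nhdsWithin_iff.2 ⟨tendsto_one_div_add_atTop_nhds_zero_nat, ?_⟩)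
    exact Eventually.of_forall fun n => by
      simp only [Set.mem_Ioi]; positivity
  · refine ⟨1 / c - Complex.I, ?_⟩
    refine ((tendsto_const_nhds.div hc h0).sub_const Complex.I).congr' ?_
    filter_upwards [hpos] with y hy
    have := hne (t + y * Complex.I) (by simpa using hy)
    simp [hg]

/-- The boundary values of a Herglotz function are almost everywhere nonzero, because `-1 / F` is
also a Herglotz function. -/
theorem ae_exists_tendsto_ne_zero_of_im_pos {F : ℂ → ℂ}
    (hF : DifferentiableOn ℂ F {z : ℂ | 0 < z.im})
    (him : ∀ z : ℂ, 0 < z.im → 0 < (F z).im) :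
    ∀ᵐ t : ℝ, ∃ a : ℂ, a ≠ 0 ∧
      Tendsto (fun y : ℝ => F (t + y * Complex.I)) (𝓝[>] 0) (𝓝 a) := by
  have hne : ∀ z : ℂ, 0 < z.im → F z ≠ 0 := by
    intro z hz h0
    have := him z hz
    simp [h0] at this
  have hd : DifferentiableOn ℂ (fun z => -1 / F z) {z : ℂ | 0 < z.im} :=
    (differentiableOn_const (-1)).div hF hne
  have hi : ∀ z : ℂ, 0 < z.im → 0 < (-1 / F z).im := by
    intro z hz
    have h1 : 0 < Complex.normSq (F z) := Complex.normSq_pos.2 (hne z hz)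
    rw [Complex.div_im]
    simp only [Complex.neg_im, Complex.one_im, neg_zero, zero_mul, zero_div, Complex.neg_re,
      Complex.one_re, zero_sub]
    have := div_pos (him z hz) h1
    rw [neg_mul, neg_div, neg_neg, one_mul]
    exact this
  filter_upwards [ae_exists_tendsto_of_im_pos hF him, ae_exists_tendsto_of_im_pos hd hi]
    with t ⟨a, ha⟩ ⟨c, hc⟩
  refine ⟨a, ?_, ha⟩
  rintro rfl
  have h1 := ha.mul hc
  have h2 : Tendsto (fun y : ℝ => F (t + y * Complex.I) * (-1 / F (t + y * Complex.I)))
      (𝓝[>] 0) (𝓝 (-1)) := by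
    refine tendsto_const_nhds.congr' ?_
    filter_upwards [self_mem_nhdsWithin] with y hy
    have := hne (t + y * Complex.I) (by simpa using hy)
    field_simp
  have := tendsto_nhds_unique h1 h2
  simp at this

/-! ### The matrix logarithm on symmetric matrices of determinant `-1` -/

theorem eig₁_add_eig₂ (A : Matrix (Fin 2) (Fin 2) ℂ) : eig₁ A + eig₂ A = A.trace := by
  unfold eig₁ eig₂; ring

theorem sqrtDisc_sq (A : Matrix (Fin 2) (Fin 2) ℂ) :
    sqrtDisc A ^ 2 = A.trace ^ 2 - 4 * A.det := by
  unfold sqrtDisc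
  rw [← Complex.cpow_nat_mul]
  norm_num

theorem eig₁_mul_eig₂ (A : Matrix (Fin 2) (Fin 2) ℂ) : eig₁ A * eig₂ A = A.det := by
  unfold eig₁ eig₂
  linear_combination (-1 / 4) * sqrtDisc_sq A

/-- The domain `ℂ ∖ {-iy : y ≥ 0}` of `logBranch`. -/
def logDomain : Set ℂ := {w | -Complex.I * w ∈ Complex.slitPlane}

theorem isOpen_logDomain : IsOpen logDomain :=
  Complex.isOpen_slitPlane.preimage (by fun_prop : Continuous fun w : ℂ => -Complex.I * w)

theorem mem_logDomain {w : ℂ} (hw : w ≠ 0) (hi : 0 ≤ w.im) : w ∈ logDomain := by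
  simp only [logDomain, Set.mem_ofPred_eq, Complex.mem_slitPlane_iff]
  rcases hi.lt_or_eq with h | h
  · left; simpa using h
  · right
    intro h0
    apply hw
    apply Complex.ext
    · simpa using h0
    · simpa using h.symm

theorem ne_zero_of_mem_logDomain {w : ℂ} (hw : w ∈ logDomain) : w ≠ 0 := by
  rintro rfl
  simp [logDomain] at hw

theorem hasStrictDerivAt_logBranch {w : ℂ} (hw : w ∈ logDomain) :
    HasStrictDerivAt logBranch w⁻¹ w := by
  have h0 := ne_zero_of_mem_logDomain hw
  have h1 : HasStrictDerivAt (fun w : ℂ => -Complex.I * w) (-Complex.I) w := by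
    simpa using (hasStrictDerivAt_id w).const_mul (-Complex.I)
  have h2 := (h1.clog hw).add_const ((Real.pi / 2 : ℂ) * Complex.I)
  refine h2.congr_deriv ?_
  have := Complex.I_ne_zero
  field_simp

theorem exp_logBranch {w : ℂ} (hw : w ≠ 0) : Complex.exp (logBranch w) = w := by
  unfold logBranch
  rw [Complex.exp_add, Complex.exp_log (mul_ne_zero (neg_ne_zero.2 Complex.I_ne_zero) hw),
    Complex.exp_pi_div_two_mul_I]
  linear_combination (-w) * Complex.I_sq

/-- `logBranch` turns the relation `λ₁ λ₂ = -1` between the eigenvalues of a matrix of determinant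
`-1` into `log λ₁ + log λ₂ = π i`. -/
theorem logBranch_add_logBranch {w v : ℂ} (hw : w ∈ logDomain) (h : w * v = -1) :
    logBranch w + logBranch v = Real.pi * Complex.I := by
  have h0 := ne_zero_of_mem_logDomain hw
  have e : -Complex.I * v = (-Complex.I * w)⁻¹ := by
    refine eq_inv_of_mul_eq_one_left ?_
    linear_combination (v * w) * Complex.I_sq - h
  unfold logBranch
  rw [e, Complex.log_inv _ (Complex.slitPlane_arg_ne_pi hw)]
  ring

theorem logBranch_ofReal_im_of_pos {r : ℝ} (hr : 0 < r) : (logBranch r).im = 0 := by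
  unfold logBranch
  rw [mul_comm, Complex.log_ofReal_mul hr (neg_ne_zero.2 Complex.I_ne_zero), Complex.log_neg_I]
  simp

theorem logBranch_ofReal_im_of_neg {r : ℝ} (hr : r < 0) : (logBranch r).im = Real.pi := by
  unfold logBranch
  rw [show -Complex.I * (r : ℂ) = ((-r : ℝ) : ℂ) * Complex.I by push_cast; ring,
    Complex.log_ofReal_mul (by linarith) Complex.I_ne_zero, Complex.log_I]
  simp

theorem logBranch_ofReal_mul_I_im {r : ℝ} (hr : 0 < r) :
    (logBranch (r * Complex.I)).im = Real.pi / 2 := by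
  unfold logBranch
  rw [show -Complex.I * (r * Complex.I) = (r : ℂ) by linear_combination (-r : ℂ) * Complex.I_sq,
    ← Complex.ofReal_log hr.le]
  simp

theorem dslope_symm (f : ℂ → ℂ) (a b : ℂ) : dslope f a b = dslope f b a := by
  rcases eq_or_ne a b with rfl | h
  · rfl
  · rw [dslope_of_ne _ h, dslope_of_ne _ h.symm, slope_comm]

theorem dslope_mul_sub (f : ℂ → ℂ) (a b : ℂ) : dslope f a b * (b - a) = f b - f a := by
  rw [mul_comm]; exact sub_smul_dslope f a b

/-- The divided difference of `logBranch` is jointly continuous, also on the diagonal. -/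
theorem continuousAt_dslope_logBranch {a b : ℂ} (ha : a ∈ logDomain) (hb : b ∈ logDomain) :
    ContinuousAt (fun p : ℂ × ℂ => dslope logBranch p.1 p.2) (a, b) := by
  rcases eq_or_ne a b with rfl | hab
  · have hs := (hasStrictDerivAt_logBranch ha)
    rw [ContinuousAt, Metric.tendsto_nhds]
    intro ε hε
    have h1 := hs.isLittleO.bound (half_pos hε)
    have h2 : ∀ᶠ p : ℂ × ℂ in 𝓝 (a, a), p.1 ∈ logDomain :=
      continuousAt_fst (isOpen_logDomain.mem_nhds ha)
    have h3 : ∀ᶠ p : ℂ × ℂ in 𝓝 (a, a), dist (p.1⁻¹) a⁻¹ < ε := by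
      have : Tendsto (fun p : ℂ × ℂ => p.1⁻¹) (𝓝 (a, a)) (𝓝 a⁻¹) :=
        (continuous_fst.tendsto (a, a)).inv₀ (ne_zero_of_mem_logDomain ha)
      exact Metric.tendsto_nhds.1 this ε hε
    filter_upwards [h1, h2, h3] with p hp1 hp2 hp3
    rw [dslope_same, hs.hasDerivAt.deriv]
    rcases eq_or_ne p.1 p.2 with h | h
    · rw [← h, dslope_same, (hasStrictDerivAt_logBranch hp2).hasDerivAt.deriv]
      exact hp3
    · have hne : p.1 - p.2 ≠ 0 := sub_ne_zero.2 h
      have e : logBranch p.1 - logBranch p.2 - a⁻¹ * (p.1 - p.2) =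
          (dslope logBranch p.1 p.2 - a⁻¹) * (p.1 - p.2) := by
        linear_combination dslope_mul_sub logBranch p.1 p.2
      simp only [ContinuousLinearMap.toSpanSingleton_apply, smul_eq_mul] at hp1
      rw [mul_comm (p.1 - p.2) a⁻¹, e, norm_mul] at hp1
      have := le_of_mul_le_mul_right hp1 (norm_pos_iff.2 hne)
      rw [dist_eq_norm]
      linarith
  · have hev : ∀ᶠ p : ℂ × ℂ in 𝓝 (a, b), p.1 ≠ p.2 :=
      (isOpen_ne_fun continuous_fst continuous_snd).mem_nhds hab
    have hc : ContinuousAt (fun p : ℂ × ℂ => (p.2 - p.1)⁻¹ * (logBranch p.2 - logBranch p.1))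
        (a, b) := by
      have ca : ContinuousAt (fun p : ℂ × ℂ => logBranch p.1) (a, b) :=
        ContinuousAt.comp' (f := Prod.fst) (hasStrictDerivAt_logBranch ha).hasDerivAt.continuousAt
          continuousAt_fst
      have cb : ContinuousAt (fun p : ℂ × ℂ => logBranch p.2) (a, b) :=
        ContinuousAt.comp' (f := Prod.snd) (hasStrictDerivAt_logBranch hb).hasDerivAt.continuousAt
          continuousAt_snd
      exact ((continuousAt_snd.sub continuousAt_fst).inv₀ (sub_ne_zero.2 hab.symm)).mul (cb.sub ca)
    refine hc.congr ?_
    filter_upwards [hev] with p hp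
    rw [dslope_of_ne _ hp.symm, slope_def_field, div_eq_inv_mul]

/-- A symmetric function of the roots `(τ ± s) / 2` of a quadratic polynomial depends continuously
on the polynomial, although the square root `s` of its discriminant need not. -/
theorem tendsto_symmetric_roots {ι X : Type*} [TopologicalSpace X] {l : Filter ι} {G : ℂ × ℂ → X}
    (hG : ∀ a b, G (a, b) = G (b, a)) {τ s : ι → ℂ} {τ₀ s₀ : ℂ}
    (hτ : Tendsto τ l (𝓝 τ₀)) (hs : Tendsto (fun i => s i ^ 2) l (𝓝 (s₀ ^ 2)))
    (hc : ContinuousAt G ((τ₀ + s₀) / 2, (τ₀ - s₀) / 2)) :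
    Tendsto (fun i => G ((τ i + s i) / 2, (τ i - s i) / 2)) l
      (𝓝 (G ((τ₀ + s₀) / 2, (τ₀ - s₀) / 2))) := by
  classical
  -- Between `s i` and `-s i`, take the one that is closer to `s₀`.
  set s' : ι → ℂ := fun i => if ‖s i - s₀‖ ≤ ‖s i + s₀‖ then s i else -s i with hs'
  have hb : ∀ i, ‖s' i - s₀‖ ^ 2 ≤ ‖s i ^ 2 - s₀ ^ 2‖ := by
    intro i
    rw [show s i ^ 2 - s₀ ^ 2 = (s i - s₀) * (s i + s₀) by ring, norm_mul]
    simp only [hs']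
    split_ifs with h
    · rw [sq]; gcongr
    · rw [sq, show -s i - s₀ = -(s i + s₀) by ring, norm_neg]
      push Not at h
      gcongr
  have hs0 : Tendsto s' l (𝓝 s₀) := by
    rw [tendsto_iff_norm_sub_tendsto_zero] at hs ⊢
    have h1 : Tendsto (fun i => Real.sqrt ‖s i ^ 2 - s₀ ^ 2‖) l (𝓝 0) := by
      simpa using hs.sqrt
    refine squeeze_zero (fun i => norm_nonneg _) (fun i => ?_) h1
    exact Real.le_sqrt_of_sq_le (hb i)
  have h2 := hc.tendsto.comp (((hτ.add hs0).div_const 2).prodMk_nhds ((hτ.sub hs0).div_const 2))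
  refine h2.congr fun i => ?_
  simp only [Function.comp, hs']
  split_ifs with h
  · rfl
  · rw [hG]
    congr 2; ring

theorem matLog_eq (A : Matrix (Fin 2) (Fin 2) ℂ) :
    matLog A = (logBranch (eig₁ A) - dslope logBranch (eig₁ A) (eig₂ A) * eig₁ A) •
      (1 : Matrix (Fin 2) (Fin 2) ℂ) + dslope logBranch (eig₁ A) (eig₂ A) • A := by
  unfold matLog
  rw [smul_sub, sub_smul, smul_smul]
  abel

/-- The matrix logarithm is continuous at each matrix with spectrum in `logDomain`. -/
theorem tendsto_matLog {ι : Type*} {l : Filter ι} {A : ι → Matrix (Fin 2) (Fin 2) ℂ}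
    {A₀ : Matrix (Fin 2) (Fin 2) ℂ} (hA : Tendsto A l (𝓝 A₀))
    (h1 : eig₁ A₀ ∈ logDomain) (h2 : eig₂ A₀ ∈ logDomain) :
    Tendsto (fun i => matLog (A i)) l (𝓝 (matLog A₀)) := by
  have ht : Tendsto (fun i => (A i).trace) l (𝓝 A₀.trace) :=
    ((by fun_prop : Continuous fun B : Matrix (Fin 2) (Fin 2) ℂ => B.trace).tendsto A₀).comp hA
  have hdt : Tendsto (fun i => (A i).det) l (𝓝 A₀.det) :=
    ((by fun_prop : Continuous fun B : Matrix (Fin 2) (Fin 2) ℂ => B.det).tendsto A₀).comp hA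
  have hs : Tendsto (fun i => sqrtDisc (A i) ^ 2) l (𝓝 (sqrtDisc A₀ ^ 2)) := by
    simp only [sqrtDisc_sq]
    exact (ht.pow 2).sub (hdt.const_mul 4)
  have hD : Tendsto (fun i => dslope logBranch (eig₁ (A i)) (eig₂ (A i))) l
      (𝓝 (dslope logBranch (eig₁ A₀) (eig₂ A₀))) :=
    tendsto_symmetric_roots (G := fun p : ℂ × ℂ => dslope logBranch p.1 p.2)
      (fun a b => dslope_symm _ _ _) ht hs (continuousAt_dslope_logBranch h1 h2)
  have hC : Tendsto (fun i => logBranch (eig₁ (A i)) -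
        dslope logBranch (eig₁ (A i)) (eig₂ (A i)) * eig₁ (A i)) l
      (𝓝 (logBranch (eig₁ A₀) - dslope logBranch (eig₁ A₀) (eig₂ A₀) * eig₁ A₀)) := by
    refine tendsto_symmetric_roots
      (G := fun p : ℂ × ℂ => logBranch p.1 - dslope logBranch p.1 p.2 * p.1) ?_ ht hs ?_
    · intro a b
      simp only
      rw [dslope_symm _ b a]
      linear_combination dslope_mul_sub logBranch a b
    · have ca : ContinuousAt (fun p : ℂ × ℂ => logBranch p.1) (eig₁ A₀, eig₂ A₀) :=
        ContinuousAt.comp' (f := Prod.fst) (hasStrictDerivAt_logBranch h1).hasDerivAt.continuousAt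
          continuousAt_fst
      exact ca.sub ((continuousAt_dslope_logBranch h1 h2).mul continuousAt_fst)
  simp only [matLog_eq]
  exact (hC.smul_const _).add (hD.smul hA)

/-- If the eigenvalues satisfy `a * b = -1`, then `a` and `b = -1 / a` have imaginary parts of the
same sign. -/
theorem ne_zero_and_im_nonneg_of_mul_eq {a b : ℂ} (hab : a * b = -1) (h : 0 ≤ (a + b).im) :
    a ≠ 0 ∧ 0 ≤ a.im := by
  have ha : a ≠ 0 := by rintro rfl; simp at hab
  refine ⟨ha, ?_⟩
  have hn : 0 < Complex.normSq a := Complex.normSq_pos.2 ha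
  have hb : b = -a⁻¹ := by field_simp; exact (mul_comm b a).trans hab
  rw [hb, Complex.add_im, Complex.neg_im, Complex.inv_im, neg_div, neg_neg] at h
  by_contra hlt
  push Not at hlt
  have : a.im / Complex.normSq a < 0 := div_neg_of_neg_of_pos hlt hn
  linarith

theorem eig₁_ne_zero_and_im_nonneg {A : Matrix (Fin 2) (Fin 2) ℂ} (hdet : A.det = -1)
    (htr : 0 ≤ A.trace.im) : eig₁ A ≠ 0 ∧ 0 ≤ (eig₁ A).im :=
  ne_zero_and_im_nonneg_of_mul_eq ((eig₁_mul_eig₂ A).trans hdet) (by rwa [eig₁_add_eig₂])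

theorem eig₂_ne_zero_and_im_nonneg {A : Matrix (Fin 2) (Fin 2) ℂ} (hdet : A.det = -1)
    (htr : 0 ≤ A.trace.im) : eig₂ A ≠ 0 ∧ 0 ≤ (eig₂ A).im :=
  ne_zero_and_im_nonneg_of_mul_eq ((mul_comm _ _).trans ((eig₁_mul_eig₂ A).trans hdet))
    (by rwa [add_comm, eig₁_add_eig₂])

theorem trace_matLog (A : Matrix (Fin 2) (Fin 2) ℂ) :
    (matLog A).trace = logBranch (eig₁ A) + logBranch (eig₂ A) := by
  have h1 := eig₁_add_eig₂ A
  have h2 := dslope_mul_sub logBranch (eig₁ A) (eig₂ A)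
  rw [matLog_eq, Matrix.trace_add, Matrix.trace_smul, Matrix.trace_smul, Matrix.trace_one, ← h1]
  simp only [Fintype.card_fin, smul_eq_mul]
  push_cast
  linear_combination h2

theorem trace_matLog_of_det {A : Matrix (Fin 2) (Fin 2) ℂ} (hdet : A.det = -1)
    (htr : 0 ≤ A.trace.im) : (matLog A).trace = Real.pi * Complex.I := by
  obtain ⟨h1, h2⟩ := eig₁_ne_zero_and_im_nonneg hdet htr
  rw [trace_matLog]
  exact logBranch_add_logBranch (mem_logDomain h1 h2) ((eig₁_mul_eig₂ A).trans hdet)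

theorem matIm_apply_of_symm {B : Matrix (Fin 2) (Fin 2) ℂ} (hB : B 0 1 = B 1 0) (i j : Fin 2) :
    matIm B i j = ((B i j).im : ℂ) := by
  have h : B j i = B i j := by
    fin_cases i <;> fin_cases j <;> simp [hB]
  simp only [matIm, Matrix.smul_apply, Matrix.sub_apply, Matrix.conjTranspose_apply, h, smul_eq_mul]
  rw [Complex.star_def, Complex.sub_conj]
  push_cast
  field_simp

theorem matLog_apply (A : Matrix (Fin 2) (Fin 2) ℂ) (i j : Fin 2) :
    matLog A i j = (if i = j then logBranch (eig₁ A) else 0) +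
      dslope logBranch (eig₁ A) (eig₂ A) * (A i j - if i = j then eig₁ A else 0) := by
  unfold matLog
  simp only [Matrix.add_apply, Matrix.smul_apply, Matrix.sub_apply, Matrix.one_apply, smul_eq_mul,
    mul_ite, mul_one, mul_zero]

theorem matLog_symm {A : Matrix (Fin 2) (Fin 2) ℂ} (hA : A 0 1 = A 1 0) :
    matLog A 0 1 = matLog A 1 0 := by
  rw [matLog_apply, matLog_apply, hA]
  simp

theorem im_eq_zero_of_sq_eq {w : ℂ} {r : ℝ} (hr : 0 ≤ r) (h : w ^ 2 = r) : w.im = 0 := by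
  have h1 := congrArg Complex.re h
  have h2 := congrArg Complex.im h
  simp only [sq, Complex.mul_re, Complex.mul_im, Complex.ofReal_re, Complex.ofReal_im] at h1 h2
  by_contra h0
  have : w.re = 0 := by
    have : w.re * w.im = 0 := by linarith
    exact (mul_eq_zero.1 this).resolve_right h0
  rw [this] at h1
  have : 0 < w.im * w.im := mul_self_pos.2 h0
  linarith

/-- If `A` has purely imaginary entries, then both eigenvalues lie on the positive imaginary axis,
and `Im log A` is `π / 2` times the identity. -/
theorem im_matLog_of_re_eq_zero {A : Matrix (Fin 2) (Fin 2) ℂ} (hA : A 0 1 = A 1 0)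
    (hdet : A.det = -1) (htr : 0 ≤ A.trace.im) (hre : ∀ i j, (A i j).re = 0) (i j : Fin 2) :
    (matLog A i j).im = if i = j then Real.pi / 2 else 0 := by
  obtain ⟨h1, h1i⟩ := eig₁_ne_zero_and_im_nonneg hdet htr
  obtain ⟨h2, h2i⟩ := eig₂_ne_zero_and_im_nonneg hdet htr
  have hsum := eig₁_add_eig₂ A
  have hprod := eig₁_mul_eig₂ A
  rw [Matrix.trace_fin_two] at hsum
  rw [Matrix.det_fin_two] at hprod
  have hAI : ∀ i j, A i j = (A i j).im * Complex.I := fun i j => by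
    apply Complex.ext <;> simp [hre]
  -- The discriminant of the real symmetric matrix `i A` is not negative.
  have hsq : ((eig₁ A - eig₂ A) * Complex.I) ^ 2 =
      ((((A 0 0).im - (A 1 1).im) ^ 2 + 4 * (A 0 1).im ^ 2 : ℝ) : ℂ) := by
    rw [hA, hAI 0 0, hAI 1 1, hAI 1 0] at hprod
    rw [hAI 0 0, hAI 1 1] at hsum
    rw [hA]
    push_cast
    linear_combination (eig₁ A + eig₂ A + ((A 0 0).im * Complex.I + (A 1 1).im * Complex.I)) *
      Complex.I ^ 2 * hsum - 4 * Complex.I ^ 2 * hprod + ((((A 0 0).im - (A 1 1).im) ^ 2 +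
      4 * (A 1 0).im ^ 2 : ℂ)) * (Complex.I ^ 2 - 1) * Complex.I_sq
  have hdiff := im_eq_zero_of_sq_eq (by positivity) hsq
  simp only [Complex.mul_im, Complex.I_re, Complex.I_im, mul_zero, mul_one, add_zero,
    Complex.sub_re] at hdiff
  have hs := congrArg Complex.re hsum
  simp only [Complex.add_re, hre, add_zero] at hs
  have e1 : eig₁ A = (eig₁ A).im * Complex.I := by
    apply Complex.ext <;> simp; linarith
  have e2 : eig₂ A = (eig₂ A).im * Complex.I := by
    apply Complex.ext <;> simp; linarith
  have p1 : 0 < (eig₁ A).im := lt_of_le_of_ne h1i fun h => h1 (by rw [e1, ← h]; simp)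
  have p2 : 0 < (eig₂ A).im := lt_of_le_of_ne h2i fun h => h2 (by rw [e2, ← h]; simp)
  have L1 : (logBranch (eig₁ A)).im = Real.pi / 2 := by rw [e1]; exact logBranch_ofReal_mul_I_im p1
  have L2 : (logBranch (eig₂ A)).im = Real.pi / 2 := by rw [e2]; exact logBranch_ofReal_mul_I_im p2
  have hβ : (dslope logBranch (eig₁ A) (eig₂ A)).re = 0 := by
    by_cases h : eig₁ A = eig₂ A
    · rw [← h, dslope_same,
        (hasStrictDerivAt_logBranch (mem_logDomain h1 h1i)).hasDerivAt.deriv, Complex.inv_re]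
      have : (eig₁ A).re = 0 := by linarith
      rw [this, zero_div]
    · have := congrArg Complex.im (dslope_mul_sub logBranch (eig₁ A) (eig₂ A))
      simp only [Complex.mul_im, Complex.sub_im, Complex.sub_re, L1, L2] at this
      have r1 : (eig₁ A).re = 0 := by linarith
      have r2 : (eig₂ A).re = 0 := by linarith
      have hne : (eig₂ A).im - (eig₁ A).im ≠ 0 := fun h0 => h (by
        apply Complex.ext <;> linarith)
      rw [r1, r2] at this
      have h0 : (dslope logBranch (eig₁ A) (eig₂ A)).re * ((eig₂ A).im - (eig₁ A).im) = 0 := by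
        linarith
      exact (mul_eq_zero.1 h0).resolve_right hne
  have r1 : (eig₁ A).re = 0 := by linarith
  rw [matLog_apply]
  split_ifs with h
  · simp [hβ, L1, r1, hre]
  · simp [hβ, hre]

/-- The converse of `im_matLog_of_re_eq_zero`. The discriminant of `log A` is not negative, so
both eigenvalues of `log A` have imaginary part `π / 2`. Hence the eigenvalues of `A` are purely
imaginary, and the divided difference that relates `log A` to `A` is purely imaginary and nonzero.
-/
theorem re_eq_zero_of_im_matLog {A : Matrix (Fin 2) (Fin 2) ℂ} (hA : A 0 1 = A 1 0)
    (hdet : A.det = -1) (htr : 0 ≤ A.trace.im)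
    (him : ∀ i j, (matLog A i j).im = if i = j then Real.pi / 2 else 0) (i j : Fin 2) :
    (A i j).re = 0 := by
  obtain ⟨h1, h1i⟩ := eig₁_ne_zero_and_im_nonneg hdet htr
  obtain ⟨h2, h2i⟩ := eig₂_ne_zero_and_im_nonneg hdet htr
  have hsum := eig₁_add_eig₂ A
  have hprod := eig₁_mul_eig₂ A
  have htrL := trace_matLog_of_det hdet htr
  rw [trace_matLog] at htrL
  have hds := dslope_mul_sub logBranch (eig₁ A) (eig₂ A)
  rw [Matrix.trace_fin_two] at hsum
  rw [Matrix.det_fin_two] at hprod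
  set β := dslope logBranch (eig₁ A) (eig₂ A) with hβdef
  set L1 := logBranch (eig₁ A) with hL1
  set L2 := logBranch (eig₂ A) with hL2
  have B00 : matLog A 0 0 = L1 + β * (A 0 0 - eig₁ A) := by simp [matLog_apply, ← hβdef, ← hL1]
  have B11 : matLog A 1 1 = L1 + β * (A 1 1 - eig₁ A) := by simp [matLog_apply, ← hβdef, ← hL1]
  have B01 : matLog A 0 1 = β * A 0 1 := by simp [matLog_apply, ← hβdef]
  have i00 : (matLog A 0 0).im = Real.pi / 2 := by simpa using him 0 0
  have i11 : (matLog A 1 1).im = Real.pi / 2 := by simpa using him 1 1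
  have i01 : (matLog A 0 1).im = 0 := by simpa using him 0 1
  have c0 : matLog A 0 0 - matLog A 1 1 = (((matLog A 0 0).re - (matLog A 1 1).re : ℝ) : ℂ) := by
    apply Complex.ext <;> simp [i00, i11]
  have c1 : matLog A 0 1 = ((matLog A 0 1).re : ℂ) := by
    apply Complex.ext <;> simp [i01]
  have hsq : (L1 - L2) ^ 2 =
      ((((matLog A 0 0).re - (matLog A 1 1).re) ^ 2 + 4 * (matLog A 0 1).re ^ 2 : ℝ) : ℂ) := by
    rw [Complex.ofReal_add, Complex.ofReal_pow, ← c0, Complex.ofReal_mul, Complex.ofReal_pow, ← c1,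
      B00, B11, B01]
    push_cast
    have : (L1 - L2) ^ 2 = (β * (eig₂ A - eig₁ A)) ^ 2 := by rw [hds]; ring
    rw [this]
    rw [hA] at hprod ⊢
    linear_combination β ^ 2 * ((eig₁ A + eig₂ A + (A 0 0 + A 1 1)) * hsum - 4 * hprod)
  have hd := im_eq_zero_of_sq_eq (by positivity) hsq
  have hs := congrArg Complex.im htrL
  simp only [Complex.add_im, Complex.mul_im, Complex.ofReal_re, Complex.I_im, mul_one,
    Complex.ofReal_im, Complex.I_re, mul_zero, add_zero] at hs
  rw [Complex.sub_im] at hd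
  have n1 : L1.im = Real.pi / 2 := by linarith
  have n2 : L2.im = Real.pi / 2 := by linarith
  have hexp : ∀ w : ℂ, w ≠ 0 → (logBranch w).im = Real.pi / 2 → w.re = 0 := by
    intro w hw h
    rw [← exp_logBranch hw, Complex.exp_re, h, Real.cos_pi_div_two, mul_zero]
  have r1 := hexp _ h1 n1
  have r2 := hexp _ h2 n2
  have hβ : β ≠ 0 ∧ β.re = 0 := by
    by_cases h : eig₁ A = eig₂ A
    · rw [hβdef, ← h, dslope_same,
        (hasStrictDerivAt_logBranch (mem_logDomain h1 h1i)).hasDerivAt.deriv]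
      refine ⟨inv_ne_zero h1, ?_⟩
      rw [Complex.inv_re, r1, zero_div]
    · constructor
      · intro h0
        rw [h0, zero_mul] at hds
        apply h
        rw [← exp_logBranch h1, ← exp_logBranch h2, ← hL1, ← hL2, sub_eq_zero.1 hds.symm]
      · have := congrArg Complex.im hds
        simp only [Complex.mul_im, Complex.sub_im, Complex.sub_re, n1, n2] at this
        have hne : (eig₂ A).im - (eig₁ A).im ≠ 0 := fun h0 => h (by
          apply Complex.ext <;> linarith)
        rw [r1, r2] at this
        have h0 : β.re * ((eig₂ A).im - (eig₁ A).im) = 0 := by linarith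
        exact (mul_eq_zero.1 h0).resolve_right hne
  have hβi : β.im ≠ 0 := fun h => hβ.1 (Complex.ext hβ.2 h)
  have fin : ∀ x : ℂ, (β * x).im = 0 → x.re = 0 := by
    intro x hx
    rw [Complex.mul_im, hβ.2, zero_mul, zero_add] at hx
    exact (mul_eq_zero.1 hx).resolve_left hβi
  have hdiag : ∀ k, (matLog A k k).im = Real.pi / 2 → matLog A k k = L1 + β * (A k k - eig₁ A) →
      (A k k).re = 0 := by
    intro k hk1 hk2
    rw [hk2, Complex.add_im, n1] at hk1
    have := fin (A k k - eig₁ A) (by linarith)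
    rw [Complex.sub_re, r1] at this
    linarith
  have hoff : (A 0 1).re = 0 := fin _ (by rw [← B01]; exact i01)
  fin_cases i <;> fin_cases j
  · exact hdiag 0 i00 B00
  · exact hoff
  · exact hA ▸ hoff
  · exact hdiag 1 i11 B11

/-- A real symmetric matrix with trace `1` and determinant `0` is a projection `P_α`. -/
theorem exists_proj_of_trace_det {P : Matrix (Fin 2) (Fin 2) ℝ} (hP : P 0 1 = P 1 0)
    (htr : P 0 0 + P 1 1 = 1) (hdet : P 0 0 * P 1 1 = P 0 1 ^ 2) : ∃ α : ℝ, P = proj α := by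
  have h : ‖(⟨2 * P 0 0 - 1, 2 * P 0 1⟩ : ℂ)‖ = 1 := by
    have : ‖(⟨2 * P 0 0 - 1, 2 * P 0 1⟩ : ℂ)‖ ^ 2 = 1 := by
      rw [Complex.sq_norm, Complex.normSq_mk]
      have : P 1 1 = 1 - P 0 0 := by linarith
      rw [this] at hdet
      nlinarith
    have h0 := norm_nonneg (⟨2 * P 0 0 - 1, 2 * P 0 1⟩ : ℂ)
    nlinarith
  -- `P = P_α` says that this number is `cos 2α + i sin 2α`.
  set w : ℂ := ⟨2 * P 0 0 - 1, 2 * P 0 1⟩ with hw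
  have hw0 : w ≠ 0 := by rintro h0; rw [h0] at h; simp at h
  have hc := Complex.cos_arg hw0
  have hs := Complex.sin_arg w
  rw [h, div_one] at hc hs
  have hα : w.arg = 2 * (w.arg / 2) := by ring
  rw [hα, Real.cos_two_mul] at hc
  rw [hα, Real.sin_two_mul] at hs
  simp only [hw] at hc hs
  refine ⟨w.arg / 2, ?_⟩
  have hsc := Real.sin_sq_add_cos_sq (w.arg / 2)
  ext i j
  fin_cases i <;> fin_cases j <;> simp [proj] <;> simp only [hw] at * <;> linarith

/-- For a real symmetric matrix of determinant `-1`, the eigenvalues are real and of opposite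
signs, and `Im log A / π` is the projection onto the eigenspace of the negative one. -/
theorem exists_proj_of_real {A : Matrix (Fin 2) (Fin 2) ℝ} (hA : A 0 1 = A 1 0)
    (hdet : A 0 0 * A 1 1 - A 0 1 ^ 2 = -1) :
    ∃ α : ℝ, (1 / Real.pi : ℂ) • matIm (matLog (A.map (fun r : ℝ => (r : ℂ)))) =
      (proj α).map (fun r : ℝ => (r : ℂ)) := by
  set B : Matrix (Fin 2) (Fin 2) ℂ := A.map (fun r : ℝ => (r : ℂ)) with hB
  have hBij : ∀ i j, B i j = (A i j : ℂ) := fun i j => rfl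
  have hsum := eig₁_add_eig₂ B
  have hprod := eig₁_mul_eig₂ B
  have hds := dslope_mul_sub logBranch (eig₁ B) (eig₂ B)
  have hdetC : (A 0 0 : ℂ) * A 1 1 - (A 0 1 : ℂ) ^ 2 = -1 := by exact_mod_cast hdet
  rw [Matrix.trace_fin_two, hBij, hBij] at hsum
  rw [Matrix.det_fin_two, hBij, hBij, hBij, hBij, ← hA, ← sq, hdetC] at hprod
  have hsq : (eig₁ B - eig₂ B) ^ 2 = (((A 0 0 + A 1 1) ^ 2 + 4 : ℝ) : ℂ) := by
    push_cast
    linear_combination (eig₁ B + eig₂ B + (A 0 0 + A 1 1)) * hsum - 4 * hprod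
  have hd := im_eq_zero_of_sq_eq (by positivity) hsq
  have hs := congrArg Complex.im hsum
  simp only [Complex.add_im, Complex.ofReal_im, add_zero] at hs
  rw [Complex.sub_im] at hd
  have e1 : eig₁ B = ((eig₁ B).re : ℂ) := by
    apply Complex.ext <;> simp; linarith
  have e2 : eig₂ B = ((eig₂ B).re : ℂ) := by
    apply Complex.ext <;> simp; linarith
  set p := (eig₁ B).re with hp
  set q := (eig₂ B).re with hq
  have hpq : p * q = -1 := by
    rw [e1, e2] at hprod; exact_mod_cast hprod
  have hpqs : p + q = A 0 0 + A 1 1 := by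
    rw [e1, e2] at hsum; exact_mod_cast hsum
  have hne : q - p ≠ 0 := by
    intro h
    have : q = p := by linarith
    rw [this] at hpq
    nlinarith
  have hdm : (dslope logBranch (eig₁ B) (eig₂ B)).im * (q - p) =
      (logBranch (eig₂ B)).im - (logBranch (eig₁ B)).im := by
    have := congrArg Complex.im hds
    rw [e1, e2] at this ⊢
    rw [← Complex.ofReal_sub, Complex.im_mul_ofReal, Complex.sub_im] at this
    exact this
  have hlogim : ∀ i j, (matLog B i j).im = (if i = j then (logBranch (eig₁ B)).im else 0) +
      (dslope logBranch (eig₁ B) (eig₂ B)).im * (A i j - if i = j then p else 0) := by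
    intro i j
    rw [matLog_apply, hBij]
    split_ifs
    · rw [Complex.add_im]
      congr 1
      rw [show (A i j : ℂ) - eig₁ B = ((A i j - p : ℝ) : ℂ) by rw [e1]; push_cast; rfl,
        Complex.im_mul_ofReal]
    · rw [zero_add, zero_add, sub_zero, sub_zero, Complex.im_mul_ofReal]
  -- `u` is the positive and `v` the negative eigenvalue.
  obtain ⟨u, v, huv, huvs, huvne, hP⟩ : ∃ u v : ℝ, u * v = -1 ∧ u + v = A 0 0 + A 1 1 ∧
      v - u ≠ 0 ∧ ∀ i j, (matLog B i j).im =
        Real.pi * ((A i j - if i = j then u else 0) / (v - u)) := by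
    rcases lt_trichotomy p 0 with h | h | h
    · have hq0 : 0 < q := by nlinarith
      have l1 : (logBranch (eig₁ B)).im = Real.pi := by rw [e1]; exact logBranch_ofReal_im_of_neg h
      have l2 : (logBranch (eig₂ B)).im = 0 := by rw [e2]; exact logBranch_ofReal_im_of_pos hq0
      rw [l1, l2] at hdm
      have hb : (dslope logBranch (eig₁ B) (eig₂ B)).im = -Real.pi / (q - p) := by
        rw [eq_div_iff hne]; linarith
      refine ⟨q, p, by linarith, by linarith, by intro h; apply hne; linarith, fun i j => ?_⟩
      have hne' : p - q ≠ 0 := by intro h; apply hne; linarith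
      rw [hlogim, l1, hb]
      split_ifs <;> field_simp <;> ring
    · rw [h] at hpq; simp at hpq
    · have hq0 : q < 0 := by nlinarith
      have l1 : (logBranch (eig₁ B)).im = 0 := by rw [e1]; exact logBranch_ofReal_im_of_pos h
      have l2 : (logBranch (eig₂ B)).im = Real.pi := by
        rw [e2]; exact logBranch_ofReal_im_of_neg hq0
      rw [l1, l2] at hdm
      have hb : (dslope logBranch (eig₁ B) (eig₂ B)).im = Real.pi / (q - p) := by
        rw [eq_div_iff hne]; linarith
      refine ⟨p, q, hpq, hpqs, hne, fun i j => ?_⟩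
      rw [hlogim, l1, hb]
      split_ifs <;> field_simp <;> ring
  set P : Matrix (Fin 2) (Fin 2) ℝ :=
    Matrix.of fun i j => (A i j - if i = j then u else 0) / (v - u) with hPdef
  have hPij : ∀ i j, P i j = (A i j - if i = j then u else 0) / (v - u) := fun i j => rfl
  obtain ⟨α, hα⟩ := exists_proj_of_trace_det (P := P) (by simp [hPij, hA])
    (by
      simp only [hPij, if_true]
      rw [← add_div, div_eq_one_iff_eq huvne]
      linarith)
    (by
      simp only [hPij, if_true]
      rw [if_neg (by decide), sub_zero, div_mul_div_comm, div_pow, ← sq]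
      congr 1
      have e : v = A 0 0 + A 1 1 - u := by linarith
      rw [e] at huv
      linarith)
  refine ⟨α, ?_⟩
  ext i j
  rw [Matrix.smul_apply, matIm_apply_of_symm (matLog_symm (by simp [hBij, hA])), hP,
    Matrix.map_apply, ← hα, hPij, smul_eq_mul]
  push_cast
  have hπ : (Real.pi : ℂ) ≠ 0 := by exact_mod_cast Real.pi_ne_zero
  field_simp

/-! ### Absolutely continuous functions -/

theorem intervalIntegrable_of_locallyIntegrable {E : Type*} [NormedAddCommGroup E]
    {k : ℝ → E} (hk : LocallyIntegrable k volume) (a b : ℝ) : IntervalIntegrable k volume a b :=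
  intervalIntegrable_iff.2
    ((hk.integrableOn_isCompact isCompact_uIcc).mono_set Set.uIoc_subset_uIcc)

theorem locallyIntegrable_norm {E : Type*} [NormedAddCommGroup E] {k : ℝ → E}
    (hk : LocallyIntegrable k volume) : LocallyIntegrable (fun x => ‖k x‖) volume :=
  hk.mono hk.aestronglyMeasurable.norm (Eventually.of_forall fun x => by simp)

theorem absolutelyContinuousOnInterval_of_dist_le {X Y : Type*} [PseudoMetricSpace X]
    [PseudoMetricSpace Y] {f : ℝ → X} {g : ℝ → Y} {a b C : ℝ}
    (hf : AbsolutelyContinuousOnInterval f a b)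
    (h : ∀ x y, dist (g x) (g y) ≤ C * dist (f x) (f y)) :
    AbsolutelyContinuousOnInterval g a b := by
  have h1 := Tendsto.const_mul C hf
  rw [mul_zero] at h1
  refine squeeze_zero (fun E => Finset.sum_nonneg fun i _ => dist_nonneg) (fun E => ?_) h1
  rw [Finset.mul_sum]
  exact Finset.sum_le_sum fun i _ => h _ _

/-- Primitives of vector valued locally integrable functions are absolutely continuous. -/
theorem absolutelyContinuousOnInterval_integral {E : Type*} [NormedAddCommGroup E]
    [NormedSpace ℝ E] {k : ℝ → E} (hk : LocallyIntegrable k volume) (c a b : ℝ) :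
    AbsolutelyContinuousOnInterval (fun x => ∫ s in c..x, k s) a b := by
  have hi : ∀ a b, IntervalIntegrable k volume a b := intervalIntegrable_of_locallyIntegrable hk
  have hn : LocallyIntegrable (fun x => ‖k x‖) volume := locallyIntegrable_norm hk
  have hin : ∀ a b, IntervalIntegrable (fun x => ‖k x‖) volume a b := fun a b =>
    intervalIntegrable_of_locallyIntegrable hn a b
  have h0 : AbsolutelyContinuousOnInterval (fun x => ∫ s in a..x, ‖k s‖) a b :=
    (hin a b).absolutelyContinuousOnInterval_intervalIntegral Set.left_mem_uIcc
  refine absolutelyContinuousOnInterval_of_dist_le (C := 1) h0 fun x y => ?_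
  rw [one_mul, dist_eq_norm, dist_eq_norm,
    intervalIntegral.integral_interval_sub_left (hi _ _) (hi _ _),
    intervalIntegral.integral_interval_sub_left (hin _ _) (hin _ _)]
  exact intervalIntegral.norm_integral_le_abs_integral_norm

/-- The fundamental theorem of calculus for absolutely continuous vector valued functions whose
almost everywhere derivative is locally integrable. -/
theorem integral_eq_sub_of_absolutelyContinuous {E : Type*} [NormedAddCommGroup E]
    [NormedSpace ℝ E] [CompleteSpace E] {h k : ℝ → E}
    (hh : ∀ a b, AbsolutelyContinuousOnInterval h a b) (hk : LocallyIntegrable k volume)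
    (hd : ∀ᵐ x, HasDerivAt h (k x) x) (a b : ℝ) : ∫ x in a..b, k x = h b - h a := by
  have hac := (hh a b).sub (absolutelyContinuousOnInterval_integral hk a a b)
  obtain ⟨C, hC⟩ := hac.const_of_ae_hasDerivAt_zero (by
    filter_upwards [hd, LocallyIntegrable.ae_hasDerivAt_integral hk] with x h1 h2 _
    exact (h1.sub (h2 a)).congr_deriv (sub_self _))
  have ha := hC a Set.left_mem_uIcc
  have hb := hC b Set.right_mem_uIcc
  simp only [Pi.sub_apply, intervalIntegral.integral_same, sub_zero] at ha hb
  rw [ha, ← hb]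
  abel

/-! ### Linear equations with locally integrable coefficients -/

section Picard

variable {E : Type*} [NormedAddCommGroup E] [NormedSpace ℝ E]

/-- The terms of the Picard series for `y' = A y`, `y 0 = v`. -/
def picard (A : ℝ → E →L[ℝ] E) (v : E) : ℕ → ℝ → E
  | 0 => fun _ => v
  | n + 1 => fun x => ∫ s in 0..x, A s (picard A v n s)

theorem locallyIntegrable_clm_apply {A : ℝ → E →L[ℝ] E} (hA : LocallyIntegrable A volume)
    {y : ℝ → E} (hy : Continuous y) : LocallyIntegrable (fun s => A s (y s)) volume := by
  rw [locallyIntegrable_iff] at hA ⊢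
  intro K hK
  obtain ⟨C, hC⟩ := hK.exists_bound_of_continuousOn hy.continuousOn
  have h1 := hA K hK
  refine Integrable.mono' (h1.norm.mul_const C) ?_ ?_
  · exact ContinuousLinearMap.aestronglyMeasurable_comp₂ (ContinuousLinearMap.id ℝ (E →L[ℝ] E))
      h1.aestronglyMeasurable hy.aestronglyMeasurable.restrict
  · filter_upwards [ae_restrict_mem hK.measurableSet] with s hs
    exact (A s).le_opNorm_of_le (hC s hs)

theorem continuous_picard {A : ℝ → E →L[ℝ] E} (hA : LocallyIntegrable A volume) (v : E) (n : ℕ) :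
    Continuous (picard A v n) := by
  induction n with
  | zero => exact continuous_const
  | succ n ih =>
    exact intervalIntegral.continuous_primitive
      (fun a b => intervalIntegrable_of_locallyIntegrable (locallyIntegrable_clm_apply hA ih) a b) 0

theorem integral_mul_pow_integral {a : ℝ → ℝ} (ha : LocallyIntegrable a volume) (n : ℕ) (x : ℝ) :
    ∫ s in 0..x, a s * (∫ r in 0..s, a r) ^ n = (∫ r in 0..x, a r) ^ (n + 1) / (n + 1) := by
  set K : ℝ → ℝ := fun s => ∫ r in 0..s, a r with hK
  have hKc : Continuous K :=
    intervalIntegral.continuous_primitive (intervalIntegrable_of_locallyIntegrable ha) 0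
  have hac : ∀ m : ℕ, ∀ c d, AbsolutelyContinuousOnInterval (fun s => K s ^ m) c d := by
    intro m c d
    induction m with
    | zero =>
      simp only [pow_zero]
      exact (LipschitzWith.const (1 : ℝ)).lipschitzOnWith.absolutelyContinuousOnInterval
    | succ m ih =>
      simp only [pow_succ]
      exact ih.fun_mul (absolutelyContinuousOnInterval_integral ha 0 c d)
  have hloc : LocallyIntegrable (fun s => a s * K s ^ n) volume := by
    have := ha.mul_continuous (hKc.pow n)
    exact this
  have := integral_eq_sub_of_absolutelyContinuous
    (h := fun s => K s ^ (n + 1) / (n + 1)) (k := fun s => a s * K s ^ n)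
    (fun c d => by
      have := (hac (n + 1) c d).const_mul (1 / (n + 1 : ℝ))
      refine absolutelyContinuousOnInterval_of_dist_le (C := 1) this fun x y => ?_
      rw [one_mul]
      apply le_of_eq
      simp only [div_eq_inv_mul, mul_one])
    hloc (by
      filter_upwards [LocallyIntegrable.ae_hasDerivAt_integral ha] with s hs
      refine (((hs 0).pow (n + 1)).div_const (n + 1 : ℝ)).congr_deriv ?_
      have : (n + 1 : ℝ) ≠ 0 := by positivity
      push_cast
      field_simp
      exact mul_comm _ _) 0 x
  rw [this]
  simp [hK]

/-- A sign `c` that makes `c * ∫ r in 0..s, a r` nonnegative for all `s` between `0` and `x`. -/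
theorem exists_sign_integral {a : ℝ → ℝ} (h0 : ∀ s, 0 ≤ a s)
    (x : ℝ) : ∃ c : ℝ, |c| = 1 ∧ ∀ s ∈ Set.uIoc 0 x, |∫ r in 0..s, a r| = c * ∫ r in 0..s, a r := by
  rcases le_total 0 x with h | h
  · refine ⟨1, by simp, fun s hs => ?_⟩
    rw [Set.uIoc_of_le h] at hs
    rw [one_mul, abs_of_nonneg (intervalIntegral.integral_nonneg hs.1.le fun r _ => h0 r)]
  · refine ⟨-1, by simp, fun s hs => ?_⟩
    rw [Set.uIoc_of_ge h] at hs
    have : 0 ≤ ∫ r in s..0, a r := intervalIntegral.integral_nonneg hs.2 fun r _ => h0 r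
    rw [intervalIntegral.integral_symm, abs_neg, abs_of_nonneg this]
    ring

/-- The terms of the Picard series are bounded by those of the exponential series. -/
theorem norm_picard_le {A : ℝ → E →L[ℝ] E} (hA : LocallyIntegrable A volume) (v : E) (n : ℕ)
    (x : ℝ) : ‖picard A v n x‖ ≤ ‖v‖ * (|∫ s in 0..x, ‖A s‖| ^ n / n.factorial) := by
  induction n generalizing x with
  | zero => simp [picard]
  | succ n ih =>
    have ha : LocallyIntegrable (fun s => ‖A s‖) volume := locallyIntegrable_norm hA
    obtain ⟨c, hc1, hc⟩ := exists_sign_integral (a := fun s => ‖A s‖) (fun s => norm_nonneg _) x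
    have hKc : Continuous fun s => ∫ r in 0..s, ‖A r‖ :=
      intervalIntegral.continuous_primitive (intervalIntegrable_of_locallyIntegrable ha) 0
    have hb : ∀ s ∈ Set.uIoc 0 x, ‖A s (picard A v n s)‖ ≤
        (‖v‖ * c ^ n / n.factorial) * (‖A s‖ * (∫ r in 0..s, ‖A r‖) ^ n) := by
      intro s hs
      refine ((A s).le_opNorm_of_le (ih s)).trans (le_of_eq ?_)
      rw [hc s hs, mul_pow]
      ring
    have hint : IntervalIntegrable (fun s => (‖v‖ * c ^ n / n.factorial) *
        (‖A s‖ * (∫ r in 0..s, ‖A r‖) ^ n)) volume 0 x :=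
      (intervalIntegrable_of_locallyIntegrable (ha.mul_continuous (hKc.pow n)) _ _).const_mul _
    have h1 := intervalIntegral.norm_integral_le_abs_of_norm_le
      (ae_restrict_of_forall_mem measurableSet_uIoc hb) hint
    rw [intervalIntegral.integral_const_mul, integral_mul_pow_integral ha] at h1
    refine h1.trans (le_of_eq ?_)
    rw [abs_mul, abs_div, abs_mul, abs_div, abs_pow, abs_pow, hc1, one_pow, abs_norm,
      Nat.factorial_succ, abs_of_nonneg (by positivity : (0 : ℝ) ≤ n.factorial),
      abs_of_nonneg (by positivity : (0 : ℝ) ≤ (n : ℝ) + 1)]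
    push_cast
    field_simp

/-- A linear differential equation with locally integrable coefficients has a global solution with
any prescribed value at `0`, here in integrated form. -/
theorem exists_continuous_integral_eq [CompleteSpace E] {A : ℝ → E →L[ℝ] E}
    (hA : LocallyIntegrable A volume) (v : E) :
    ∃ y : ℝ → E, Continuous y ∧ ∀ x, y x = v + ∫ s in 0..x, A s (y s) := by
  have ha : LocallyIntegrable (fun s => ‖A s‖) volume := locallyIntegrable_norm hA
  have hsum : ∀ x, Summable fun n : ℕ => ‖v‖ * (|∫ s in 0..x, ‖A s‖| ^ n / n.factorial) :=
    fun x => (Real.summable_pow_div_factorial _).mul_left _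
  have hmono : ∀ x s, s ∈ Set.uIcc 0 x → |∫ r in 0..s, ‖A r‖| ≤ |∫ r in 0..x, ‖A r‖| := by
    intro x s hs
    refine intervalIntegral.abs_integral_mono_interval (Set.uIoc_subset_uIoc_of_uIcc_subset_uIcc
      (Set.uIcc_subset_uIcc_left hs)) (Eventually.of_forall fun r => norm_nonneg _)
      (intervalIntegrable_of_locallyIntegrable ha _ _)
  have hbd : ∀ x s, s ∈ Set.uIcc 0 x → ∀ n, ‖picard A v n s‖ ≤
      ‖v‖ * (|∫ s in 0..x, ‖A s‖| ^ n / n.factorial) := by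
    intro x s hs n
    refine (norm_picard_le hA v n s).trans ?_
    have := hmono x s hs
    gcongr
  set y : ℝ → E := fun x => ∑' n, picard A v n x with hy
  have hys : ∀ x, HasSum (fun n => picard A v n x) (y x) := fun x =>
    (Summable.of_norm_bounded (hsum x) (norm_picard_le hA v · x)).hasSum
  have hyc : Continuous y := by
    rw [continuous_iff_continuousAt]
    have hon : ∀ x, ContinuousOn y (Set.uIcc 0 x) := fun x =>
      continuousOn_tsum (fun n => (continuous_picard hA v n).continuousOn) (hsum x)
        fun n s hs => hbd x s hs n
    intro x
    rcases lt_trichotomy x 0 with h | h | h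
    · refine (hon (x - 1)).continuousAt ?_
      rw [Set.uIcc_of_ge (by linarith)]
      exact Icc_mem_nhds (by linarith) h
    · subst h
      have := (hon (-1)).union_of_isClosed (hon 1) isClosed_Icc isClosed_Icc
      refine this.continuousAt ?_
      rw [Set.uIcc_of_ge (by norm_num), Set.uIcc_of_le (by norm_num),
        Set.Icc_union_Icc_eq_Icc (by norm_num) (by norm_num)]
      exact Icc_mem_nhds (by norm_num) (by norm_num)
    · refine (hon (x + 1)).continuousAt ?_
      rw [Set.uIcc_of_le (by linarith)]
      exact Icc_mem_nhds h (by linarith)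
  refine ⟨y, hyc, fun x => ?_⟩
  have h1 : HasSum (fun n => picard A v (n + 1) x) (∫ s in 0..x, A s (y s)) := by
    refine intervalIntegral.hasSum_integral_of_dominated_convergence
      (fun n s => ‖A s‖ * (‖v‖ * (|∫ s in 0..x, ‖A s‖| ^ n / n.factorial))) ?_ ?_ ?_ ?_ ?_
    · intro n
      exact (locallyIntegrable_clm_apply hA
        (continuous_picard hA v n)).aestronglyMeasurable.restrict
    · intro n
      exact Eventually.of_forall fun s hs =>
        (A s).le_opNorm_of_le (hbd x s (Set.uIoc_subset_uIcc hs) n)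
    · exact Eventually.of_forall fun s _ => (hsum x).mul_left _
    · simp only [tsum_mul_left]
      exact (intervalIntegrable_of_locallyIntegrable ha _ _).mul_const _
    · exact Eventually.of_forall fun s _ => (A s).hasSum (hys s)
  have h2 := (hasSum_nat_add_iff' 1).2 (hys x)
  simp only [Finset.range_one, Finset.sum_singleton] at h2
  have := h1.unique h2
  rw [this]
  simp [picard]

end Picard

/-! ### Solutions of the Dirac equation and the Lagrange identity -/

/-- The bilinear form `u ⬝ v` on `ℂ²`. -/
def dot (u v : C2) : ℂ := u 0 * v 0 + u 1 * v 1

/-- The Wronskian `uᵗ J v`. -/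
def wr (u v : C2) : ℂ := u 1 * v 0 - u 0 * v 1

/-- Componentwise complex conjugation on `ℂ²`. -/
def cj (u : C2) : C2 := WithLp.toLp 2 fun i => (starRingEnd ℂ) (u i)

@[simp] theorem cj_apply (u : C2) (i : Fin 2) : cj u i = (starRingEnd ℂ) (u i) := rfl

theorem norm_cj (u : C2) : ‖cj u‖ = ‖u‖ := by
  simp [EuclideanSpace.norm_eq]

theorem norm_sq_C2 (u : C2) : ‖u‖ ^ 2 = ‖u 0‖ ^ 2 + ‖u 1‖ ^ 2 := by
  rw [EuclideanSpace.norm_sq_eq, Fin.sum_univ_two]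

theorem dot_cj_self (u : C2) : dot u (cj u) = (‖u‖ ^ 2 : ℝ) := by
  rw [norm_sq_C2]
  simp only [dot, cj_apply, Complex.mul_conj, Complex.normSq_eq_norm_sq]
  push_cast
  rfl

theorem norm_dot_le (u v : C2) : ‖dot u v‖ ≤ ‖u‖ * ‖v‖ := by
  have h1 : ‖dot u v‖ ≤ ‖u 0‖ * ‖v 0‖ + ‖u 1‖ * ‖v 1‖ := by
    unfold dot
    refine (norm_add_le _ _).trans ?_
    rw [norm_mul, norm_mul]
  refine h1.trans (abs_le_of_sq_le_sq' ?_ (by positivity)).2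
  rw [mul_pow, norm_sq_C2, norm_sq_C2]
  nlinarith [sq_nonneg (‖u 0‖ * ‖v 1‖ - ‖u 1‖ * ‖v 0‖)]

theorem norm_wr_le (u v : C2) : ‖wr u v‖ ≤ ‖u‖ * ‖v‖ := by
  have h1 : ‖wr u v‖ ≤ ‖u 1‖ * ‖v 0‖ + ‖u 0‖ * ‖v 1‖ := by
    unfold wr
    refine (norm_sub_le _ _).trans ?_
    rw [norm_mul, norm_mul]
  refine h1.trans (abs_le_of_sq_le_sq' ?_ (by positivity)).2
  rw [mul_pow, norm_sq_C2, norm_sq_C2]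
  nlinarith [sq_nonneg (‖u 0‖ * ‖v 0‖ - ‖u 1‖ * ‖v 1‖)]

theorem continuous_dot : Continuous fun p : C2 × C2 => dot p.1 p.2 := by
  unfold dot; fun_prop

theorem continuous_wr : Continuous fun p : C2 × C2 => wr p.1 p.2 := by
  unfold wr; fun_prop

theorem continuous_cj : Continuous cj := by
  unfold cj; fun_prop

theorem LocallyAC.apply {y : ℝ → C2} (hy : LocallyAC y) (i : Fin 2) (a b : ℝ) :
    AbsolutelyContinuousOnInterval (fun x => y x i) a b := by
  refine absolutelyContinuousOnInterval_of_dist_le (C := 1) (hy a b) fun x x' => ?_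
  rw [one_mul, dist_eq_norm, dist_eq_norm]
  exact PiLp.norm_apply_le (y x - y x') i

theorem LocallyAC.cj {y : ℝ → C2} (hy : LocallyAC y) : LocallyAC fun x => cj (y x) := by
  intro a b
  refine absolutelyContinuousOnInterval_of_dist_le (C := 1) (hy a b) fun x x' => ?_
  rw [one_mul, dist_eq_norm, dist_eq_norm, ← norm_cj (y x - y x')]
  apply le_of_eq
  congr 1
  ext i
  simp

theorem hasDerivAt_apply {y : ℝ → C2} {y' : C2} {x : ℝ} (h : HasDerivAt y y' x) (i : Fin 2) :
    HasDerivAt (fun x => y x i) (y' i) x := by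
  exact ((EuclideanSpace.proj (𝕜 := ℂ) i : C2 →L[ℂ] ℂ).restrictScalars
    ℝ).hasFDerivAt.comp_hasDerivAt x h

theorem hasDerivAt_of_apply {y : ℝ → C2} {y' : C2} {x : ℝ}
    (h : ∀ i, HasDerivAt (fun x => y x i) (y' i) x) : HasDerivAt y y' x := by
  have h1 : HasDerivAt (fun x => (y x).ofLp) y'.ofLp x := hasDerivAt_pi.2 h
  exact (PiLp.continuousLinearEquiv 2 ℝ
    (fun _ : Fin 2 => ℂ)).symm.hasFDerivAt.comp_hasDerivAt x h1

theorem expr_apply_zero (W : ℝ → Matrix (Fin 2) (Fin 2) ℝ) (y : ℝ → C2) (x : ℝ) :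
    expr W y x 0 = deriv y x 1 - W x 0 0 * y x 0 - W x 0 1 * y x 1 := by
  simp [expr, J, dotProduct, Fin.sum_univ_two]
  ring

theorem expr_apply_one (W : ℝ → Matrix (Fin 2) (Fin 2) ℝ) (y : ℝ → C2) (x : ℝ) :
    expr W y x 1 = -deriv y x 0 - W x 1 0 * y x 0 - W x 1 1 * y x 1 := by
  simp [expr, J, dotProduct, Fin.sum_univ_two]
  ring

theorem expr_cj {W : ℝ → Matrix (Fin 2) (Fin 2) ℝ} {y : ℝ → C2} {x : ℝ}
    (h : DifferentiableAt ℝ y x) : expr W (fun x => cj (y x)) x = cj (expr W y x) := by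
  have hd : deriv (fun x => cj (y x)) x = cj (deriv y x) := by
    refine (hasDerivAt_of_apply fun i => ?_).deriv
    have := hasDerivAt_apply h.hasDerivAt i
    exact this.star
  ext i
  fin_cases i
  · simp [expr_apply_zero, hd]
  · simp [expr_apply_one, hd]

variable {W : ℝ → Matrix (Fin 2) (Fin 2) ℝ}

theorem IsSolution.cj {z : ℂ} {y : ℝ → C2} (hy : IsSolution W z y) :
    IsSolution W ((starRingEnd ℂ) z) fun x => cj (y x) := by
  refine ⟨hy.1.cj, ?_⟩
  filter_upwards [hy.2, hy.1.ae_differentiableAt] with x h1 h2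
  rw [expr_cj h2, h1]
  ext i
  simp

/-- The Lagrange identity: the Wronskian of `u` and `v` is an antiderivative of
`(L u) ⬝ v - u ⬝ (L v)`. -/
theorem wr_sub_wr (hW : IsCoefficient W) {u v f g : ℝ → C2} (hu : LocallyAC u) (hv : LocallyAC v)
    (hf : ∀ᵐ x, expr W u x = f x) (hg : ∀ᵐ x, expr W v x = g x)
    (hint : LocallyIntegrable (fun x => dot (f x) (v x) - dot (u x) (g x)) volume) (a b : ℝ) :
    ∫ x in a..b, (dot (f x) (v x) - dot (u x) (g x)) = wr (u b) (v b) - wr (u a) (v a) := by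
  refine integral_eq_sub_of_absolutelyContinuous (h := fun x => wr (u x) (v x)) ?_ hint ?_ a b
  · intro a b
    exact ((hu.apply 1 a b).fun_smul (hv.apply 0 a b)).sub
      ((hu.apply 0 a b).fun_smul (hv.apply 1 a b))
  · filter_upwards [hW.symm, hf, hg, hu.ae_differentiableAt, hv.ae_differentiableAt]
      with x hs hf hg hdu hdv
    have hu := hasDerivAt_apply hdu.hasDerivAt
    have hv := hasDerivAt_apply hdv.hasDerivAt
    refine (((hu 1).mul (hv 0)).sub ((hu 0).mul (hv 1))).congr_deriv ?_
    rw [← hf, ← hg]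
    simp only [dot, expr_apply_zero, expr_apply_one]
    rw [show W x 1 0 = W x 0 1 from hs.apply 0 1]
    ring

theorem IsSolution.continuous {z : ℂ} {y : ℝ → C2} (hy : IsSolution W z y) : Continuous y :=
  hy.1.continuous

/-- The Lagrange identity for solutions at two spectral parameters. -/
theorem IsSolution.wr_sub_wr (hW : IsCoefficient W) {z w : ℂ} {u v : ℝ → C2}
    (hu : IsSolution W z u) (hv : IsSolution W w v) (a b : ℝ) :
    (z - w) * ∫ x in a..b, dot (u x) (v x) = wr (u b) (v b) - wr (u a) (v a) := by
  have hc : Continuous fun x => dot (u x) (v x) :=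
    continuous_dot.comp (hu.continuous.prodMk hv.continuous)
  have e : ∀ x, dot (z • u x) (v x) - dot (u x) (w • v x) = (z - w) * dot (u x) (v x) := by
    intro x
    simp only [dot, PiLp.smul_apply, smul_eq_mul]
    ring
  rw [← Dirac.wr_sub_wr hW hu.1 hv.1 hu.2 hv.2
    (by simp only [e]; exact (continuous_const.mul hc).locallyIntegrable)]
  simp only [e]
  rw [intervalIntegral.integral_const_mul]

theorem IsSolution.wr_eq (hW : IsCoefficient W) {z : ℂ} {u v : ℝ → C2}
    (hu : IsSolution W z u) (hv : IsSolution W z v) (a b : ℝ) :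
    wr (u b) (v b) = wr (u a) (v a) := by
  have := hu.wr_sub_wr hW hv a b
  rw [sub_self, zero_mul] at this
  exact (sub_eq_zero.1 this.symm)

theorem IsSolution.add {z : ℂ} {u v : ℝ → C2} (hu : IsSolution W z u) (hv : IsSolution W z v) :
    IsSolution W z (u + v) := by
  refine ⟨hu.1.add hv.1, ?_⟩
  filter_upwards [hu.2, hv.2, hu.1.ae_differentiableAt, hv.1.ae_differentiableAt] with x h1 h2 h3 h4
  rw [Pi.add_apply, smul_add, ← h1, ← h2]
  ext i
  fin_cases i
  · simp [expr_apply_zero, deriv_add h3 h4]; ring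
  · simp [expr_apply_one, deriv_add h3 h4]; ring

theorem IsSolution.smul {z : ℂ} {u : ℝ → C2} (c : ℂ) (hu : IsSolution W z u) :
    IsSolution W z (c • u) := by
  refine ⟨hu.1.smul c, ?_⟩
  filter_upwards [hu.2, hu.1.ae_differentiableAt] with x h1 h3
  rw [Pi.smul_apply, smul_comm, ← h1]
  ext i
  fin_cases i
  · simp [expr_apply_zero, (h3.hasDerivAt.const_smul c).deriv]; ring
  · simp [expr_apply_one, (h3.hasDerivAt.const_smul c).deriv]; ring

/-- The operator `v ↦ J N v` on `ℂ²`, regarded as a real linear one. -/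
def unitOp (N : Matrix (Fin 2) (Fin 2) ℂ) : C2 →L[ℝ] C2 :=
  (Matrix.toEuclideanCLM (n := Fin 2) (𝕜 := ℂ) (J * N)).restrictScalars ℝ

theorem unitOp_zero (N : Matrix (Fin 2) (Fin 2) ℂ) (v : C2) :
    unitOp N v 0 = -(N 1 0 * v 0 + N 1 1 * v 1) := by
  have : unitOp N v 0 = ((J * N).mulVec v.ofLp) 0 := rfl
  rw [this]
  simp [J, Matrix.mulVec, dotProduct, Fin.sum_univ_two, Matrix.mul_apply]

theorem unitOp_one (N : Matrix (Fin 2) (Fin 2) ℂ) (v : C2) :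
    unitOp N v 1 = N 0 0 * v 0 + N 0 1 * v 1 := by
  have : unitOp N v 1 = ((J * N).mulVec v.ofLp) 1 := rfl
  rw [this]
  simp [J, Matrix.mulVec, dotProduct, Fin.sum_univ_two, Matrix.mul_apply]

/-- The coefficient `J (W + z)` of the Dirac equation in the form `y' = J (W + z) y`. -/
def coeffOp (W : ℝ → Matrix (Fin 2) (Fin 2) ℝ) (z : ℂ) (x : ℝ) : C2 →L[ℝ] C2 :=
  W x 0 0 • unitOp !![1, 0; 0, 0] + W x 0 1 • unitOp !![0, 1; 0, 0] +
    W x 1 0 • unitOp !![0, 0; 1, 0] + W x 1 1 • unitOp !![0, 0; 0, 1] + unitOp !![z, 0; 0, z]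

theorem coeffOp_zero (z : ℂ) (x : ℝ) (v : C2) :
    coeffOp W z x v 0 = -(W x 1 0 * v 0 + W x 1 1 * v 1 + z * v 1) := by
  simp only [coeffOp, add_apply, smul_apply,
    PiLp.add_apply, PiLp.smul_apply, unitOp_zero]
  simp
  ring

theorem coeffOp_one (z : ℂ) (x : ℝ) (v : C2) :
    coeffOp W z x v 1 = W x 0 0 * v 0 + W x 0 1 * v 1 + z * v 0 := by
  simp only [coeffOp, add_apply, smul_apply,
    PiLp.add_apply, PiLp.smul_apply, unitOp_one]
  simp

theorem locallyIntegrable_add {E : Type*} [NormedAddCommGroup E] {f g : ℝ → E}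
    (hf : LocallyIntegrable f volume) (hg : LocallyIntegrable g volume) :
    LocallyIntegrable (fun x => f x + g x) volume := hf.add hg

theorem locallyIntegrable_coeffOp (hW : IsCoefficient W) (z : ℂ) :
    LocallyIntegrable (coeffOp W z) volume := by
  have hsm : ∀ i j (N : C2 →L[ℝ] C2), LocallyIntegrable (fun x => W x i j • N) volume := by
    intro i j N
    have h1 := hW.locallyIntegrable i j
    rw [locallyIntegrable_iff] at h1 ⊢
    exact fun K hK => (h1 K hK).smul_const _
  have hc : LocallyIntegrable (fun _ : ℝ => unitOp !![z, 0; 0, z]) volume :=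
    continuous_const.locallyIntegrable
  exact locallyIntegrable_add (locallyIntegrable_add (locallyIntegrable_add
    (locallyIntegrable_add (hsm 0 0 _) (hsm 0 1 _)) (hsm 1 0 _)) (hsm 1 1 _)) hc

/-- Solutions of the integrated equation `y = v + ∫ J (W + z) y` solve the Dirac equation. -/
theorem isSolution_of_eq_integral (hW : IsCoefficient W) {z : ℂ} {v : C2} {y : ℝ → C2}
    (hyc : Continuous y) (hy : ∀ x, y x = v + ∫ s in 0..x, coeffOp W z s (y s)) :
    IsSolution W z y := by
  have hloc := locallyIntegrable_clm_apply (locallyIntegrable_coeffOp hW z) hyc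
  have hyeq : y = fun x => v + ∫ s in 0..x, coeffOp W z s (y s) := funext hy
  refine ⟨?_, ?_⟩
  · intro a b
    refine absolutelyContinuousOnInterval_of_dist_le (C := 1)
      (absolutelyContinuousOnInterval_integral hloc 0 a b) fun x x' => ?_
    rw [one_mul, hy x, hy x', dist_add_left]
  · filter_upwards [LocallyIntegrable.ae_hasDerivAt_integral hloc] with x hx
    have hd : deriv y x = coeffOp W z x (y x) := by
      have := (hx 0).const_add v
      rw [← hyeq] at this
      exact this.deriv
    ext i
    fin_cases i
    · simp [expr_apply_zero, hd, coeffOp_one]; ring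
    · simp [expr_apply_one, hd, coeffOp_zero]; ring

theorem exists_isSolution (hW : IsCoefficient W) (z : ℂ) (v : C2) :
    ∃ y, IsSolution W z y ∧ y 0 = v := by
  obtain ⟨y, hyc, hy⟩ := exists_continuous_integral_eq (locallyIntegrable_coeffOp hW z) v
  exact ⟨y, isSolution_of_eq_integral hW hyc hy, by rw [hy 0]; simp⟩

theorem IsSolution.eq_zero (hW : IsCoefficient W) {z : ℂ} {u : ℝ → C2} (hu : IsSolution W z u)
    (h0 : u 0 = 0) : u = 0 := by
  obtain ⟨p, hp, hp0⟩ := exists_isSolution hW z (WithLp.toLp 2 ![1, 0])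
  obtain ⟨q, hq, hq0⟩ := exists_isSolution hW z (WithLp.toLp 2 ![0, 1])
  funext x
  have e1 := hu.wr_eq hW hp 0 x
  have e2 := hu.wr_eq hW hq 0 x
  have e3 := hp.wr_eq hW hq 0 x
  simp only [wr, h0, hp0, hq0] at e1 e2 e3
  simp at e1 e2 e3
  ext i
  fin_cases i
  · simp
    linear_combination u x 0 * e3 - p x 0 * e2 + q x 0 * e1
  · simp
    linear_combination u x 1 * e3 - p x 1 * e2 + q x 1 * e1

theorem IsSolution.ne_zero_at (hW : IsCoefficient W) {z : ℂ} {u : ℝ → C2} (hu : IsSolution W z u)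
    (h : u ≠ 0) : u 0 ≠ 0 := fun h0 => h (hu.eq_zero hW h0)

/-- The Lagrange identity for a solution and its complex conjugate. -/
theorem IsSolution.im_sub (hW : IsCoefficient W) {z : ℂ} {u : ℝ → C2} (hu : IsSolution W z u)
    (a b : ℝ) : (u a 0 * (starRingEnd ℂ) (u a 1)).im - (u b 0 * (starRingEnd ℂ) (u b 1)).im =
      z.im * ∫ x in a..b, ‖u x‖ ^ 2 := by
  have h := hu.wr_sub_wr hW hu.cj a b
  simp only [dot_cj_self] at h
  rw [intervalIntegral.integral_ofReal, Complex.sub_conj] at h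
  have h1 := congrArg Complex.im h
  simp only [wr, cj_apply, Complex.sub_im, Complex.mul_im, Complex.conj_re, Complex.conj_im,
    Complex.ofReal_re, Complex.ofReal_im, Complex.I_re, Complex.I_im, Complex.mul_re] at h1 ⊢
  linarith

/-! ### Weyl solutions on the right half line -/

/-- If an integrable function on a half line has a limit at infinity, then the limit is zero. -/
theorem eq_zero_of_tendsto_of_integrableOn_Ioi {h : ℝ → ℂ} {l : ℂ} (hi : IntegrableOn h (Set.Ioi 0))
    (hl : Tendsto h atTop (𝓝 l)) : l = 0 := by
  by_contra h0
  have hpos : 0 < ‖l‖ := norm_pos_iff.2 h0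
  have hev : ∀ᶠ x in atTop, ‖l‖ / 2 < ‖h x‖ := hl.norm.eventually_const_lt (by linarith)
  obtain ⟨N, hN⟩ := eventually_atTop.1 (hev.and (eventually_gt_atTop 0))
  have hN0 : 0 < N := (hN N le_rfl).2
  have h1 : IntegrableOn (fun _ : ℝ => ‖l‖ / 2) (Set.Ioi N) := by
    refine Integrable.mono' (hi.mono_set (Set.Ioi_subset_Ioi hN0.le)).norm
      aestronglyMeasurable_const ?_
    filter_upwards [ae_restrict_mem measurableSet_Ioi] with x hx
    rw [Real.norm_of_nonneg (by linarith)]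
    exact (hN x (le_of_lt hx)).1.le
  rw [integrableOn_const_iff] at h1
  rcases h1 with h1 | h1
  · simp at h1
    exact h0 h1
  · simp at h1

theorem integrable_norm_mul_norm {s : Set ℝ} {u v : ℝ → C2} (hu : MemLp u 2 (volume.restrict s))
    (hv : MemLp v 2 (volume.restrict s)) : IntegrableOn (fun x => ‖u x‖ * ‖v x‖) s :=
  MemLp.integrable_mul hu.norm hv.norm

theorem integrableOn_dot {s : Set ℝ} {u v : ℝ → C2} (huc : Continuous u) (hvc : Continuous v)
    (hu : MemLp u 2 (volume.restrict s))
    (hv : MemLp v 2 (volume.restrict s)) : IntegrableOn (fun x => dot (u x) (v x)) s :=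
  (integrable_norm_mul_norm hu hv).mono'
    (continuous_dot.comp (huc.prodMk hvc)).aestronglyMeasurable.restrict
    (Eventually.of_forall fun _ => norm_dot_le _ _)

/-- The Lagrange identity on the half line: the boundary term at infinity is integrable and has a
limit, so it vanishes there. -/
theorem IsSolution.integral_Ioi (hW : IsCoefficient W) {z w : ℂ} {u v : ℝ → C2}
    (hu : IsSolution W z u) (hv : IsSolution W w v)
    (hu2 : MemLp u 2 (volume.restrict (Set.Ioi 0)))
    (hv2 : MemLp v 2 (volume.restrict (Set.Ioi 0))) :
    (z - w) * ∫ x in Set.Ioi 0, dot (u x) (v x) = -wr (u 0) (v 0) := by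
  have h1 := (intervalIntegral_tendsto_integral_Ioi 0
    (integrableOn_dot hu.continuous hv.continuous hu2 hv2) tendsto_id).const_mul (z - w)
  have h2 : Tendsto (fun b => wr (u b) (v b)) atTop
      (𝓝 ((z - w) * (∫ x in Set.Ioi 0, dot (u x) (v x)) + wr (u 0) (v 0))) := by
    refine (h1.add_const (wr (u 0) (v 0))).congr fun b => ?_
    rw [id, hu.wr_sub_wr hW hv]
    ring
  have hi : IntegrableOn (fun x => wr (u x) (v x)) (Set.Ioi 0) :=
    (integrable_norm_mul_norm hu2 hv2).mono'
      (continuous_wr.comp (hu.continuous.prodMk hv.continuous)).aestronglyMeasurable.restrict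
      (Eventually.of_forall fun _ => norm_wr_le _ _)
  have := eq_zero_of_tendsto_of_integrableOn_Ioi hi h2
  linear_combination this

theorem memLp_cj {s : Set ℝ} {u : ℝ → C2} (hu : MemLp u 2 (volume.restrict s)) :
    MemLp (fun x => cj (u x)) 2 (volume.restrict s) :=
  hu.of_le (continuous_cj.comp_aestronglyMeasurable hu.1)
    (Eventually.of_forall fun _ => (norm_cj _).le)

theorem integrableOn_norm_sq {s : Set ℝ} {u : ℝ → C2} (hu : MemLp u 2 (volume.restrict s)) :
    IntegrableOn (fun x => ‖u x‖ ^ 2) s := by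
  simp only [sq]
  exact integrable_norm_mul_norm hu hu

theorem IsSolution.im_eq (hW : IsCoefficient W) {z : ℂ} {u : ℝ → C2} (hu : IsSolution W z u)
    (hu2 : MemLp u 2 (volume.restrict (Set.Ioi 0))) :
    (u 0 0 * (starRingEnd ℂ) (u 0 1)).im = z.im * ∫ x in Set.Ioi 0, ‖u x‖ ^ 2 := by
  have h := hu.integral_Ioi hW hu.cj hu2 (memLp_cj hu2)
  simp only [dot_cj_self] at h
  rw [show ∫ x in Set.Ioi (0 : ℝ), ((‖u x‖ ^ 2 : ℝ) : ℂ) =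
    ((∫ x in Set.Ioi (0 : ℝ), ‖u x‖ ^ 2 : ℝ) : ℂ)
    from integral_ofReal, Complex.sub_conj] at h
  have h1 := congrArg Complex.im h
  simp only [wr, cj_apply, Complex.sub_im, Complex.mul_im, Complex.conj_re, Complex.conj_im,
    Complex.ofReal_re, Complex.ofReal_im, Complex.I_re, Complex.I_im, Complex.mul_re,
    Complex.neg_im] at h1 ⊢
  linarith

theorem integral_norm_sq_pos {u : ℝ → C2} (huc : Continuous u)
    (hu2 : MemLp u 2 (volume.restrict (Set.Ioi 0))) (h0 : u 0 ≠ 0) :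
    0 < ∫ x in Set.Ioi 0, ‖u x‖ ^ 2 := by
  have hi := integrableOn_norm_sq hu2
  have h1 : 0 < ∫ x in (0 : ℝ)..1, ‖u x‖ ^ 2 := by
    refine intervalIntegral.integral_pos one_pos (by fun_prop) (fun x _ => by positivity)
      ⟨0, by simp, by positivity⟩
  rw [intervalIntegral.integral_of_le zero_le_one] at h1
  exact h1.trans_le (setIntegral_mono_set hi (Eventually.of_forall fun x => by positivity)
    (Set.Ioc_subset_Ioi_self.eventuallyLE))

theorem IsWeylSolution.im_pos (hW : IsCoefficient W) {z : ℂ} (hz : 0 < z.im) {u : ℝ → C2}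
    (hu : IsWeylSolution W z (Set.Ioi 0) u) : 0 < (u 0 0 * (starRingEnd ℂ) (u 0 1)).im := by
  rw [hu.1.im_eq hW hu.2.2]
  exact mul_pos hz (integral_norm_sq_pos hu.1.continuous hu.2.2 (hu.1.ne_zero_at hW hu.2.1))

theorem IsWeylSolution.apply_one_ne_zero (hW : IsCoefficient W) {z : ℂ} (hz : 0 < z.im)
    {u : ℝ → C2} (hu : IsWeylSolution W z (Set.Ioi 0) u) : u 0 1 ≠ 0 := by
  intro h
  have := hu.im_pos hW hz
  simp [h] at this

/-- Weyl's limit point or circle argument. With `p`, `q` the solutions with values `(1, 0)`,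
`(0, 1)` at `0`, the Weyl disk `K n` consists of the `m` with `Im z ∫ ‖m p + q‖² ≤ Im m`, the
integral being over `(0, n + 1)`. The disks are nonempty, compact and nested, and for `m` in their
intersection `m p + q` is square integrable. -/
theorem exists_isWeylSolution_Ioi (hW : IsCoefficient W) {z : ℂ} (hz : 0 < z.im) :
    ∃ u, IsWeylSolution W z (Set.Ioi 0) u := by
  obtain ⟨p, hp, hp0⟩ := exists_isSolution hW z (WithLp.toLp 2 ![1, 0])
  obtain ⟨q, hq, hq0⟩ := exists_isSolution hW z (WithLp.toLp 2 ![0, 1])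
  have hpc := hp.continuous
  have hqc := hq.continuous
  have p00 : p 0 0 = 1 := by rw [hp0]; rfl
  have p01 : p 0 1 = 0 := by rw [hp0]; rfl
  have q00 : q 0 0 = 0 := by rw [hq0]; rfl
  have q01 : q 0 1 = 1 := by rw [hq0]; rfl
  have hsol : ∀ m : ℂ, IsSolution W z (m • p + q) := fun m => (hp.smul m).add hq
  have hucont : ∀ m : ℂ, Continuous fun x => ‖(m • p + q) x‖ ^ 2 := fun m =>
    (hsol m).continuous.norm.pow 2
  set K : ℕ → Set ℂ := fun n => {m | z.im * ∫ x in (0 : ℝ)..(n + 1 : ℝ), ‖(m • p + q) x‖ ^ 2 ≤ m.im}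
    with hK
  have hmono : ∀ n, K (n + 1) ⊆ K n := by
    intro n m hm
    simp only [hK, Set.mem_ofPred_eq] at hm ⊢
    refine le_trans ?_ hm
    gcongr
    refine intervalIntegral.integral_mono_interval le_rfl (by positivity) (by push_cast; linarith)
      (Eventually.of_forall fun x => by positivity) ((hucont m).intervalIntegrable _ _)
  have hne : ∀ n, (K n).Nonempty := by
    intro n
    set N : ℝ := n + 1 with hN
    have hN0 : 0 < N := by positivity
    -- The Lagrange identity for `p` on `[0, N]` would fail otherwise.
    have hpN : p N 0 ≠ 0 := by
      intro h
      have h1 := hp.im_sub hW 0 N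
      rw [h, p01] at h1
      simp only [map_zero, mul_zero, zero_mul, sub_self] at h1
      have h2 : 0 < ∫ x in (0 : ℝ)..N, ‖p x‖ ^ 2 := by
        refine intervalIntegral.integral_pos hN0 (by fun_prop) (fun x _ => by positivity)
          ⟨0, ⟨le_rfl, hN0.le⟩, ?_⟩
        have : p 0 ≠ 0 := fun h => by rw [h] at p00; simp at p00
        positivity
      have := mul_pos hz h2
      linarith [Complex.zero_im]
    -- For this `m`, the first component of `m p + q` vanishes at `N`.
    refine ⟨-q N 0 / p N 0, ?_⟩
    set m := -q N 0 / p N 0 with hm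
    have h1 := (hsol m).im_sub hW 0 N
    have e0 : (m • p + q) N 0 = 0 := by
      simp only [Pi.add_apply, Pi.smul_apply, PiLp.add_apply, PiLp.smul_apply, smul_eq_mul, hm]
      field_simp
      ring
    have e1 : (m • p + q) 0 0 = m := by
      simp [p00, q00]
    have e2 : (m • p + q) 0 1 = 1 := by
      simp [p01, q01]
    rw [e0, e1, e2] at h1
    simp only [map_one, mul_one, zero_mul, Complex.zero_im, sub_zero] at h1
    exact h1.symm.le
  have hclosed : ∀ n, IsClosed (K n) := by
    intro n
    refine isClosed_le (continuous_const.mul ?_) Complex.continuous_im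
    refine intervalIntegral.continuous_parametric_intervalIntegral_of_continuous' ?_ _ _
    simp only [Function.uncurry_def, Pi.add_apply, Pi.smul_apply]
    fun_prop
  have hcomp : IsCompact (K 0) := by
    refine Metric.isCompact_of_isClosed_isBounded (hclosed 0) ?_
    set a := ∫ x in (0 : ℝ)..1, ‖p x‖ ^ 2 with ha
    set b := ∫ x in (0 : ℝ)..1, ‖q x‖ ^ 2 with hb
    have ha0 : 0 < a := by
      refine intervalIntegral.integral_pos one_pos (by fun_prop) (fun x _ => by positivity)
        ⟨0, by simp, ?_⟩
      have : p 0 ≠ 0 := fun h => by rw [h] at p00; simp at p00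
      positivity
    have hb0 : 0 ≤ b := intervalIntegral.integral_nonneg zero_le_one fun x _ => by positivity
    rw [isBounded_iff_forall_norm_le]
    refine ⟨(2 / z.im + 2 * b) / a + 1, fun m hm => ?_⟩
    simp only [hK, Set.mem_ofPred_eq, Nat.cast_zero, zero_add] at hm
    have h1 : ‖m‖ ^ 2 * a ≤ 2 * (∫ x in (0 : ℝ)..1, ‖(m • p + q) x‖ ^ 2) + 2 * b := by
      rw [ha, hb, ← intervalIntegral.integral_const_mul, ← intervalIntegral.integral_const_mul,
        ← intervalIntegral.integral_const_mul, ← intervalIntegral.integral_add]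
      · refine intervalIntegral.integral_mono_on zero_le_one ?_ ?_ fun x _ => ?_
        · exact (by fun_prop : Continuous fun x => ‖m‖ ^ 2 * ‖p x‖ ^ 2).intervalIntegrable _ _
        · have := hucont m
          exact (by fun_prop : Continuous fun x => 2 * ‖(m • p + q) x‖ ^ 2 +
            2 * ‖q x‖ ^ 2).intervalIntegrable _ _
        · have h2 := norm_sub_le ((m • p + q) x) (q x)
          rw [Pi.add_apply, Pi.smul_apply, add_sub_cancel_right, norm_smul] at h2
          rw [← mul_pow, Pi.add_apply, Pi.smul_apply]
          have h3 : 0 ≤ ‖m‖ * ‖p x‖ := by positivity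
          nlinarith [sq_nonneg (‖m • p x + q x‖ - ‖q x‖)]
      · have := hucont m
        exact (by fun_prop : Continuous fun x => 2 * ‖(m • p + q) x‖ ^ 2).intervalIntegrable _ _
      · exact (by fun_prop : Continuous fun x => 2 * ‖q x‖ ^ 2).intervalIntegrable _ _
    have h2 : (∫ x in (0 : ℝ)..1, ‖(m • p + q) x‖ ^ 2) ≤ ‖m‖ / z.im := by
      rw [le_div_iff₀ hz, mul_comm]
      exact hm.trans ((le_abs_self _).trans (Complex.abs_im_le_norm m))
    by_contra hlt
    push Not at hlt
    have hz2 : 0 < 2 / z.im := by positivity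
    have hq : 0 ≤ (2 / z.im + 2 * b) / a := by positivity
    have hm1 : 1 ≤ ‖m‖ := by linarith
    have h3 : (2 / z.im + 2 * b) / a < ‖m‖ := by linarith
    rw [div_lt_iff₀ ha0] at h3
    have h4 : ‖m‖ ^ 2 * a ≤ ‖m‖ * (2 / z.im + 2 * b) := by
      have : 2 * (‖m‖ / z.im) = ‖m‖ * (2 / z.im) := by ring
      nlinarith
    nlinarith
  obtain ⟨m, hm⟩ := IsCompact.nonempty_iInter_of_sequence_nonempty_isCompact_isClosed K hmono hne
    hcomp hclosed
  refine ⟨m • p + q, hsol m, ?_, ?_⟩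
  · intro h
    have e2 : (m • p + q) 0 1 = 1 := by
      simp [p01, q01]
    rw [h] at e2
    simp at e2
  · rw [memLp_two_iff_integrable_sq_norm (hsol m).continuous.aestronglyMeasurable.restrict]
    refine integrableOn_Ioi_of_intervalIntegral_norm_bounded (m.im / z.im) 0
      (l := atTop) (b := fun n : ℕ => (n + 1 : ℝ)) (fun n => (hucont m).integrableOn_Ioc) ?_ ?_
    · exact tendsto_atTop_add_const_right _ _ tendsto_natCast_atTop_atTop
    · refine Eventually.of_forall fun n => ?_
      have := Set.mem_iInter.1 hm n
      simp only [hK, Set.mem_ofPred_eq] at this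
      rw [le_div_iff₀ hz, mul_comm]
      simpa using this

theorem isWeylSolution_weylSolution_Ioi (hW : IsCoefficient W) {z : ℂ} (hz : 0 < z.im) :
    IsWeylSolution W z (Set.Ioi 0) (weylSolution W z (Set.Ioi 0)) :=
  Classical.epsilon_spec (exists_isWeylSolution_Ioi hW hz)

/-- Two solutions that are square integrable on the right half line have proportional values at
`0`. -/
theorem IsSolution.wr_eq_zero (hW : IsCoefficient W) {z : ℂ} {u v : ℝ → C2}
    (hu : IsSolution W z u) (hv : IsSolution W z v)
    (hu2 : MemLp u 2 (volume.restrict (Set.Ioi 0)))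
    (hv2 : MemLp v 2 (volume.restrict (Set.Ioi 0))) : wr (u 0) (v 0) = 0 := by
  have := hu.integral_Ioi hW hv hu2 hv2
  rw [sub_self, zero_mul] at this
  linear_combination this

theorem mPlus_eq (hW : IsCoefficient W) {z : ℂ} (hz : 0 < z.im) {u : ℝ → C2}
    (hu : IsWeylSolution W z (Set.Ioi 0) u) : mPlus W z = u 0 0 / u 0 1 := by
  have hy := isWeylSolution_weylSolution_Ioi hW hz
  have h := hu.1.wr_eq_zero hW hy.1 hu.2.2 hy.2.2
  unfold mPlus
  rw [div_eq_div_iff (hy.apply_one_ne_zero hW hz) (hu.apply_one_ne_zero hW hz)]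
  unfold wr at h
  linear_combination h

theorem mPlus_im_pos (hW : IsCoefficient W) {z : ℂ} (hz : 0 < z.im) : 0 < (mPlus W z).im := by
  have hy := isWeylSolution_weylSolution_Ioi hW hz
  have h1 := hy.im_pos hW hz
  have h2 := hy.apply_one_ne_zero hW hz
  have h3 : mPlus W z = (weylSolution W z (Set.Ioi 0) 0 0 *
      (starRingEnd ℂ) (weylSolution W z (Set.Ioi 0) 0 1)) *
      ((Complex.normSq (weylSolution W z (Set.Ioi 0) 0 1))⁻¹ : ℝ) := by
    unfold mPlus
    rw [div_eq_mul_inv, Complex.inv_def]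
    ring
  rw [h3, Complex.im_mul_ofReal]
  exact mul_pos h1 (inv_pos.2 (Complex.normSq_pos.2 h2))

/-- The Weyl solution with value `(m₊, 1)` at `0`. -/
theorem exists_normalized (hW : IsCoefficient W) {z : ℂ} (hz : 0 < z.im) :
    ∃ y, IsSolution W z y ∧ MemLp y 2 (volume.restrict (Set.Ioi 0)) ∧ y 0 0 = mPlus W z ∧
      y 0 1 = 1 := by
  have hy := isWeylSolution_weylSolution_Ioi hW hz
  have h2 := hy.apply_one_ne_zero hW hz
  refine ⟨(weylSolution W z (Set.Ioi 0) 0 1)⁻¹ • weylSolution W z (Set.Ioi 0), hy.1.smul _,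
    hy.2.2.const_smul _, ?_, ?_⟩
  · simp only [Pi.smul_apply, PiLp.smul_apply, smul_eq_mul, mPlus, div_eq_inv_mul]
  · simp only [Pi.smul_apply, PiLp.smul_apply, smul_eq_mul]
    exact inv_mul_cancel₀ h2

/-! ### Holomorphy of the Titchmarsh-Weyl functions -/

/-- The Hilbert space `L²((0, ∞); ℂ²)`. -/
abbrev L2Half : Type := Lp C2 2 ((volume : Measure ℝ).restrict (Set.Ioi 0))

theorem inner_eq_dot_cj (u v : C2) : inner ℂ u v = dot v (cj u) := by
  rw [PiLp.inner_apply, Fin.sum_univ_two]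
  simp only [dot, cj_apply, RCLike.inner_apply]

theorem inner_toLp {u v : ℝ → C2} (hu : MemLp u 2 (volume.restrict (Set.Ioi 0)))
    (hv : MemLp v 2 (volume.restrict (Set.Ioi 0))) :
    inner ℂ (hu.toLp u : L2Half) (hv.toLp v) = ∫ x in Set.Ioi 0, dot (v x) (cj (u x)) := by
  rw [L2.inner_def]
  refine integral_congr_ae ?_
  filter_upwards [hu.coeFn_toLp, hv.coeFn_toLp] with x h1 h2
  rw [h1, h2, inner_eq_dot_cj]

theorem cj_cj (u : C2) : cj (cj u) = u := by
  ext i; simp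

/-- `m₊` is holomorphic. Let `Y z` be the Weyl solution with value `(m₊ z, 1)` at `0`. The
Lagrange identity gives `(z - w) ∫ Y z ⬝ Y w = m₊ z - m₊ w`, so it is enough to see that `Y` is
continuous as a function with values in `L²`. The Lagrange identity for `Y z` and the conjugate of
`Y v` expresses the inner products `⟨Y v, Y z⟩` through `m₊`; in particular the continuity of `Y`
follows from that of `m₊`, and `‖Y z‖² = Im m₊ z / Im z` gives a bound for `Y z` from which `m₊`
is seen to be continuous. -/
theorem differentiableAt_mPlus (hW : IsCoefficient W) {w : ℂ} (hw : 0 < w.im) :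
    DifferentiableAt ℂ (mPlus W) w := by
  choose! y hy hy2 hy0 hy1 using fun (z : ℂ) (hz : 0 < z.im) => exists_normalized hW hz
  set m := mPlus W with hm
  have hU : ∀ᶠ z in 𝓝 w, 0 < z.im :=
    (isOpen_lt continuous_const Complex.continuous_im).mem_nhds hw
  have hbil : ∀ z v, 0 < z.im → 0 < v.im →
      (z - v) * ∫ x in Set.Ioi 0, dot (y z x) (y v x) = m z - m v := by
    intro z v hz hv
    rw [(hy z hz).integral_Ioi hW (hy v hv) (hy2 z hz) (hy2 v hv)]
    simp only [wr, hy0 z hz, hy0 v hv, hy1 z hz, hy1 v hv]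
    ring
  have hses : ∀ z v, 0 < z.im → 0 < v.im →
      (z - (starRingEnd ℂ) v) * ∫ x in Set.Ioi 0, dot (y z x) (cj (y v x)) =
        m z - (starRingEnd ℂ) (m v) := by
    intro z v hz hv
    rw [(hy z hz).integral_Ioi hW (hy v hv).cj (hy2 z hz) (memLp_cj (hy2 v hv))]
    simp only [wr, hy0 z hz, hy0 v hv, hy1 z hz, hy1 v hv, cj_apply, map_one]
    ring
  classical
  set Y : ℂ → L2Half := fun z => if hz : 0 < z.im then (hy2 z hz).toLp (y z) else 0 with hY
  set Yc : L2Half := (memLp_cj (hy2 w hw)).toLp _ with hYc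
  have hYz : ∀ z (hz : 0 < z.im), Y z = (hy2 z hz).toLp (y z) := fun z hz => dif_pos hz
  have hne : ∀ z v : ℂ, 0 < z.im → 0 < v.im → z - (starRingEnd ℂ) v ≠ 0 := by
    intro z v hz hv h
    have := congrArg Complex.im h
    simp only [Complex.sub_im, Complex.conj_im, Complex.zero_im] at this
    linarith
  have hin : ∀ z v, 0 < z.im → 0 < v.im →
      inner ℂ (Y v) (Y z) = (m z - (starRingEnd ℂ) (m v)) / (z - (starRingEnd ℂ) v) := by
    intro z v hz hv
    rw [hYz z hz, hYz v hv, inner_toLp, eq_div_iff (hne z v hz hv), mul_comm]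
    exact hses z v hz hv
  have hnorm : ∀ z, 0 < z.im → ‖Y z‖ ^ 2 = (m z).im / z.im := by
    intro z hz
    have h2 : ((2 * (m z).im : ℝ) : ℂ) * Complex.I / (((2 * z.im : ℝ) : ℂ) * Complex.I) =
        (((m z).im / z.im : ℝ) : ℂ) := by
      have := Complex.I_ne_zero
      have hz' : (z.im : ℂ) ≠ 0 := by exact_mod_cast hz.ne'
      push_cast
      field_simp
    rw [← inner_self_eq_norm_sq (𝕜 := ℂ), hin z z hz hz, Complex.sub_conj, Complex.sub_conj, h2]
    exact Complex.ofReal_re _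
  set I : ℂ → ℂ := fun z => inner ℂ Yc (Y z) with hI
  have hIeq : ∀ z, 0 < z.im → (z - w) * I z = m z - m w := by
    intro z hz
    rw [hI]
    simp only
    rw [hYz z hz, hYc, inner_toLp]
    simp only [cj_cj]
    exact hbil z w hz hw
  have hcont : Tendsto m (𝓝 w) (𝓝 (m w)) := by
    set k := 2 / w.im with hk
    have hk0 : 0 < k := by positivity
    set C := ‖Yc‖ with hC
    set a : ℝ := 1 + k * ‖m w‖ with ha
    have hev1 : ∀ᶠ z in 𝓝 w, w.im / 2 < z.im :=
      (isOpen_lt continuous_const Complex.continuous_im).mem_nhds (by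
        show w.im / 2 < w.im
        linarith)
    have hsub : Tendsto (fun z => ‖z - w‖) (𝓝 w) (𝓝 0) := by
      have : Continuous fun z : ℂ => ‖z - w‖ := by fun_prop
      simpa using this.tendsto w
    have hev2 : ∀ᶠ z in 𝓝 w, ‖z - w‖ * (C * k) < 1 / 2 := by
      have := hsub.mul_const (C * k)
      rw [zero_mul] at this
      exact this.eventually_lt_const (by norm_num)
    rw [tendsto_iff_norm_sub_tendsto_zero]
    have hlim : Tendsto (fun z => 2 * (‖z - w‖ * (C * a))) (𝓝 w) (𝓝 0) := by
      simpa using (hsub.mul_const (C * a)).const_mul 2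
    refine squeeze_zero' (Eventually.of_forall fun z => norm_nonneg _) ?_ hlim
    filter_upwards [hev1, hev2] with z hz1 hz2
    have hz : 0 < z.im := by linarith
    have h1 : ‖Y z‖ ≤ 1 + k * ‖m z‖ := by
      have h2 : ‖Y z‖ ^ 2 ≤ k * ‖m z‖ := by
        rw [hnorm z hz, div_le_iff₀ hz]
        have h3 : (m z).im ≤ ‖m z‖ := (le_abs_self _).trans (Complex.abs_im_le_norm _)
        -- `k = 2 / Im w` is a bound for `1 / Im z` near `w`.
        have h4 : 1 ≤ k * z.im := by
          rw [hk, div_mul_eq_mul_div, le_div_iff₀ hw]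
          linarith
        nlinarith [norm_nonneg (m z)]
      nlinarith [sq_nonneg (‖Y z‖ - 1), norm_nonneg (Y z)]
    have h2 : ‖m z - m w‖ ≤ ‖z - w‖ * (C * (1 + k * ‖m z‖)) := by
      rw [← hIeq z hz, norm_mul]
      gcongr
      exact (norm_inner_le_norm _ _).trans (by gcongr)
    have h3 : ‖m z‖ ≤ ‖m w‖ + ‖m z - m w‖ := by
      have := norm_add_le (m w) (m z - m w)
      rwa [add_sub_cancel] at this
    have hd := norm_nonneg (m z - m w)
    have h4 : ‖z - w‖ * (C * (1 + k * ‖m z‖)) ≤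
        ‖z - w‖ * (C * (1 + k * (‖m w‖ + ‖m z - m w‖))) := by gcongr
    have h5 : ‖z - w‖ * (C * (1 + k * (‖m w‖ + ‖m z - m w‖))) =
        ‖z - w‖ * (C * a) + ‖z - w‖ * (C * k) * ‖m z - m w‖ := by rw [ha]; ring
    nlinarith
  have hYlim : Tendsto Y (𝓝 w) (𝓝 (Y w)) := by
    rw [tendsto_iff_norm_sub_tendsto_zero]
    have hq : Tendsto (fun z => (m z).im / z.im + (m w).im / w.im -
        2 * ((m z - (starRingEnd ℂ) (m w)) / (z - (starRingEnd ℂ) w)).re) (𝓝 w) (𝓝 0) := by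
      have hid : Tendsto (fun z : ℂ => z) (𝓝 w) (𝓝 w) := tendsto_id
      have h1 : Tendsto (fun z => (m z).im / z.im) (𝓝 w) (𝓝 ((m w).im / w.im)) :=
        ((Complex.continuous_im.tendsto _).comp hcont).div (Complex.continuous_im.tendsto _) hw.ne'
      have h2 := (Complex.continuous_re.tendsto _).comp
        ((hcont.sub_const ((starRingEnd ℂ) (m w))).div (hid.sub_const ((starRingEnd ℂ) w))
          (hne w w hw hw))
      have h3 := (h1.add_const ((m w).im / w.im)).sub (h2.const_mul 2)
      have hval : ((m w - (starRingEnd ℂ) (m w)) / (w - (starRingEnd ℂ) w)).re =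
          (m w).im / w.im := by
        rw [← hin w w hw hw, ← hnorm w hw]
        exact inner_self_eq_norm_sq (𝕜 := ℂ) (Y w)
      rw [hval, show (m w).im / w.im + (m w).im / w.im - 2 * ((m w).im / w.im) = 0 by ring] at h3
      exact h3
    have hsq : Tendsto (fun z => ‖Y z - Y w‖ ^ 2) (𝓝 w) (𝓝 0) := by
      refine hq.congr' ?_
      filter_upwards [hU] with z hz
      rw [@norm_sub_sq ℂ, hnorm z hz, hnorm w hw, ← hin z w hz hw, inner_re_symm]
      simp only [RCLike.re_to_complex]
      ring
    have := hsq.sqrt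
    simpa using this
  have hIlim : Tendsto I (𝓝 w) (𝓝 (I w)) := tendsto_const_nhds.inner hYlim
  have : HasDerivAt m (I w) w := by
    rw [hasDerivAt_iff_tendsto_slope]
    refine (hIlim.mono_left nhdsWithin_le_nhds).congr' ?_
    filter_upwards [self_mem_nhdsWithin, hU.filter_mono nhdsWithin_le_nhds] with z hzw hz
    have : z - w ≠ 0 := sub_ne_zero.2 hzw
    rw [slope_def_field, eq_div_iff this, mul_comm]
    exact hIeq z hz
  exact this.differentiableAt

theorem differentiableOn_mPlus (hW : IsCoefficient W) :
    DifferentiableOn ℂ (mPlus W) {z : ℂ | 0 < z.im} := fun _ hz =>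
  (differentiableAt_mPlus hW hz).differentiableWithinAt

/-! ### Reflection and the left half line -/

/-- The coefficient of the Dirac operator that arises under the reflection `x ↦ -x`; see `refl`.
-/
def reflCoeff (W : ℝ → Matrix (Fin 2) (Fin 2) ℝ) (x : ℝ) : Matrix (Fin 2) (Fin 2) ℝ :=
  !![W (-x) 0 0, -W (-x) 0 1; -W (-x) 1 0, W (-x) 1 1]

/-- The map `(v₁, v₂) ↦ (v₁, -v₂)`. -/
def flipOp : C2 →L[ℝ] C2 :=
  (Matrix.toEuclideanCLM (n := Fin 2) (𝕜 := ℂ) !![1, 0; 0, -1]).restrictScalars ℝ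

theorem flipOp_zero (v : C2) : flipOp v 0 = v 0 := by
  have : flipOp v 0 = (Matrix.mulVec !![1, 0; 0, -1] v.ofLp) 0 := rfl
  rw [this]
  simp [Matrix.mulVec, dotProduct, Fin.sum_univ_two]

theorem flipOp_one (v : C2) : flipOp v 1 = -v 1 := by
  have : flipOp v 1 = (Matrix.mulVec !![1, 0; 0, -1] v.ofLp) 1 := rfl
  rw [this]
  simp [Matrix.mulVec, dotProduct, Fin.sum_univ_two]

theorem norm_flipOp (v : C2) : ‖flipOp v‖ = ‖v‖ := by
  have h : ‖flipOp v‖ ^ 2 = ‖v‖ ^ 2 := by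
    rw [norm_sq_C2, norm_sq_C2, flipOp_zero, flipOp_one, norm_neg]
  exact (pow_left_inj₀ (norm_nonneg _) (norm_nonneg _) two_ne_zero).1 h

/-- The reflection of a `ℂ²`-valued function about `0`. The sign in the second component turns
solutions for `W` into solutions for `reflCoeff W`. -/
def refl (y : ℝ → C2) (x : ℝ) : C2 := flipOp (y (-x))

theorem reflCoeff_reflCoeff : reflCoeff (reflCoeff W) = W := by
  funext x
  ext i j
  fin_cases i <;> fin_cases j <;> simp [reflCoeff]

theorem refl_refl (y : ℝ → C2) : refl (refl y) = y := by
  funext x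
  ext i
  fin_cases i
  · simp [refl, flipOp_zero]
  · simp [refl, flipOp_one]

theorem locallyIntegrable_comp_neg {f : ℝ → ℝ} (hf : LocallyIntegrable f volume) :
    LocallyIntegrable (fun x => f (-x)) volume := by
  rw [locallyIntegrable_iff] at hf ⊢
  intro K hK
  have h1 := hf (-K) hK.neg
  have h2 := (Measure.measurePreserving_neg (volume : Measure ℝ)).integrableOn_comp_preimage
    (MeasurableEquiv.neg ℝ).measurableEmbedding (f := f) (s := -K)
  have h3 : Neg.neg ⁻¹' (-K) = K := by
    ext x; simp
  rw [h3] at h2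
  exact h2.2 h1

theorem isCoefficient_reflCoeff (hW : IsCoefficient W) : IsCoefficient (reflCoeff W) := by
  refine ⟨?_, ?_⟩
  · have := (Measure.measurePreserving_neg (volume : Measure ℝ)).quasiMeasurePreserving.ae hW.symm
    filter_upwards [this] with x hx
    have h01 : W (-x) 1 0 = W (-x) 0 1 := hx.apply 0 1
    ext i j
    fin_cases i <;> fin_cases j <;> simp [reflCoeff, h01]
  · intro i j
    fin_cases i <;> fin_cases j
    · exact locallyIntegrable_comp_neg (hW.locallyIntegrable 0 0)
    · exact (locallyIntegrable_comp_neg (hW.locallyIntegrable 0 1)).neg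
    · exact (locallyIntegrable_comp_neg (hW.locallyIntegrable 1 0)).neg
    · exact locallyIntegrable_comp_neg (hW.locallyIntegrable 1 1)

theorem IsSolution.eq_integral (hW : IsCoefficient W) {z : ℂ} {y : ℝ → C2}
    (hy : IsSolution W z y) (x : ℝ) : y x = y 0 + ∫ s in 0..x, coeffOp W z s (y s) := by
  have hloc := locallyIntegrable_clm_apply (locallyIntegrable_coeffOp hW z) hy.continuous
  rw [integral_eq_sub_of_absolutelyContinuous hy.1 hloc ?_ 0 x]
  · abel
  · filter_upwards [hy.2, hy.1.ae_differentiableAt] with s h1 h2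
    refine h2.hasDerivAt.congr_deriv ?_
    have e0 := congrArg (fun v : C2 => v 0) h1
    have e1 := congrArg (fun v : C2 => v 1) h1
    simp only [expr_apply_zero, expr_apply_one, PiLp.smul_apply, smul_eq_mul] at e0 e1
    ext i
    fin_cases i
    · simp only [Fin.zero_eta, coeffOp_zero]
      linear_combination -e1
    · simp only [Fin.mk_one, coeffOp_one]
      linear_combination e0

theorem IsSolution.refl (hW : IsCoefficient W) {z : ℂ} {y : ℝ → C2} (hy : IsSolution W z y) :
    IsSolution (reflCoeff W) z (refl y) := by
  have hc : Continuous (Dirac.refl y) := flipOp.continuous.comp (hy.continuous.comp continuous_neg)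
  refine isSolution_of_eq_integral (isCoefficient_reflCoeff hW) (v := flipOp (y 0)) hc fun x => ?_
  have hloc := locallyIntegrable_clm_apply (locallyIntegrable_coeffOp hW z) hy.continuous
  have e : ∀ s, coeffOp (reflCoeff W) z s (Dirac.refl y s) =
      -flipOp (coeffOp W z (-s) (y (-s))) := by
    intro s
    ext i
    fin_cases i
    · simp [coeffOp_zero, Dirac.refl, flipOp_zero, flipOp_one, reflCoeff]
      ring
    · simp [coeffOp_one, Dirac.refl, flipOp_zero, flipOp_one, reflCoeff]
  simp only [e]
  rw [intervalIntegral.integral_neg,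
    intervalIntegral.integral_comp_neg (fun s => flipOp (coeffOp W z s (y s))), neg_zero,
    ← intervalIntegral.integral_symm,
    flipOp.intervalIntegral_comp_comm (intervalIntegrable_of_locallyIntegrable hloc _ _),
    ← map_add, ← hy.eq_integral hW]
  rfl

theorem memLp_refl {y : ℝ → C2} (hy : MemLp y 2 (volume.restrict (Set.Iio 0))) :
    MemLp (refl y) 2 (volume.restrict (Set.Ioi 0)) := by
  have h := (Measure.measurePreserving_neg (volume : Measure ℝ)).restrict_preimage
    (s := Set.Iio 0) measurableSet_Iio
  have e : Neg.neg ⁻¹' (Set.Iio (0 : ℝ)) = Set.Ioi 0 := by ext x; simp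
  rw [e] at h
  have h1 := hy.comp_measurePreserving h
  exact h1.of_le (flipOp.continuous.comp_aestronglyMeasurable h1.1)
    (Eventually.of_forall fun x => (norm_flipOp _).le)

theorem memLp_refl_of_Ioi {y : ℝ → C2} (hy : MemLp y 2 (volume.restrict (Set.Ioi 0))) :
    MemLp (refl y) 2 (volume.restrict (Set.Iio 0)) := by
  have h := (Measure.measurePreserving_neg (volume : Measure ℝ)).restrict_preimage
    (s := Set.Ioi 0) measurableSet_Ioi
  have e : Neg.neg ⁻¹' (Set.Ioi (0 : ℝ)) = Set.Iio 0 := by ext x; simp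
  rw [e] at h
  have h1 := hy.comp_measurePreserving h
  exact h1.of_le (flipOp.continuous.comp_aestronglyMeasurable h1.1)
    (Eventually.of_forall fun x => (norm_flipOp _).le)

theorem refl_zero : refl 0 = 0 := by
  funext x; simp [refl]

theorem IsWeylSolution.refl (hW : IsCoefficient W) {z : ℂ} {y : ℝ → C2}
    (hy : IsWeylSolution W z (Set.Iio 0) y) :
    IsWeylSolution (reflCoeff W) z (Set.Ioi 0) (refl y) := by
  refine ⟨hy.1.refl hW, fun h => hy.2.1 ?_, memLp_refl hy.2.2⟩
  rw [← refl_refl y, h, refl_zero]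

theorem exists_isWeylSolution_Iio (hW : IsCoefficient W) {z : ℂ} (hz : 0 < z.im) :
    ∃ u, IsWeylSolution W z (Set.Iio 0) u := by
  obtain ⟨u, hu⟩ := exists_isWeylSolution_Ioi (isCoefficient_reflCoeff hW) hz
  refine ⟨Dirac.refl u, ?_, fun h => hu.2.1 ?_, memLp_refl_of_Ioi hu.2.2⟩
  · have := hu.1.refl (isCoefficient_reflCoeff hW)
    rwa [reflCoeff_reflCoeff] at this
  · rw [← refl_refl u, h, refl_zero]

theorem mPlus_reflCoeff (hW : IsCoefficient W) {z : ℂ} (hz : 0 < z.im) {u : ℝ → C2}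
    (hu : IsWeylSolution W z (Set.Iio 0) u) : mPlus (reflCoeff W) z = -(u 0 0 / u 0 1) := by
  rw [mPlus_eq (isCoefficient_reflCoeff hW) hz (hu.refl hW)]
  simp only [Dirac.refl, neg_zero, flipOp_zero, flipOp_one]
  rw [div_neg]

theorem mMinus_eq_mPlus (hW : IsCoefficient W) {z : ℂ} (hz : 0 < z.im) :
    mMinus W z = mPlus (reflCoeff W) z :=
  (mPlus_reflCoeff hW hz (Classical.epsilon_spec (exists_isWeylSolution_Iio hW hz))).symm

theorem mMinus_eq (hW : IsCoefficient W) {z : ℂ} (hz : 0 < z.im) {u : ℝ → C2}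
    (hu : IsWeylSolution W z (Set.Iio 0) u) : mMinus W z = -(u 0 0 / u 0 1) := by
  rw [mMinus_eq_mPlus hW hz, mPlus_reflCoeff hW hz hu]

theorem IsWeylSolution.apply_one_ne_zero_Iio (hW : IsCoefficient W) {z : ℂ} (hz : 0 < z.im)
    {u : ℝ → C2} (hu : IsWeylSolution W z (Set.Iio 0) u) : u 0 1 ≠ 0 := by
  have := (hu.refl hW).apply_one_ne_zero (isCoefficient_reflCoeff hW) hz
  simpa [Dirac.refl, flipOp_one] using this

theorem mMinus_im_pos (hW : IsCoefficient W) {z : ℂ} (hz : 0 < z.im) : 0 < (mMinus W z).im := by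
  rw [mMinus_eq_mPlus hW hz]
  exact mPlus_im_pos (isCoefficient_reflCoeff hW) hz

theorem differentiableOn_mMinus (hW : IsCoefficient W) :
    DifferentiableOn ℂ (mMinus W) {z : ℂ | 0 < z.im} :=
  (differentiableOn_mPlus (isCoefficient_reflCoeff hW)).congr fun _ hz => mMinus_eq_mPlus hW hz

/-! ### The Krein function and its boundary values -/

/-- The matrix `M` as a function of `p = m₊` and `q = m₋`. -/
def mMatrix (p q : ℂ) : Matrix (Fin 2) (Fin 2) ℂ :=
  (-1 / (p + q)) • !![-2 * p * q, p - q; p - q, 2]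

theorem M_eq_mMatrix (z : ℂ) : M W z = mMatrix (mPlus W z) (mMinus W z) := rfl

theorem mMatrix_symm (p q : ℂ) : mMatrix p q 0 1 = mMatrix p q 1 0 := by simp [mMatrix]

theorem det_mMatrix {p q : ℂ} (h : p + q ≠ 0) : (mMatrix p q).det = -1 := by
  rw [Matrix.det_fin_two]
  simp only [mMatrix, Matrix.smul_apply, smul_eq_mul, Matrix.of_apply, Matrix.cons_val',
    Matrix.cons_val_zero, Matrix.cons_val_one, Matrix.cons_val_fin_one]
  field_simp
  ring

theorem trace_mMatrix_im_nonneg {p q : ℂ} (hp : 0 ≤ p.im) (hq : 0 ≤ q.im) :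
    0 ≤ (mMatrix p q).trace.im := by
  have e : (mMatrix p q).trace = (2 * (p * q - 1) * (starRingEnd ℂ) (p + q)) *
      ((Complex.normSq (p + q))⁻¹ : ℝ) := by
    rw [Matrix.trace_fin_two]
    simp only [mMatrix, Matrix.smul_apply, smul_eq_mul, Matrix.of_apply, Matrix.cons_val',
      Matrix.cons_val_zero, Matrix.cons_val_one, Matrix.cons_val_fin_one]
    rw [div_eq_mul_inv, Complex.inv_def]
    ring
  rw [e, Complex.im_mul_ofReal]
  refine mul_nonneg ?_ (inv_nonneg.2 (Complex.normSq_nonneg _))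
  have e2 : (2 * (p * q - 1) * (starRingEnd ℂ) (p + q)).im =
      2 * ((p.re ^ 2 + p.im ^ 2) * q.im + (q.re ^ 2 + q.im ^ 2) * p.im + p.im + q.im) := by
    simp
    ring
  rw [e2]
  positivity

theorem tendsto_mMatrix {ι : Type*} {l : Filter ι} {p q : ι → ℂ} {a b : ℂ}
    (hp : Tendsto p l (𝓝 a)) (hq : Tendsto q l (𝓝 b)) (h : a + b ≠ 0) :
    Tendsto (fun i => mMatrix (p i) (q i)) l (𝓝 (mMatrix a b)) := by
  unfold mMatrix
  refine (tendsto_const_nhds.div (hp.add hq) h).smul ?_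
  refine tendsto_pi_nhds.2 fun i => tendsto_pi_nhds.2 fun j => ?_
  fin_cases i <;> fin_cases j
  · exact (hp.const_mul (-2)).mul hq
  · exact hp.sub hq
  · exact hp.sub hq
  · exact tendsto_const_nhds

theorem continuous_matIm : Continuous matIm := by
  unfold matIm
  fun_prop

/-- `Im log` is continuous at the matrices of determinant `-1` whose trace has nonnegative
imaginary part, since their eigenvalues are nonzero and lie in the closed upper half plane. -/
theorem tendsto_im_log {ι : Type*} {l : Filter ι} {A : ι → Matrix (Fin 2) (Fin 2) ℂ}
    {A₀ : Matrix (Fin 2) (Fin 2) ℂ} (hA : Tendsto A l (𝓝 A₀)) (hdet : A₀.det = -1)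
    (htr : 0 ≤ A₀.trace.im) :
    Tendsto (fun i => (1 / Real.pi : ℂ) • matIm (matLog (A i))) l
      (𝓝 ((1 / Real.pi : ℂ) • matIm (matLog A₀))) := by
  obtain ⟨h1, h1'⟩ := eig₁_ne_zero_and_im_nonneg hdet htr
  obtain ⟨h2, h2'⟩ := eig₂_ne_zero_and_im_nonneg hdet htr
  have := tendsto_matLog hA (mem_logDomain h1 h1') (mem_logDomain h2 h2')
  exact ((continuous_matIm.tendsto _).comp this).const_smul _

theorem mPlus_add_mMinus_ne_zero (hW : IsCoefficient W) {z : ℂ} (hz : 0 < z.im) :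
    mPlus W z + mMinus W z ≠ 0 := by
  intro h
  have := congrArg Complex.im h
  simp only [Complex.add_im, Complex.zero_im] at this
  linarith [mPlus_im_pos hW hz, mMinus_im_pos hW hz]

theorem trace_kreinApprox (hW : IsCoefficient W) {z : ℂ} (hz : 0 < z.im) :
    (kreinApprox W z).trace = 1 := by
  have h := trace_matLog_of_det (A := M W z) (det_mMatrix (mPlus_add_mMinus_ne_zero hW hz))
    (trace_mMatrix_im_nonneg (mPlus_im_pos hW hz).le (mMinus_im_pos hW hz).le)
  unfold kreinApprox matIm
  rw [Matrix.trace_smul, Matrix.trace_smul, Matrix.trace_sub, Matrix.trace_conjTranspose, h]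
  have hπ : (Real.pi : ℂ) ≠ 0 := by exact_mod_cast Real.pi_ne_zero
  have := Complex.I_ne_zero
  simp only [smul_eq_mul, Complex.star_def, map_mul, Complex.conj_ofReal, Complex.conj_I]
  field_simp
  ring

theorem eventually_im_pos (t : ℝ) : ∀ᶠ y : ℝ in 𝓝[>] 0, 0 < ((t : ℂ) + y * Complex.I).im := by
  filter_upwards [self_mem_nhdsWithin] with y hy
  simpa using hy

theorem krein_eq {t : ℝ} {X : Matrix (Fin 2) (Fin 2) ℂ}
    (h : Tendsto (fun y : ℝ => kreinApprox W (t + y * Complex.I)) (𝓝[>] 0) (𝓝 X)) :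
    krein W t = X := h.limUnder_eq

theorem trace_krein (hW : IsCoefficient W) {t : ℝ} (h : KreinExistsAt W t) :
    (krein W t).trace = 1 := by
  obtain ⟨X, hX⟩ := h
  rw [krein_eq hX]
  have h1 : Tendsto (fun y : ℝ => (kreinApprox W (t + y * Complex.I)).trace) (𝓝[>] 0)
      (𝓝 X.trace) :=
    ((by fun_prop : Continuous fun B : Matrix (Fin 2) (Fin 2) ℂ => B.trace).tendsto X).comp hX
  refine tendsto_nhds_unique h1 (tendsto_const_nhds.congr' ?_)
  filter_upwards [eventually_im_pos t] with y hy
  exact (trace_kreinApprox hW hy).symm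

/-- Almost everywhere, the Herglotz functions `m₊`, `m₋` have finite boundary values, and the sum
of these is not zero, because `m₊ + m₋` is also a Herglotz function. -/
theorem ae_boundary_values (hW : IsCoefficient W) : ∀ᵐ t : ℝ, ∃ a b : ℂ,
    Tendsto (fun y : ℝ => mPlus W (t + y * Complex.I)) (𝓝[>] 0) (𝓝 a) ∧
    Tendsto (fun y : ℝ => mMinus W (t + y * Complex.I)) (𝓝[>] 0) (𝓝 b) ∧
    0 ≤ a.im ∧ 0 ≤ b.im ∧ a + b ≠ 0 := by
  have hd := (differentiableOn_mPlus hW).add (differentiableOn_mMinus hW)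
  filter_upwards [ae_exists_tendsto_of_im_pos (differentiableOn_mPlus hW) fun z => mPlus_im_pos hW,
    ae_exists_tendsto_of_im_pos (differentiableOn_mMinus hW) fun z => mMinus_im_pos hW,
    ae_exists_tendsto_ne_zero_of_im_pos hd fun z hz =>
      add_pos (mPlus_im_pos hW hz) (mMinus_im_pos hW hz)] with t ⟨a, ha⟩ ⟨b, hb⟩ ⟨c, hc0, hc⟩
  refine ⟨a, b, ha, hb, ?_, ?_, ?_⟩
  · refine ge_of_tendsto ((Complex.continuous_im.tendsto a).comp ha) ?_
    filter_upwards [eventually_im_pos t] with y hy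
    exact (mPlus_im_pos hW hy).le
  · refine ge_of_tendsto ((Complex.continuous_im.tendsto b).comp hb) ?_
    filter_upwards [eventually_im_pos t] with y hy
    exact (mMinus_im_pos hW hy).le
  · rwa [tendsto_nhds_unique (ha.add hb) hc]

theorem tendsto_kreinApprox {t : ℝ} {a b : ℂ}
    (ha : Tendsto (fun y : ℝ => mPlus W (t + y * Complex.I)) (𝓝[>] 0) (𝓝 a))
    (hb : Tendsto (fun y : ℝ => mMinus W (t + y * Complex.I)) (𝓝[>] 0) (𝓝 b))
    (hai : 0 ≤ a.im) (hbi : 0 ≤ b.im) (hab : a + b ≠ 0) :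
    Tendsto (fun y : ℝ => kreinApprox W (t + y * Complex.I)) (𝓝[>] 0)
      (𝓝 ((1 / Real.pi : ℂ) • matIm (matLog (mMatrix a b)))) :=
  tendsto_im_log (tendsto_mMatrix ha hb hab) (det_mMatrix hab) (trace_mMatrix_im_nonneg hai hbi)

/-- The condition `m₊ = -conj m₋` says that `M` has purely imaginary entries, which is equivalent
to `Im log M = π / 2`. -/
theorem im_log_mMatrix_eq_half_iff {a b : ℂ} (hai : 0 ≤ a.im) (hbi : 0 ≤ b.im) (hab : a + b ≠ 0) :
    (1 / Real.pi : ℂ) • matIm (matLog (mMatrix a b)) =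
      (1 / 2 : ℂ) • (1 : Matrix (Fin 2) (Fin 2) ℂ) ↔ a = -(starRingEnd ℂ) b := by
  have hs := mMatrix_symm a b
  have hdet := det_mMatrix hab
  have htr := trace_mMatrix_im_nonneg hai hbi
  have hπ : (Real.pi : ℂ) ≠ 0 := by exact_mod_cast Real.pi_ne_zero
  have hiff : (1 / Real.pi : ℂ) • matIm (matLog (mMatrix a b)) =
      (1 / 2 : ℂ) • (1 : Matrix (Fin 2) (Fin 2) ℂ) ↔
      ∀ i j, (matLog (mMatrix a b) i j).im = if i = j then Real.pi / 2 else 0 := by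
    rw [← Matrix.ext_iff]
    refine forall_congr' fun i => forall_congr' fun j => ?_
    rw [Matrix.smul_apply, matIm_apply_of_symm (matLog_symm hs), Matrix.smul_apply,
      Matrix.one_apply, smul_eq_mul, smul_eq_mul]
    split_ifs
    · rw [← Complex.ofReal_inj]
      push_cast
      constructor <;> intro h <;> field_simp at h ⊢ <;> linear_combination h
    · simp
  rw [hiff]
  have e11 : mMatrix a b 1 1 = -2 / (a + b) := by
    simp [mMatrix]; ring
  have e01 : mMatrix a b 0 1 = mMatrix a b 1 1 * ((a - b) / 2) := by
    rw [e11]; simp [mMatrix]; ring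
  have e00 : mMatrix a b 0 0 = mMatrix a b 1 1 * (-a * b) := by
    rw [e11]; simp [mMatrix]; ring
  constructor
  · intro h
    have hre := re_eq_zero_of_im_matLog hs hdet htr h
    have h11 := hre 1 1
    have h01 := hre 0 1
    have hne : mMatrix a b 1 1 ≠ 0 := by
      rw [e11]; exact div_ne_zero (by norm_num) hab
    have hne' : (mMatrix a b 1 1).im ≠ 0 := fun h => hne (Complex.ext h11 h)
    have hsum : (a + b).re = 0 := by
      have : (a + b) * mMatrix a b 1 1 = -2 := by rw [e11]; field_simp
      have := congrArg Complex.im this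
      rw [Complex.mul_im, h11, mul_zero, add_zero] at this
      have h2 : (a + b).re * (mMatrix a b 1 1).im = 0 := by simpa using this
      exact (mul_eq_zero.1 h2).resolve_right hne'
    rw [e01, Complex.mul_re, h11, zero_mul, zero_sub, neg_eq_zero] at h01
    have hdiff := (mul_eq_zero.1 h01).resolve_left hne'
    have hdiff' : a.im - b.im = 0 := by
      rw [← Complex.sub_im]
      have e : a - b = ((2 : ℝ) : ℂ) * ((a - b) / 2) := by push_cast; ring
      rw [e, Complex.im_ofReal_mul, hdiff, mul_zero]
    rw [Complex.add_re] at hsum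
    apply Complex.ext
    · simp; linarith
    · simp; linarith
  · intro h
    have hre1 : a.re = -b.re := by rw [h]; simp
    have him1 : a.im = b.im := by rw [h]; simp
    have h11 : (mMatrix a b 1 1).re = 0 := by
      rw [e11, Complex.div_re]
      simp [hre1]
    have hre : ∀ i j, (mMatrix a b i j).re = 0 := by
      intro i j
      fin_cases i <;> fin_cases j
      · show (mMatrix a b 0 0).re = 0
        rw [e00, Complex.mul_re, h11]
        simp [hre1, him1]
        right; ring
      · show (mMatrix a b 0 1).re = 0
        rw [e01, Complex.mul_re, h11]
        simp [him1]
      · show (mMatrix a b 1 0).re = 0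
        rw [← hs, e01, Complex.mul_re, h11]
        simp [him1]
      · exact h11
    exact im_matLog_of_re_eq_zero hs hdet htr hre

theorem isReflectionless_iff (hW : IsCoefficient W) (E : Set ℝ) : IsReflectionless W E ↔
    ∀ᵐ t : ℝ, t ∈ E → krein W t = (1 / 2 : ℂ) • (1 : Matrix (Fin 2) (Fin 2) ℂ) := by
  have hb := ae_boundary_values hW
  constructor
  · intro h
    filter_upwards [h, hb] with t ht ⟨a, b, ha, hb, hai, hbi, hab⟩ htE
    obtain ⟨a', b', ha', hb', hab'⟩ := ht htE
    rw [tendsto_nhds_unique ha' ha, tendsto_nhds_unique hb' hb] at hab'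
    rw [krein_eq (tendsto_kreinApprox ha hb hai hbi hab)]
    exact (im_log_mMatrix_eq_half_iff hai hbi hab).2 hab'
  · intro h
    filter_upwards [h, hb] with t ht ⟨a, b, ha, hb, hai, hbi, hab⟩ htE
    have := ht htE
    rw [krein_eq (tendsto_kreinApprox ha hb hai hbi hab)] at this
    exact ⟨a, b, ha, hb, (im_log_mMatrix_eq_half_iff hai hbi hab).1 this⟩

/-! ### The resolvent and evaluation at the origin -/

theorem locallyIntegrable_dot {f g : ℝ → C2} (hf : LocallyIntegrable f volume)
    (hg : Continuous g) : LocallyIntegrable (fun x => dot (f x) (g x)) volume := by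
  have h : LocallyIntegrable (fun x => ‖f x‖ * ‖g x‖) volume := by
    have := locallyIntegrable_norm hf
    rw [locallyIntegrable_iff] at this ⊢
    exact fun K hK => (this K hK).mul_continuousOn hg.norm.continuousOn hK
  refine h.mono (continuous_dot.comp_aestronglyMeasurable
    (hf.aestronglyMeasurable.prodMk hg.aestronglyMeasurable)) (Eventually.of_forall fun x => ?_)
  rw [Real.norm_of_nonneg (by positivity)]
  exact norm_dot_le _ _

/-- The Lagrange identity for a solution of the inhomogeneous equation and a solution of the
homogeneous one. -/
theorem integral_dot_eq_wr_sub_wr (hW : IsCoefficient W) {z : ℂ} {y f v : ℝ → C2}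
    (hy : LocallyAC y) (hf : LocallyIntegrable f volume)
    (he : ∀ᵐ x, expr W y x = f x + z • y x) (hv : IsSolution W z v) (a b : ℝ) :
    ∫ x in a..b, dot (f x) (v x) = wr (y b) (v b) - wr (y a) (v a) := by
  have e : ∀ x, dot (f x + z • y x) (v x) - dot (y x) (z • v x) = dot (f x) (v x) := by
    intro x
    simp only [dot, PiLp.add_apply, PiLp.smul_apply, smul_eq_mul]
    ring
  rw [← wr_sub_wr hW hy hv.1 he hv.2
    (by simp only [e]; exact locallyIntegrable_dot hf hv.continuous)]
  simp only [e]

theorem locallyIntegrable_L2 (u : L2) : LocallyIntegrable u volume :=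
  (Lp.memLp u).locallyIntegrable (by norm_num)

/-- The `L¹` norm on an interval of length one is at most the `L²` norm. -/
theorem integral_norm_le_norm (u : L2) : ∫ x in (0 : ℝ)..1, ‖u x‖ ≤ ‖u‖ := by
  have hp : IsProbabilityMeasure ((volume : Measure ℝ).restrict (Set.Ioc 0 1)) :=
    ⟨by simp⟩
  rw [intervalIntegral.integral_of_le zero_le_one, integral_norm_eq_lintegral_enorm
    (Lp.aestronglyMeasurable u).restrict, ← eLpNorm_one_eq_lintegral_enorm, Lp.norm_def]
  refine ENNReal.toReal_mono (Lp.eLpNorm_ne_top u) ?_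
  exact (eLpNorm_le_eLpNorm_of_exponent_le (by norm_num)
    (Lp.aestronglyMeasurable u).restrict).trans (eLpNorm_restrict_le _ _ _ _)

/-- Point evaluation is continuous in the graph norm of the Dirac operator. -/
theorem exists_norm_apply_zero_le (hW : IsCoefficient W) (z : ℂ) : ∃ C : ℝ,
    ∀ (y : ℝ → C2) (u e : L2), LocallyAC y → u =ᵐ[volume] y →
      (∀ᵐ x, expr W y x = e x + z • y x) → ‖y 0‖ ≤ C * (‖u‖ + ‖e‖) := by
  have key : ∀ v : ℝ → C2, IsSolution W z v → ∃ K : ℝ, ∀ (y : ℝ → C2) (u e : L2), LocallyAC y →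
      u =ᵐ[volume] y → (∀ᵐ x, expr W y x = e x + z • y x) →
      ‖wr (y 0) (v 0)‖ ≤ K * (‖u‖ + ‖e‖) := by
    intro v hv
    obtain ⟨K, hK⟩ := (isCompact_Icc (a := (0 : ℝ)) (b := 1)).exists_bound_of_continuousOn
      hv.continuous.continuousOn
    have hK0 : 0 ≤ K := (norm_nonneg _).trans (hK 0 (by simp))
    refine ⟨K, fun y u e hy hu he => ?_⟩
    have hen := locallyIntegrable_norm (locallyIntegrable_L2 e)
    -- The bound by `‖y x‖` is averaged over `x ∈ [0, 1]`.
    have h1 : ∀ x ∈ Set.Icc (0 : ℝ) 1, ‖wr (y 0) (v 0)‖ ≤ K * ‖y x‖ + K * ‖e‖ := by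
      intro x hx
      have h2 := integral_dot_eq_wr_sub_wr hW hy (locallyIntegrable_L2 e) he hv 0 x
      have h3 : ‖∫ s in (0 : ℝ)..x, dot (e s) (v s)‖ ≤ K * ‖e‖ := by
        calc ‖∫ s in (0 : ℝ)..x, dot (e s) (v s)‖ ≤ ∫ s in (0 : ℝ)..x, K * ‖e s‖ := by
              refine intervalIntegral.norm_integral_le_of_norm_le hx.1
                (Eventually.of_forall fun s hs => ?_)
                ((intervalIntegrable_of_locallyIntegrable hen 0 x).const_mul K)
              refine (norm_dot_le _ _).trans ?_
              rw [mul_comm]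
              gcongr
              exact hK s ⟨hs.1.le, hs.2.trans hx.2⟩
          _ ≤ ∫ s in (0 : ℝ)..1, K * ‖e s‖ :=
              intervalIntegral.integral_mono_interval le_rfl hx.1 hx.2
                (Eventually.of_forall fun s => by positivity)
                ((intervalIntegrable_of_locallyIntegrable hen 0 1).const_mul K)
          _ ≤ K * ‖e‖ := by
              rw [intervalIntegral.integral_const_mul]
              gcongr
              exact integral_norm_le_norm e
      have h4 : wr (y 0) (v 0) = wr (y x) (v x) - ∫ s in (0 : ℝ)..x, dot (e s) (v s) := by
        rw [h2]; ring
      rw [h4]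
      refine (norm_sub_le _ _).trans (add_le_add ((norm_wr_le _ _).trans ?_) h3)
      rw [mul_comm]
      gcongr
      exact hK x hx
    have hyc := hy.continuous
    have h5 : ∫ _ in (0 : ℝ)..1, ‖wr (y 0) (v 0)‖ ≤ ∫ x in (0 : ℝ)..1, (K * ‖y x‖ + K * ‖e‖) :=
      intervalIntegral.integral_mono_on zero_le_one (by simp)
        ((by fun_prop : Continuous fun x => K * ‖y x‖ + K * ‖e‖).intervalIntegrable _ _) h1
    rw [intervalIntegral.integral_add
      ((by fun_prop : Continuous fun x => K * ‖y x‖).intervalIntegrable _ _) (by simp),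
      intervalIntegral.integral_const_mul] at h5
    simp only [intervalIntegral.integral_const, sub_zero, one_smul] at h5
    have h6 : ∫ x in (0 : ℝ)..1, ‖y x‖ ≤ ‖u‖ := by
      refine le_trans (le_of_eq ?_) (integral_norm_le_norm u)
      refine intervalIntegral.integral_congr_ae ?_
      filter_upwards [hu] with x hx _
      rw [hx]
    nlinarith
  obtain ⟨p, hp, hp0⟩ := exists_isSolution hW z (WithLp.toLp 2 ![1, 0])
  obtain ⟨q, hq, hq0⟩ := exists_isSolution hW z (WithLp.toLp 2 ![0, 1])
  obtain ⟨K, hK⟩ := key p hp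
  obtain ⟨K', hK'⟩ := key q hq
  refine ⟨K + K', fun y u e hy hu he => ?_⟩
  have h1 := hK y u e hy hu he
  have h2 := hK' y u e hy hu he
  simp only [wr, hp0, hq0] at h1 h2
  simp at h1 h2
  have h3 : ‖y 0‖ ≤ ‖y 0 0‖ + ‖y 0 1‖ := by
    refine (abs_le_of_sq_le_sq' ?_ (by positivity)).2
    rw [norm_sq_C2]
    nlinarith [norm_nonneg (y 0 0), norm_nonneg (y 0 1)]
  linarith

/-- Where the inhomogeneity vanishes, a solution of the inhomogeneous equation agrees with the
solution of the homogeneous equation that has the same value at `0`. -/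
theorem IsSolution.eq_of_vanish (hW : IsCoefficient W) {z : ℂ} {y f u : ℝ → C2}
    (hy : LocallyAC y) (hf : LocallyIntegrable f volume)
    (he : ∀ᵐ x, expr W y x = f x + z • y x) (hu : IsSolution W z u) (h0 : u 0 = y 0) {x : ℝ}
    (hx : ∀ᵐ s, s ∈ Set.uIoc 0 x → f s = 0) : u x = y x := by
  have key : ∀ v, IsSolution W z v → wr (y x) (v x) = wr (u x) (v x) := by
    intro v hv
    have h1 := integral_dot_eq_wr_sub_wr hW hy hf he hv 0 x
    have h2 : ∫ s in (0 : ℝ)..x, dot (f s) (v s) = 0 := by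
      refine intervalIntegral.integral_zero_ae ?_
      filter_upwards [hx] with s hs hsx
      rw [hs hsx]
      simp [dot]
    rw [h2] at h1
    rw [hu.wr_eq hW hv 0 x, h0]
    exact (sub_eq_zero.1 h1.symm)
  obtain ⟨p, hp, hp0⟩ := exists_isSolution hW z (WithLp.toLp 2 ![1, 0])
  obtain ⟨q, hq, hq0⟩ := exists_isSolution hW z (WithLp.toLp 2 ![0, 1])
  have e1 := key p hp
  have e2 := key q hq
  have e3 := hp.wr_eq hW hq 0 x
  simp only [wr, hp0, hq0] at e1 e2 e3
  simp at e3
  ext i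
  fin_cases i
  · simp
    linear_combination (u x 0 - y x 0) * e3 + p x 0 * e2 - q x 0 * e1
  · simp
    linear_combination (u x 1 - y x 1) * e3 + p x 1 * e2 - q x 1 * e1

/-- A square integrable solution of the inhomogeneous equation, with an inhomogeneity that is
supported on the left half line, gives a solution of the homogeneous equation that is square
integrable on the right half line. -/
theorem exists_isSolution_Ioi (hW : IsCoefficient W) {z : ℂ} {y f : ℝ → C2}
    (hy : LocallyAC y) (hy2 : MemLp y 2 volume) (hf : LocallyIntegrable f volume)
    (he : ∀ᵐ x, expr W y x = f x + z • y x) (hf0 : ∀ᵐ x, x ∈ Set.Ioi 0 → f x = 0) :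
    ∃ u, IsSolution W z u ∧ u 0 = y 0 ∧ MemLp u 2 (volume.restrict (Set.Ioi 0)) := by
  obtain ⟨u, hu, h0⟩ := exists_isSolution hW z (y 0)
  refine ⟨u, hu, h0, (hy2.restrict _).ae_eq ?_⟩
  filter_upwards [ae_restrict_mem measurableSet_Ioi] with x hx
  refine (hu.eq_of_vanish hW hy hf he h0 ?_).symm
  filter_upwards [hf0] with s hs hsx
  rw [Set.uIoc_of_le (le_of_lt hx)] at hsx
  exact hs hsx.1

theorem exists_isSolution_Iio (hW : IsCoefficient W) {z : ℂ} {y f : ℝ → C2}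
    (hy : LocallyAC y) (hy2 : MemLp y 2 volume) (hf : LocallyIntegrable f volume)
    (he : ∀ᵐ x, expr W y x = f x + z • y x) (hf0 : ∀ᵐ x, x ∈ Set.Iic 0 → f x = 0) :
    ∃ u, IsSolution W z u ∧ u 0 = y 0 ∧ MemLp u 2 (volume.restrict (Set.Iio 0)) := by
  obtain ⟨u, hu, h0⟩ := exists_isSolution hW z (y 0)
  refine ⟨u, hu, h0, (hy2.restrict _).ae_eq ?_⟩
  filter_upwards [ae_restrict_mem measurableSet_Iio] with x hx
  refine (hu.eq_of_vanish hW hy hf he h0 ?_).symm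
  filter_upwards [hf0] with s hs hsx
  rw [Set.uIoc_of_ge (le_of_lt hx)] at hsx
  exact hs hsx.2

theorem IsSolution.wr_eq_zero_Iio (hW : IsCoefficient W) {z : ℂ} {u v : ℝ → C2}
    (hu : IsSolution W z u) (hv : IsSolution W z v)
    (hu2 : MemLp u 2 (volume.restrict (Set.Iio 0)))
    (hv2 : MemLp v 2 (volume.restrict (Set.Iio 0))) : wr (u 0) (v 0) = 0 := by
  have h := (hu.refl hW).wr_eq_zero (isCoefficient_reflCoeff hW) (hv.refl hW) (memLp_refl hu2)
    (memLp_refl hv2)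
  simp only [wr, Dirac.refl, neg_zero, flipOp_zero, flipOp_one] at h
  unfold wr
  linear_combination -h

theorem exists_resolvent {z : ℂ} (hz : z ∉ spectrumOp (diracOp W)) : ∃ R : L2 →L[ℂ] L2,
    (∀ f, (R f, f + z • R f) ∈ graph W) ∧ ∀ u g, (u, g) ∈ graph W → R (g - z • u) = u := by
  unfold spectrumOp at hz
  rw [Set.notMem_compl_iff] at hz
  obtain ⟨R, h1, h2⟩ := hz
  refine ⟨R, fun f => ?_, fun u g hug => ?_⟩
  · obtain ⟨h, hf⟩ := h1 f
    rw [← diracOp_graph, LinearPMap.mem_graph_iff]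
    refine ⟨⟨R f, h⟩, rfl, ?_⟩
    exact sub_eq_iff_eq_add.1 hf
  · rw [← diracOp_graph, LinearPMap.mem_graph_iff] at hug
    obtain ⟨y, hy, hg⟩ := hug
    have := h2 y
    rw [hg, hy] at this
    exact this

/-- Cutting off a solution of the homogeneous equation: there are functions in the domain of the
Dirac operator with an arbitrary value at `0`. -/
theorem exists_mem_graph (hW : IsCoefficient W) (z : ℂ) (v : C2) : ∃ y f : ℝ → C2,
    LocallyAC y ∧ MemLp y 2 volume ∧ MemLp f 2 volume ∧
      (∀ᵐ x, expr W y x = f x + z • y x) ∧ y 0 = v := by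
  obtain ⟨u, hu, hu0⟩ := exists_isSolution hW z v
  let χ : ContDiffBump (0 : ℝ) := ⟨1, 2, one_pos, one_lt_two⟩
  have hχ : ContDiff ℝ 1 χ := χ.contDiff
  have hχc : HasCompactSupport χ := χ.hasCompactSupport
  have huc := hu.continuous
  have hd : Continuous (deriv χ) := hχ.continuous_deriv_one
  refine ⟨fun x => χ x • u x, fun x => deriv χ x • (WithLp.toLp 2 ![u x 1, -u x 0] : C2),
    fun a b => ?_, ?_, ?_, ?_, ?_⟩
  · exact (hχ.contDiffOn.absolutelyContinuousOnInterval).fun_smul (hu.1 a b)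
  · exact (χ.continuous.smul huc).memLp_of_hasCompactSupport hχc.smul_right
  · refine Continuous.memLp_of_hasCompactSupport ?_ hχc.deriv.smul_right
    fun_prop
  · filter_upwards [hu.2, hu.1.ae_differentiableAt] with x h1 h2
    have h3 : HasDerivAt χ (deriv χ x) x := (hχ.differentiable one_ne_zero x).hasDerivAt
    have h4 := (h3.smul h2.hasDerivAt).deriv
    have e0 := congrArg (fun v : C2 => v 0) h1
    have e1 := congrArg (fun v : C2 => v 1) h1
    simp only [expr_apply_zero, expr_apply_one, PiLp.smul_apply, smul_eq_mul] at e0 e1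
    have h5 : deriv (fun x => χ x • u x) x = χ x • deriv u x + deriv χ x • u x := h4
    ext i
    fin_cases i
    · simp [expr_apply_zero, h5]
      linear_combination (χ x : ℂ) * e0
    · simp [expr_apply_one, h5]
      linear_combination (χ x : ℂ) * e1
  · simp only
    rw [χ.one_of_mem_closedBall (by simp [χ]), one_smul, hu0]

/-- The resolvent followed by evaluation at `0` is a continuous linear map onto `ℂ²`. -/
theorem exists_evaluation (hW : IsCoefficient W) {z : ℂ} (hz : z ∉ spectrumOp (diracOp W)) :
    ∃ (R : L2 →L[ℂ] L2) (ev : L2 →L[ℂ] C2), (∀ f : L2, ∃ y, LocallyAC y ∧ R f =ᵐ[volume] y ∧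
      (∀ᵐ x, expr W y x = f x + z • y x) ∧ y 0 = ev f) ∧ Function.Surjective ev := by
  obtain ⟨R, h1, h2⟩ := exists_resolvent hz
  have h3 : ∀ f : L2, ∃ y, LocallyAC y ∧ R f =ᵐ[volume] y ∧
      (∀ᵐ x, expr W y x = f x + z • y x) := by
    intro f
    obtain ⟨y, hy, hy1, hy2⟩ := h1 f
    refine ⟨y, hy, hy1, ?_⟩
    filter_upwards [hy1, hy2, Lp.coeFn_add f (z • R f), Lp.coeFn_smul z (R f)] with x e1 e2 e3 e4
    rw [← e2, e3, Pi.add_apply, e4, Pi.smul_apply, e1]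
  choose Y hY hY1 hY2 using h3
  obtain ⟨C, hC⟩ := exists_norm_apply_zero_le hW z
  have huniq : ∀ (f : L2) (y : ℝ → C2), Continuous y → R f =ᵐ[volume] y → y = Y f :=
    fun f y hy h => (Continuous.ae_eq_iff_eq volume hy (hY f).continuous).1 (h.symm.trans (hY1 f))
  let ev₀ : L2 →ₗ[ℂ] C2 :=
    { toFun := fun f => Y f 0
      map_add' := fun f g => by
        rw [← huniq (f + g) (Y f + Y g) ((hY f).add (hY g)).continuous]
        · rfl
        · rw [map_add]
          exact (Lp.coeFn_add _ _).trans ((hY1 f).add (hY1 g))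
      map_smul' := fun c f => by
        rw [← huniq (c • f) (c • Y f) ((hY f).smul c).continuous]
        · rfl
        · rw [map_smul]
          exact (Lp.coeFn_smul _ _).trans ((hY1 f).const_smul c) }
  have hC0 : ∀ f, ‖ev₀ f‖ ≤ (|C| * (‖R‖ + 1)) * ‖f‖ := by
    intro f
    calc ‖ev₀ f‖ ≤ C * (‖R f‖ + ‖f‖) := hC (Y f) (R f) f (hY f) (hY1 f) (hY2 f)
      _ ≤ |C| * (‖R‖ * ‖f‖ + ‖f‖) := by
        gcongr
        · exact le_abs_self C
        · exact R.le_opNorm f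
      _ = _ := by ring
  refine ⟨R, ev₀.mkContinuous _ hC0, fun f => ⟨Y f, hY f, hY1 f, hY2 f, rfl⟩, fun v => ?_⟩
  obtain ⟨y, f, hy, hy2, hf2, he, hv⟩ := exists_mem_graph hW z v
  refine ⟨hf2.toLp f, ?_⟩
  have hmem : (hy2.toLp y, hf2.toLp f + z • hy2.toLp y) ∈ graph W := by
    refine ⟨y, hy, hy2.coeFn_toLp, ?_⟩
    filter_upwards [he, hy2.coeFn_toLp, hf2.coeFn_toLp,
      Lp.coeFn_add (hf2.toLp f) (z • hy2.toLp y), Lp.coeFn_smul z (hy2.toLp y)]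
      with x e1 e2 e3 e4 e5
    rw [e4, Pi.add_apply, e5, Pi.smul_apply, e1, e2, e3]
  have h5 := h2 _ _ hmem
  rw [add_sub_cancel_right] at h5
  have h6 := huniq (hf2.toLp f) y hy.continuous (by rw [h5]; exact hy2.coeFn_toLp)
  show Y _ 0 = v
  rw [← h6, hv]

/-- Perturbation of the spectral parameter: for small `w`, the equation
`-J y' - W y = F + (z + w) y` has a square integrable solution, obtained from the inverse of
`1 - w R`, and its value at `0` is continuous at `w = 0`. -/
theorem exists_tendsto_evaluation {z : ℂ} {R : L2 →L[ℂ] L2}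
    {ev : L2 →L[ℂ] C2} (h : ∀ f : L2, ∃ y, LocallyAC y ∧ R f =ᵐ[volume] y ∧
      (∀ᵐ x, expr W y x = f x + z • y x) ∧ y 0 = ev f) (F : L2) :
    ∃ a : ℂ → C2, Tendsto a (𝓝 0) (𝓝 (ev F)) ∧ ∀ᶠ w in 𝓝 0, ∃ y, LocallyAC y ∧
      MemLp y 2 volume ∧ (∀ᵐ x, expr W y x = F x + (z + w) • y x) ∧ y 0 = a w := by
  have hlim : Tendsto (fun w : ℂ => (1 : L2 →L[ℂ] L2) - w • R) (𝓝 0) (𝓝 1) := by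
    have : Continuous fun w : ℂ => (1 : L2 →L[ℂ] L2) - w • R := by fun_prop
    simpa using this.tendsto 0
  refine ⟨fun w => ev (Ring.inverse ((1 : L2 →L[ℂ] L2) - w • R) F), ?_, ?_⟩
  · have h1 : Tendsto (fun w : ℂ => Ring.inverse ((1 : L2 →L[ℂ] L2) - w • R)) (𝓝 0) (𝓝 1) := by
      have := (NormedRing.inverse_continuousAt (1 : (L2 →L[ℂ] L2)ˣ)).tendsto
      rw [Units.val_one, Ring.inverse_one] at this
      exact this.comp hlim
    have h2 : Continuous fun B : L2 →L[ℂ] L2 => ev (B F) := by fun_prop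
    exact (h2.tendsto 1).comp h1
  · have hu : ∀ᶠ B : L2 →L[ℂ] L2 in 𝓝 1, IsUnit B := by
      exact Units.isOpen.mem_nhds isUnit_one
    filter_upwards [hlim.eventually hu] with w hw
    set G := Ring.inverse ((1 : L2 →L[ℂ] L2) - w • R) F with hG
    have hGF : G = F + w • R G := by
      have := congrArg (fun B : L2 →L[ℂ] L2 => B F) (Ring.mul_inverse_cancel _ hw)
      have h2 : G - w • R G = F := this
      rw [← h2]; abel
    obtain ⟨y, hy, h1, h2, h3⟩ := h G
    refine ⟨y, hy, (Lp.memLp (R G)).ae_eq h1, ?_, h3⟩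
    have h4 : G =ᵐ[volume] ⇑(F + w • R G) := by rw [← hGF]
    filter_upwards [h1, h2, h4, Lp.coeFn_add F (w • R G), Lp.coeFn_smul w (R G)]
      with x e1 e2 e3 e4 e5
    rw [e2, e3, e4, Pi.add_apply, e5, Pi.smul_apply, e1, add_smul, add_assoc, add_comm (w • y x)]

/-! ### The Krein function off the spectrum -/

/-- The matrix `M` in terms of the values `a`, `b` at `0` of the solutions that are square
integrable on the right and on the left half line. -/
def valueMatrix (a b : C2) : Matrix (Fin 2) (Fin 2) ℂ :=
  (1 / wr a b) • !![2 * a 0 * b 0, a 0 * b 1 + a 1 * b 0;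
    a 0 * b 1 + a 1 * b 0, 2 * a 1 * b 1]

theorem mMatrix_eq_valueMatrix {a b : C2} (ha : a 1 ≠ 0) (hb : b 1 ≠ 0) :
    mMatrix (a 0 / a 1) (-(b 0 / b 1)) = valueMatrix a b := by
  have hs : a 0 / a 1 + -(b 0 / b 1) = -wr a b / (a 1 * b 1) := by
    unfold wr
    field_simp
    ring
  unfold mMatrix valueMatrix
  rw [hs]
  ext i j
  fin_cases i <;> fin_cases j <;> simp <;> field_simp

theorem tendsto_valueMatrix {ι : Type*} {l : Filter ι} {a b : ι → C2} {a₀ b₀ : C2}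
    (ha : Tendsto a l (𝓝 a₀)) (hb : Tendsto b l (𝓝 b₀)) (h : wr a₀ b₀ ≠ 0) :
    Tendsto (fun i => valueMatrix (a i) (b i)) l (𝓝 (valueMatrix a₀ b₀)) := by
  have ha' : ∀ i, Tendsto (fun k => a k i) l (𝓝 (a₀ i)) := fun i =>
    ((by fun_prop : Continuous fun v : C2 => v i).tendsto a₀).comp ha
  have hb' : ∀ i, Tendsto (fun k => b k i) l (𝓝 (b₀ i)) := fun i =>
    ((by fun_prop : Continuous fun v : C2 => v i).tendsto b₀).comp hb
  have hw : Tendsto (fun k => wr (a k) (b k)) l (𝓝 (wr a₀ b₀)) :=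
    ((ha' 1).mul (hb' 0)).sub ((ha' 0).mul (hb' 1))
  unfold valueMatrix
  refine (tendsto_const_nhds.div hw h).smul ?_
  refine tendsto_pi_nhds.2 fun i => tendsto_pi_nhds.2 fun j => ?_
  fin_cases i <;> fin_cases j
  · exact ((ha' 0).const_mul 2).mul (hb' 0)
  · exact ((ha' 0).mul (hb' 1)).add ((ha' 1).mul (hb' 0))
  · exact ((ha' 0).mul (hb' 1)).add ((ha' 1).mul (hb' 0))
  · exact ((ha' 1).const_mul 2).mul (hb' 1)

theorem det_valueMatrix {a b : C2} (h : wr a b ≠ 0) : (valueMatrix a b).det = -1 := by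
  rw [Matrix.det_fin_two]
  simp only [valueMatrix, Matrix.smul_apply, smul_eq_mul, Matrix.of_apply, Matrix.cons_val',
    Matrix.cons_val_zero, Matrix.cons_val_one, Matrix.cons_val_fin_one]
  field_simp
  unfold wr
  ring

/-- If `a` and `b` are multiples of real vectors, then `valueMatrix a b` is real. -/
theorem exists_valueMatrix_eq_map {a b : C2} (h : wr a b ≠ 0) (ha : wr a (cj a) = 0)
    (hb : wr b (cj b) = 0) : ∃ A : Matrix (Fin 2) (Fin 2) ℝ,
      valueMatrix a b = A.map (fun r : ℝ => (r : ℂ)) ∧ A 0 1 = A 1 0 ∧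
        A 0 0 * A 1 1 - A 0 1 ^ 2 = -1 := by
  have hreal : ∀ i j, (starRingEnd ℂ) (valueMatrix a b i j) = valueMatrix a b i j := by
    have h' : (starRingEnd ℂ) (wr a b) ≠ 0 := (map_ne_zero _).2 h
    have h2 : (starRingEnd ℂ) 2 = 2 := map_ofNat _ 2
    intro i j
    simp only [wr, cj_apply, map_sub, map_mul] at h h' ha hb
    fin_cases i <;> fin_cases j <;> simp [valueMatrix, wr, h2] <;> field_simp
    · linear_combination (starRingEnd ℂ) (b 0) * b 0 * ha - (starRingEnd ℂ) (a 0) * a 0 * hb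
    · linear_combination 2 * (starRingEnd ℂ) (b 1) * b 0 * ha - 2 * (starRingEnd ℂ) (a 1) * a 0 * hb
    · linear_combination 2 * (starRingEnd ℂ) (b 1) * b 0 * ha - 2 * (starRingEnd ℂ) (a 1) * a 0 * hb
    · linear_combination (starRingEnd ℂ) (b 1) * b 1 * ha - (starRingEnd ℂ) (a 1) * a 1 * hb
  have hmap : valueMatrix a b =
      (Matrix.of fun i j => (valueMatrix a b i j).re).map (fun r : ℝ => (r : ℂ)) := by
    ext i j
    exact (Complex.conj_eq_iff_re.1 (hreal i j)).symm
  refine ⟨_, hmap, by simp [valueMatrix], ?_⟩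
  have hdet := det_valueMatrix h
  rw [hmap, Matrix.det_fin_two] at hdet
  have e : valueMatrix a b 1 0 = valueMatrix a b 0 1 := by simp [valueMatrix]
  simp only [Matrix.map_apply, Matrix.of_apply, e] at hdet ⊢
  rw [sq]
  exact_mod_cast hdet

/-- Decomposition of `F` into a part that vanishes off `s` and one that vanishes on `s`. -/
theorem exists_indicator_L2 (F : L2) {s : Set ℝ} (hs : MeasurableSet s) :
    ∃ F₁ F₂ : L2, F = F₁ + F₂ ∧ (∀ᵐ x, x ∈ sᶜ → F₁ x = 0) ∧ ∀ᵐ x, x ∈ s → F₂ x = 0 := by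
  have h1 := (Lp.memLp F).indicator hs
  have h2 := (Lp.memLp F).indicator hs.compl
  refine ⟨h1.toLp _, h2.toLp _, ?_, ?_, ?_⟩
  · refine Lp.ext ?_
    filter_upwards [Lp.coeFn_add (h1.toLp _) (h2.toLp _), h1.coeFn_toLp, h2.coeFn_toLp]
      with x e1 e2 e3
    rw [e1, Pi.add_apply, e2, e3]
    exact (congrFun (Set.indicator_self_add_compl s F) x).symm
  · filter_upwards [h1.coeFn_toLp] with x hx hxs
    rw [hx, Set.indicator_of_notMem hxs]
  · filter_upwards [h2.coeFn_toLp] with x hx hxs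
    rw [hx, Set.indicator_of_notMem (by simpa using hxs)]

theorem wr_add_left (u v w : C2) : wr (u + v) w = wr u w + wr v w := by
  simp [wr]; ring

theorem wr_add_right (u v w : C2) : wr u (v + w) = wr u v + wr u w := by
  simp [wr]; ring

theorem wr_comm (u v : C2) : wr u v = -wr v u := by
  simp [wr]; ring

/-- Off the spectrum, `R F` is a solution on the half line where `F` vanishes, and is square
integrable there. The values at `0` of these solutions, for `F` supported on the left and on the
right half line, together span `ℂ²`, and each of the two families consists of multiples of one
vector, which may be taken to be real as the spectral parameter is real. They depend continuously
on the spectral parameter, so `M` has a limit that is a real symmetric matrix of determinant `-1`.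
-/
theorem krein_eq_proj (hW : IsCoefficient W) {t : ℝ} (ht : (t : ℂ) ∉ spectrumOp (diracOp W)) :
    ∃ α : ℝ, Tendsto (fun y : ℝ => kreinApprox W (t + y * Complex.I)) (𝓝[>] 0)
      (𝓝 ((proj α).map (fun r : ℝ => (r : ℂ)))) := by
  obtain ⟨R, ev, hev, hsurj⟩ := exists_evaluation hW ht
  have hright : ∀ F : L2, (∀ᵐ x, x ∈ Set.Ioi 0 → F x = 0) →
      ∃ u, IsSolution W t u ∧ u 0 = ev F ∧ MemLp u 2 (volume.restrict (Set.Ioi 0)) := by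
    intro F hF
    obtain ⟨y, hy, hRy, he, h0⟩ := hev F
    rw [← h0]
    exact exists_isSolution_Ioi hW hy ((Lp.memLp _).ae_eq hRy) (locallyIntegrable_L2 F) he hF
  have hleft : ∀ F : L2, (∀ᵐ x, x ∈ Set.Iic 0 → F x = 0) →
      ∃ u, IsSolution W t u ∧ u 0 = ev F ∧ MemLp u 2 (volume.restrict (Set.Iio 0)) := by
    intro F hF
    obtain ⟨y, hy, hRy, he, h0⟩ := hev F
    rw [← h0]
    exact exists_isSolution_Iio hW hy ((Lp.memLp _).ae_eq hRy) (locallyIntegrable_L2 F) he hF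
  have hrr : ∀ F G : L2, (∀ᵐ x, x ∈ Set.Ioi 0 → F x = 0) → (∀ᵐ x, x ∈ Set.Ioi 0 → G x = 0) →
      wr (ev F) (ev G) = 0 := by
    intro F G hF hG
    obtain ⟨u, hu, hu0, hu2⟩ := hright F hF
    obtain ⟨v, hv, hv0, hv2⟩ := hright G hG
    rw [← hu0, ← hv0]
    exact hu.wr_eq_zero hW hv hu2 hv2
  have hll : ∀ F G : L2, (∀ᵐ x, x ∈ Set.Iic 0 → F x = 0) → (∀ᵐ x, x ∈ Set.Iic 0 → G x = 0) →
      wr (ev F) (ev G) = 0 := by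
    intro F G hF hG
    obtain ⟨u, hu, hu0, hu2⟩ := hleft F hF
    obtain ⟨v, hv, hv0, hv2⟩ := hleft G hG
    rw [← hu0, ← hv0]
    exact hu.wr_eq_zero_Iio hW hv hu2 hv2
  -- Otherwise all values at `0` of elements of the domain would be multiples of one vector.
  obtain ⟨F, G, hF, hG, hFG⟩ : ∃ F G : L2, (∀ᵐ x, x ∈ Set.Ioi 0 → F x = 0) ∧
      (∀ᵐ x, x ∈ Set.Iic 0 → G x = 0) ∧ wr (ev F) (ev G) ≠ 0 := by
    by_contra! hcon
    obtain ⟨P, hP⟩ := hsurj (WithLp.toLp 2 ![1, 0])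
    obtain ⟨Q, hQ⟩ := hsurj (WithLp.toLp 2 ![0, 1])
    obtain ⟨P₁, P₂, rfl, hP₁, hP₂⟩ := exists_indicator_L2 P (measurableSet_Iic (a := (0 : ℝ)))
    obtain ⟨Q₁, Q₂, rfl, hQ₁, hQ₂⟩ := exists_indicator_L2 Q (measurableSet_Iic (a := (0 : ℝ)))
    rw [Set.compl_Iic] at hP₁ hQ₁
    have h0 : wr (ev (P₁ + P₂)) (ev (Q₁ + Q₂)) = 0 := by
      rw [map_add, map_add, wr_add_left, wr_add_right, wr_add_right, hrr P₁ Q₁ hP₁ hQ₁,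
        hll P₂ Q₂ hP₂ hQ₂, hcon P₁ Q₂ hP₁ hQ₂, wr_comm, hcon Q₁ P₂ hQ₁ hP₂]
      simp
    rw [hP, hQ] at h0
    simp [wr] at h0
  have ha : wr (ev F) (cj (ev F)) = 0 := by
    obtain ⟨u, hu, hu0, hu2⟩ := hright F hF
    have hc := hu.cj
    rw [Complex.conj_ofReal] at hc
    rw [← hu0]
    exact hu.wr_eq_zero hW hc hu2 (memLp_cj hu2)
  have hb : wr (ev G) (cj (ev G)) = 0 := by
    obtain ⟨u, hu, hu0, hu2⟩ := hleft G hG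
    have hc := hu.cj
    rw [Complex.conj_ofReal] at hc
    rw [← hu0]
    exact hu.wr_eq_zero_Iio hW hc hu2 (memLp_cj hu2)
  obtain ⟨A, hA, hAs, hAd⟩ := exists_valueMatrix_eq_map hFG ha hb
  obtain ⟨α, hα⟩ := exists_proj_of_real hAs hAd
  refine ⟨α, ?_⟩
  rw [← hα, ← hA]
  have htr : 0 ≤ (valueMatrix (ev F) (ev G)).trace.im := by
    rw [hA, Matrix.trace_fin_two]
    simp
  obtain ⟨a, hal, hae⟩ := exists_tendsto_evaluation hev F
  obtain ⟨b, hbl, hbe⟩ := exists_tendsto_evaluation hev G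
  have hw : Tendsto (fun y : ℝ => (y : ℂ) * Complex.I) (𝓝[>] 0) (𝓝 0) := by
    have : Continuous fun y : ℝ => (y : ℂ) * Complex.I := by fun_prop
    simpa using (this.tendsto 0).mono_left nhdsWithin_le_nhds
  have hlim := tendsto_valueMatrix (hal.comp hw) (hbl.comp hw) hFG
  refine tendsto_im_log (hlim.congr' ?_) (det_valueMatrix hFG) htr
  have hne : ∀ᶠ y : ℝ in 𝓝[>] 0, wr (a (y * Complex.I)) (b (y * Complex.I)) ≠ 0 :=
    (((continuous_wr.tendsto _).comp ((hal.comp hw).prodMk_nhds (hbl.comp hw)))).eventually_ne hFG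
  filter_upwards [eventually_im_pos t, hne, hw.eventually hae, hw.eventually hbe]
    with y hy hne ⟨f, hf, hf2, hfe, hf0⟩ ⟨g, hg, hg2, hge, hg0⟩
  obtain ⟨u, hu, hu0, hu2⟩ := exists_isSolution_Ioi hW hf hf2 (locallyIntegrable_L2 F) hfe hF
  obtain ⟨v, hv, hv0, hv2⟩ := exists_isSolution_Iio hW hg hg2 (locallyIntegrable_L2 G) hge hG
  rw [hf0] at hu0
  rw [hg0] at hv0
  have hu' : IsWeylSolution W (t + y * Complex.I) (Set.Ioi 0) u := by
    refine ⟨hu, fun h => hne ?_, hu2⟩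
    rw [← hu0, h]
    simp [wr]
  have hv' : IsWeylSolution W (t + y * Complex.I) (Set.Iio 0) v := by
    refine ⟨hv, fun h => hne ?_, hv2⟩
    rw [← hv0, h]
    simp [wr]
  rw [M_eq_mMatrix, mPlus_eq hW hy hu', mMinus_eq hW hy hv', mMatrix_eq_valueMatrix
    (hu'.apply_one_ne_zero hW hy) (hv'.apply_one_ne_zero_Iio hW hy), hu0, hv0]
  rfl

end Dirac

end

theorem proposition1p1 (W : ℝ → Matrix (Fin 2) (Fin 2) ℝ) (hW : Dirac.IsCoefficient W) :
    -- the Krein function exists almost everywhere, and has trace one wherever it exists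
    ((∀ᵐ t : ℝ, Dirac.KreinExistsAt W t) ∧
      ∀ t : ℝ, Dirac.KreinExistsAt W t → (Dirac.krein W t).trace = 1) ∧
    -- reflectionless on `E` if and only if `ξ = 1/2` almost everywhere on `E`
    (∀ E : Set ℝ, MeasurableSet E →
      (Dirac.IsReflectionless W E ↔
        ∀ᵐ t : ℝ, t ∈ E → Dirac.krein W t = (1 / 2 : ℂ) • (1 : Matrix (Fin 2) (Fin 2) ℂ))) ∧
    -- off the spectrum, `ξ(t)` exists and is a projection `P_α`
    (∀ t : ℝ, (t : ℂ) ∉ Dirac.spectrumOp (Dirac.diracOp W) →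
      Dirac.KreinExistsAt W t ∧
        ∃ α : ℝ, Dirac.krein W t = (Dirac.proj α).map (fun r : ℝ => (r : ℂ))) := by
  refine ⟨⟨?_, fun t => Dirac.trace_krein hW⟩, fun E _ => Dirac.isReflectionless_iff hW E,
    fun t ht => ?_⟩
  · filter_upwards [Dirac.ae_boundary_values hW] with t ⟨a, b, ha, hb, hai, hbi, hab⟩
    exact ⟨_, Dirac.tendsto_kreinApprox ha hb hai hbi hab⟩
  · obtain ⟨α, hα⟩ := Dirac.krein_eq_proj hW ht
    exact ⟨⟨_, hα⟩, α, Dirac.krein_eq hα⟩
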